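/- Let $p,q\in\mathbb C$ with $0<|p|,|q|<1$, let $\sqrt{pq}$ be a fixed square root of $pq$, and put $(z;q)_\infty=\prod_{j\ge0}(1-zq^j)$, $\theta(z;p)=(z;p)_\infty(p/z;p)_\infty$, $\theta(z)_n=\prod_{j=0}^{n-1}\theta(zq^j;p)$, $$\Gamma(z)=\Gamma(z;p,q)=\prod_{j,k\ge0}\frac{1-z^{-1}p^{j+1}q^{k+1}}{1-zp^jq^k},\qquad \kappa=\frac{(p;p)_\infty(q;q)_\infty}{4\pi i}.$$ Write $\Gamma(a,b,\dots)=\Gamma(a)\Gamma(b)\cdots$, where a sign $\pm1$ in an exponent means the product over both signs. For functions $f$ analytic near the positively oriented unit circle $\mathbb T$ and $|tw|,|t/w|<1$ let $$[M(t)f](w)=\kappa\int_{\mathbb T}\frac{\Gamma(tw^{\pm1}z^{\pm1})}{\Gamma(t^2,z^{\pm2})}f(z)\frac{dz}{z},\qquad D(s;y,w)=\Gamma\big(\sqrt{pq}\,s^{-1}y^{\pm1}w^{\pm1}\big).$$ For $0\le m\le n$ let $$M_{nm}(a,k)=\frac{\theta(k)_{n+m}\theta(k/a)_{n-m}}{\theta(qa)_{n+m}\theta(q)_{n-m}}\frac{\theta(aq^{2m};p)}{\theta(a;p)}a^{n-m},\qquad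 D_m(a;b,c)=\frac{\theta(b)_m\theta(c)_m}{\theta(qa/b)_m\theta(qa/c)_m}\Big(\frac{qa}{bc}\Big)^m,$$ and $M_{nm}(a,k)=0$ for $m>n$; let $M(a,k)=(M_{nm}(a,k))_{n,m=0}^N$ and let $D(a;b,c)$ be the diagonal matrix with entries $D_m(a;b,c)$, $0\le m\le N$. Let $N\ge0$ be an integer and $s,t,y,z_0\in\mathbb C^*$ with $|s|,|t|,|z_0|<1$ and $|\sqrt{pq}\,s^{-1}t^{-1}y^{\pm1}|<1$, and put $$\tilde t=z_0^2,\quad a=t^2z_0^2,\quad k=s^2t^2z_0^2,\quad b=\sqrt{\tfrac{pq\tilde ta}{k}}\,y,\quad c=\sqrt{\tfrac{q\tilde ta}{pk}}\,y^{-1},$$ with the branches $\sqrt{pq\tilde ta/k}=\sqrt{pq}\,z_0/s$ and $\sqrt{q\tilde ta/(pk)}=\sqrt{pq}\,z_0/(ps)$. Assume that the parameters are generic in the following sense: $p^i\ne q^j$ for $i\ge1$, $1\le j\le N$, and for all integers $i,j\ge0$ $$(z_0q^N)^2\ne p^iq^j,\quad (tz_0q^N)^2\ne p^iq^j,\quad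 tz_0q^N\ne\sqrt{pq}\,(st)^{-1}y^{\pm1}p^iq^j,\quad z_0q^N\ne\sqrt{pq}\,s^{-1}y^{\pm1}p^iq^j .$$ Then $kbc=qa\tilde t$ and the following hold. (1) Let $\alpha$ be a function with $\alpha(z^{-1})=\alpha(z)$ that is analytic in $\mathbb C^*$ except for at most simple poles at $z=(z_0q^m)^{\pm1}$, $m=0,\dots,N$, and let $\tilde\alpha_m=\lim_{z\to z_0q^m}(1-z_0q^m/z)\alpha(z)$. Both sides of the star-triangle relation $$M(s)_{wx}D(st;y,x)M(t)_{xz}\,\alpha(z)=D(t;y,w)M(st)_{wz}D(s;y,z)\,\alpha(z),$$ as functions of $w$ in the annulus $|s|<|w|<|s|^{-1}$, have a meromorphic continuation to $w\in\mathbb C^*$. Set $w=\epsilon^{-1}stz_0q^N$ in these continuations, multiply by $1-\epsilon$ and let $\epsilon\to1$. Then the left-hand side tends to $$\frac{\Gamma(k,b,pc)\,q^{N(N+1)}}{\Gamma(\tilde t,qa/c,pqa/b)}\sum_{n,m=0}^NM_{Nn}(a,k)D_n(a;b,c)M_{nm}(\tilde t,a)\,q^{-m(m+1)}\tilde\alpha_m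 ,$$ and the right-hand side tends to $$\frac{\Gamma(k,b,pc)\,q^{N(N+1)}}{\Gamma(\tilde t,qa/c,pqa/b)}\sum_{m=0}^ND_N(k;q\tilde t/c,q\tilde t/b)M_{Nm}(\tilde t,k)D_m(\tilde t;b,c)\,q^{-m(m+1)}\tilde\alpha_m .$$ (2) The resulting matrix identity holds: $$M(a,k)D(a;b,c)M(\tilde t,a)=D(k;q\tilde t/c,q\tilde t/b)M(\tilde t,k)D(\tilde t;b,c).$$ -/

import Mathlib

open Filter Topology

noncomputable section

namespace EllipticBailey

/-- The infinite product `(z;q)_∞ = ∏_{j ≥ 0} (1 - z q^j)`. -/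
def qPoch (z q : ℂ) : ℂ := ∏' j : ℕ, (1 - z * q ^ j)

/-- The short Jacobi theta function `θ(z;p) = (z;p)_∞ (p/z;p)_∞`. -/
def theta (p z : ℂ) : ℂ := qPoch z p * qPoch (p * z⁻¹) p

/-- The elliptic gamma function
`Γ(z;p,q) = ∏_{j,k ≥ 0} (1 - z⁻¹ p^{j+1} q^{k+1}) / (1 - z p^j q^k)`. -/
def ellGamma (p q z : ℂ) : ℂ :=
  (∏' jk : ℕ × ℕ, (1 - z⁻¹ * p ^ (jk.1 + 1) * q ^ (jk.2 + 1))) /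
    ∏' jk : ℕ × ℕ, (1 - z * p ^ jk.1 * q ^ jk.2)

/-- `Γ(t w^{±1} z^{±1};p,q)`, a product of four elliptic gamma functions. -/
def ellGamma4 (p q t w z : ℂ) : ℂ :=
  ellGamma p q (t * w * z) * ellGamma p q (t * w * z⁻¹) *
    ellGamma p q (t * w⁻¹ * z) * ellGamma p q (t * w⁻¹ * z⁻¹)

/-- `κ = (p;p)_∞ (q;q)_∞ / (4πi)`. -/
def kappa (p q : ℂ) : ℂ := qPoch p p * qPoch q q / (4 * Real.pi * Complex.I)

/-- The elliptic Fourier transformation `M(t)_{wz} f(z)`, an integral over the positively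
oriented unit circle; it is used for `|t w|, |t / w| < 1` only. -/
def opM (p q t : ℂ) (f : ℂ → ℂ) (w : ℂ) : ℂ :=
  kappa p q * ∮ z in C(0, 1),
    ellGamma4 p q t w z /
      (ellGamma p q (t ^ 2) * (ellGamma p q (z ^ 2) * ellGamma p q ((z ^ 2)⁻¹))) * f z / z

/-- `D(s;y,w) = Γ(√(pq) s⁻¹ y^{±1} w^{±1};p,q)`, where `r` is the chosen root `√(pq)`. -/
def opD (p q r s y w : ℂ) : ℂ := ellGamma4 p q (r * s⁻¹) y w

/-- The left-hand side `M(s)_{wx} D(st;y,x) M(t)_{xz} α(z)` of the star-triangle relation. -/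
def starLHS (p q r s t y : ℂ) (α : ℂ → ℂ) (w : ℂ) : ℂ :=
  opM p q s (fun x => opD p q r (s * t) y x * opM p q t α x) w

/-- The right-hand side `D(t;y,w) M(st)_{wz} D(s;y,z) α(z)` of the star-triangle relation. -/
def starRHS (p q r s t y : ℂ) (α : ℂ → ℂ) (w : ℂ) : ℂ :=
  opD p q r t y w * opM p q (s * t) (fun z => opD p q r s y z * α z) w

/-- `F` is the continuation, meromorphic in the punctured plane, of a function `f` given on the
annulus `|s| < |w| < |s|⁻¹` (the values of `w` with `|s w|, |s / w| < 1`). It is unique up to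
values at isolated points. -/
def IsContinuation (s : ℂ) (f F : ℂ → ℂ) : Prop :=
  MeromorphicOn F {w | w ≠ 0} ∧ ∀ w : ℂ, ‖s‖ < ‖w‖ → ‖s * w‖ < 1 → F w = f w

/-- `α` is invariant under `z ↦ z⁻¹` and analytic in the punctured plane, except for at most
simple poles at `z = (z₀ q^m)^{±1}`, `m = 0, …, N`, and
`res m = lim_{z → z₀ q^m} (1 - z₀ q^m / z) α(z)`. -/
structure IsTestFunction (q z₀ : ℂ) (N : ℕ) (α : ℂ → ℂ) (res : ℕ → ℂ) : Prop where
  symm : ∀ z : ℂ, z ≠ 0 → α z⁻¹ = α z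
  analytic : ∀ z : ℂ, z ≠ 0 → (∀ m ≤ N, z ≠ z₀ * q ^ m ∧ z ≠ (z₀ * q ^ m)⁻¹) → AnalyticAt ℂ α z
  residue : ∀ m ≤ N,
    Tendsto (fun z => (1 - z₀ * q ^ m / z) * α z) (𝓝[≠] (z₀ * q ^ m)) (𝓝 (res m))

/-- The elliptic Pochhammer symbol `θ(z)_n = ∏_{j < n} θ(z q^j;p)`, `n ≥ 0`. -/
def thetaPoch (p q z : ℂ) (n : ℕ) : ℂ := ∏ j ∈ Finset.range n, theta p (z * q ^ j)

/-- The entries `M_{nm}(a,k)`; they vanish for `m > n`, because `1/θ(q)_{n-m} = 0` then. -/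
def entryM (p q a k : ℂ) (n m : ℕ) : ℂ :=
  if m ≤ n then
    thetaPoch p q k (n + m) * thetaPoch p q (k / a) (n - m) /
      (thetaPoch p q (q * a) (n + m) * thetaPoch p q q (n - m)) *
      (theta p (a * q ^ (2 * m)) / theta p a) * a ^ (n - m)
  else 0

/-- The diagonal entries `D_m(a;b,c)`. -/
def entryD (p q a b c : ℂ) (m : ℕ) : ℂ :=
  thetaPoch p q b m * thetaPoch p q c m /
    (thetaPoch p q (a * q / b) m * thetaPoch p q (a * q / c) m) * (a * q / (b * c)) ^ m

/-- The matrix `M(a,k)` of size `N + 1`. -/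
def matM (p q : ℂ) (N : ℕ) (a k : ℂ) : Matrix (Fin (N + 1)) (Fin (N + 1)) ℂ :=
  Matrix.of fun n m => entryM p q a k n m

/-- The diagonal matrix `D(a;b,c)` of size `N + 1`. -/
def matD (p q : ℂ) (N : ℕ) (a b c : ℂ) : Matrix (Fin (N + 1)) (Fin (N + 1)) ℂ :=
  Matrix.diagonal fun m => entryD p q a b c m

/-- The common factor `q^{N(N+1)} Γ(k, b, pc;p,q) / Γ(τ, qa/c, pqa/b;p,q)` of both limits. -/
def prefactor (p q : ℂ) (N : ℕ) (τ a k b c : ℂ) : ℂ :=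
  q ^ (N * (N + 1)) * (ellGamma p q k * ellGamma p q b * ellGamma p q (p * c)) /
    (ellGamma p q τ * ellGamma p q (q * a / c) * ellGamma p q (p * q * a / b))

end EllipticBailey

end

noncomputable section

namespace EllipticBailey

/-! ### Infinite products -/

/-- The product `∏ᵢ (1 - v cᵢ)` of a summable family `c`, as a function of `v`. -/
def eulerProd {ι : Type*} (c : ι → ℂ) (v : ℂ) : ℂ := ∏' i, (1 - v * c i)

section EulerProd

variable {ι κ : Type*} {c : ι → ℂ}

lemma multipliable_eulerProd (hc : Summable fun i => ‖c i‖) (v : ℂ) :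
    Multipliable fun i => 1 - v * c i := by
  have h : Summable fun i => ‖-(v * c i)‖ := by
    simpa only [norm_neg, norm_mul] using hc.mul_left ‖v‖
  simpa only [sub_eq_add_neg] using multipliable_one_add_of_summable h

lemma eulerProd_eq_zero_iff (hc : Summable fun i => ‖c i‖) (v : ℂ) :
    eulerProd c v = 0 ↔ ∃ i, v * c i = 1 := by
  constructor
  · intro h
    by_contra! hne
    refine tprod_one_add_ne_zero_of_summable (f := fun i => -(v * c i)) (fun i => ?_) ?_
      (by simpa only [sub_eq_add_neg, eulerProd] using h)
    · rw [← sub_eq_add_neg]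
      exact sub_ne_zero.2 (hne i).symm
    · simpa only [norm_neg, norm_mul] using hc.mul_left ‖v‖
  · rintro ⟨i, hi⟩
    exact tprod_of_exists_eq_zero ⟨i, by rw [hi, sub_self]⟩

lemma eulerProd_ne_zero_of_norm_lt (hc : Summable fun i => ‖c i‖) {v : ℂ}
    (h : ∀ i, ‖v * c i‖ < 1) : eulerProd c v ≠ 0 := by
  rw [Ne, eulerProd_eq_zero_iff hc]
  rintro ⟨i, hi⟩
  simpa [hi] using h i

lemma differentiable_eulerProd (hc : Summable fun i => ‖c i‖) :
    Differentiable ℂ (eulerProd c) := by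
  intro v
  have hs : Summable fun i => (‖v‖ + 1) * ‖c i‖ := hc.mul_left _
  have hprod := hs.hasProdLocallyUniformlyOn_one_add (K := Metric.ball (0 : ℂ) (‖v‖ + 1))
    (f := fun i x => -(x * c i)) Metric.isOpen_ball
    (Eventually.of_forall fun i x hx => by
      rw [norm_neg, norm_mul]
      exact mul_le_mul_of_nonneg_right (mem_ball_zero_iff.1 hx).le (norm_nonneg _))
    (fun i => by fun_prop)
  have hd := hprod.differentiableOn
    (.of_forall fun _ => by
      simpa [Finset.prod_fn] using DifferentiableOn.finsetProd (fun _ _ => by fun_prop))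
    Metric.isOpen_ball
  have := (hd v (by simp)).differentiableAt (Metric.isOpen_ball.mem_nhds (by simp))
  have heq : eulerProd c = fun x => ∏' i, (1 + -(x * c i)) := by
    ext x
    simp only [eulerProd, sub_eq_add_neg]
  rw [heq]
  exact this

lemma eulerProd_eq_mul_of_isCompl {κ' : Type*} (hc : Summable fun i => ‖c i‖) {e : κ → ι}
    {e' : κ' → ι} (he : Function.Injective e) (he' : Function.Injective e')
    (hcompl : IsCompl (Set.range e) (Set.range e')) (v : ℂ) :
    eulerProd c v = eulerProd (c ∘ e) v * eulerProd (c ∘ e') v := by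
  have h1 : HasProd ((fun i => 1 - v * c i) ∘ e) (eulerProd (c ∘ e) v) :=
    (multipliable_eulerProd (c := c ∘ e) (hc.comp_injective he) v).hasProd
  have h2 : HasProd ((fun i => 1 - v * c i) ∘ e') (eulerProd (c ∘ e') v) :=
    (multipliable_eulerProd (c := c ∘ e') (hc.comp_injective he') v).hasProd
  exact ((he.hasProd_range_iff.2 h1).mul_isCompl hcompl (he'.hasProd_range_iff.2 h2)).tprod_eq

lemma eulerProd_eq_prod_mul (hc : Summable fun i => ‖c i‖) (s : Finset ι) (v : ℂ) :
    eulerProd c v = (∏ i ∈ s, (1 - v * c i)) * eulerProd (fun i : {i // i ∉ s} => c i) v := by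
  have := eulerProd_eq_mul_of_isCompl hc (e := fun i : s => (i : ι))
    (e' := fun i : {i // i ∉ s} => (i : ι)) Subtype.val_injective Subtype.val_injective
    (by
      have h1 : Set.range (fun i : s => (i : ι)) = {i | i ∈ s} := by ext; simp
      have h2 : Set.range (fun i : {i // i ∉ s} => (i : ι)) = {i | i ∈ s}ᶜ := by ext; simp
      rw [h1, h2]
      exact isCompl_compl) v
  rw [this]
  congr 1
  rw [eulerProd, tprod_fintype, Finset.univ_eq_attach]
  exact s.prod_attach fun i => 1 - v * c i

end EulerProd

/-! ### The products `(z;q)_∞` and `(z;p,q)_∞` -/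

lemma summable_norm_pow {q : ℂ} (hq : ‖q‖ < 1) : Summable fun j : ℕ => ‖q ^ j‖ := by
  simpa only [norm_pow] using summable_geometric_of_lt_one (norm_nonneg _) hq

lemma summable_norm_pow_mul_pow {p q : ℂ} (hp : ‖p‖ < 1) (hq : ‖q‖ < 1) :
    Summable fun jk : ℕ × ℕ => ‖p ^ jk.1 * q ^ jk.2‖ :=
  (summable_norm_pow hp).mul_norm (summable_norm_pow hq)

/-- The double product `(z;p,q)_∞ = ∏_{j,k ≥ 0} (1 - z p^j q^k)`. -/
def dPoch (p q z : ℂ) : ℂ := eulerProd (fun jk : ℕ × ℕ => p ^ jk.1 * q ^ jk.2) z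

section

variable {p q : ℂ}

lemma qPoch_eq_zero_iff (hq : ‖q‖ < 1) (z : ℂ) : qPoch z q = 0 ↔ ∃ j : ℕ, z * q ^ j = 1 :=
  eulerProd_eq_zero_iff (summable_norm_pow hq) z

lemma differentiable_qPoch (hq : ‖q‖ < 1) : Differentiable ℂ fun z => qPoch z q :=
  differentiable_eulerProd (summable_norm_pow hq)

lemma qPoch_eq_mul (hq : ‖q‖ < 1) (z : ℂ) : qPoch z q = (1 - z) * qPoch (z * q) q := by
  have h := eulerProd_eq_mul_of_isCompl (summable_norm_pow hq) (e := fun _ : Unit => 0)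
    (e' := Nat.succ) (fun _ _ _ => rfl) Nat.succ_injective
    (by
      rw [isCompl_iff, Set.disjoint_iff, codisjoint_iff_le_sup]
      constructor
      · rintro x ⟨⟨_, rfl⟩, ⟨j, hj⟩⟩
        exact (Nat.succ_ne_zero j hj).elim
      · rintro (_ | j) -
        · exact Or.inl ⟨(), rfl⟩
        · exact Or.inr ⟨j, rfl⟩) z
  change eulerProd _ z = _ * eulerProd _ _
  rw [h]
  congr 1
  · simp [eulerProd]
  · simp only [eulerProd, Function.comp, pow_succ]
    congr 1
    ext j
    ring

lemma qPoch_ne_zero_of_norm_lt (hq : ‖q‖ < 1) {z : ℂ} (hz : ‖z‖ < 1) : qPoch z q ≠ 0 := by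
  refine eulerProd_ne_zero_of_norm_lt (summable_norm_pow hq) fun j => ?_
  rw [norm_mul, norm_pow]
  exact (mul_le_of_le_one_right (norm_nonneg _) (pow_le_one₀ (norm_nonneg _) hq.le)).trans_lt hz

lemma dPoch_eq_zero_iff (hp : ‖p‖ < 1) (hq : ‖q‖ < 1) (z : ℂ) :
    dPoch p q z = 0 ↔ ∃ i j : ℕ, z * (p ^ i * q ^ j) = 1 := by
  simp [dPoch, eulerProd_eq_zero_iff (summable_norm_pow_mul_pow hp hq)]

lemma norm_pow_mul_pow_le_one (hp : ‖p‖ < 1) (hq : ‖q‖ < 1) (i j : ℕ) :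
    ‖p ^ i * q ^ j‖ ≤ 1 := by
  rw [norm_mul, norm_pow, norm_pow]
  exact mul_le_one₀ (pow_le_one₀ (norm_nonneg _) hp.le) (by positivity)
    (pow_le_one₀ (norm_nonneg _) hq.le)

lemma dPoch_ne_zero_of_norm_lt (hp : ‖p‖ < 1) (hq : ‖q‖ < 1) {z : ℂ} (hz : ‖z‖ < 1) :
    dPoch p q z ≠ 0 := by
  refine eulerProd_ne_zero_of_norm_lt (summable_norm_pow_mul_pow hp hq) fun jk => ?_
  rw [norm_mul]
  exact (mul_le_of_le_one_right (norm_nonneg _)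
    (norm_pow_mul_pow_le_one hp hq _ _)).trans_lt hz

lemma differentiable_dPoch (hp : ‖p‖ < 1) (hq : ‖q‖ < 1) : Differentiable ℂ (dPoch p q) :=
  differentiable_eulerProd (summable_norm_pow_mul_pow hp hq)

lemma dPoch_eq_mul_right (hp : ‖p‖ < 1) (hq : ‖q‖ < 1) (z : ℂ) :
    dPoch p q z = qPoch z p * dPoch p q (z * q) := by
  have h := eulerProd_eq_mul_of_isCompl (summable_norm_pow_mul_pow hp hq)
    (e := fun j : ℕ => (j, 0)) (e' := fun jk : ℕ × ℕ => (jk.1, jk.2 + 1))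
    (fun _ _ h => by simpa using h) (fun _ _ h => by simpa [Prod.ext_iff] using h)
    (by
      rw [isCompl_iff, Set.disjoint_iff, codisjoint_iff_le_sup]
      constructor
      · rintro x ⟨⟨j, rfl⟩, ⟨jk, hjk⟩⟩
        simp [Prod.ext_iff] at hjk
      · rintro ⟨j, k⟩ -
        rcases k with _ | k
        · exact Or.inl ⟨j, rfl⟩
        · exact Or.inr ⟨(j, k), rfl⟩) z
  rw [dPoch, h]
  congr 1
  · simp [eulerProd, qPoch, Function.comp]
  · simp only [eulerProd, dPoch, Function.comp, pow_succ]
    congr 1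
    ext j
    ring

lemma dPoch_comm (p q z : ℂ) : dPoch p q z = dPoch q p z := by
  simp only [dPoch, eulerProd]
  rw [← (Equiv.prodComm ℕ ℕ).tprod_eq]
  simp [mul_comm]

lemma dPoch_eq_mul_left (hp : ‖p‖ < 1) (hq : ‖q‖ < 1) (z : ℂ) :
    dPoch p q z = qPoch z q * dPoch p q (z * p) := by
  rw [dPoch_comm, dPoch_eq_mul_right hq hp, dPoch_comm]

/-! ### Theta functions -/

lemma theta_inv (hp : ‖p‖ < 1) {z : ℂ} (hz : z ≠ 0) : theta p z⁻¹ = -z⁻¹ * theta p z := by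
  rw [theta, theta, qPoch_eq_mul hp z⁻¹, qPoch_eq_mul hp z, inv_inv, mul_comm p z, mul_comm p z⁻¹]
  field_simp
  ring

lemma theta_mul_left (hp0 : p ≠ 0) (hp : ‖p‖ < 1) {z : ℂ} (hz : z ≠ 0) :
    theta p (p * z) = -z⁻¹ * theta p z := by
  rw [← theta_inv hp hz, theta, theta, inv_inv, mul_inv, ← mul_assoc, mul_inv_cancel₀ hp0,
    one_mul, mul_comm]

lemma theta_one (hp : ‖p‖ < 1) : theta p 1 = 0 := by
  rw [theta, (qPoch_eq_zero_iff hp 1).2 ⟨0, by simp⟩, zero_mul]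

lemma theta_eq_zero_iff (hp0 : p ≠ 0) (hp : ‖p‖ < 1) {z : ℂ} (hz : z ≠ 0) :
    theta p z = 0 ↔ ∃ n : ℤ, z = p ^ n := by
  rw [theta, mul_eq_zero, qPoch_eq_zero_iff hp, qPoch_eq_zero_iff hp]
  constructor
  · rintro (⟨j, hj⟩ | ⟨j, hj⟩)
    · refine ⟨-(j : ℤ), ?_⟩
      rw [zpow_neg, zpow_natCast]
      exact eq_inv_of_mul_eq_one_left hj
    · refine ⟨(j + 1 : ℕ), ?_⟩
      rw [zpow_natCast, pow_succ]
      field_simp at hj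
      rw [← hj]
      ring
  · rintro ⟨n, hn⟩
    rcases lt_or_ge 0 n with h | h
    · right
      obtain ⟨j, rfl⟩ : ∃ j : ℕ, n = (j + 1 : ℕ) := ⟨(n - 1).toNat, by omega⟩
      refine ⟨j, ?_⟩
      rw [hn, zpow_natCast, pow_succ]
      field_simp
    · left
      obtain ⟨j, rfl⟩ : ∃ j : ℕ, n = -(j : ℤ) := ⟨(-n).toNat, by omega⟩
      refine ⟨j, ?_⟩
      rw [hn, zpow_neg, zpow_natCast]
      field_simp

lemma differentiableAt_theta (hp : ‖p‖ < 1) {z : ℂ} (hz : z ≠ 0) :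
    DifferentiableAt ℂ (theta p) z := by
  have h1 : DifferentiableAt ℂ (fun z => qPoch z p) z := differentiable_qPoch hp z
  have h2 : DifferentiableAt ℂ (fun z => qPoch (p * z⁻¹) p) z :=
    DifferentiableAt.fun_comp' z (g := fun z => qPoch z p) (differentiable_qPoch hp _) (by fun_prop (disch := assumption))
  exact h1.mul h2

/-! ### The elliptic gamma function -/

lemma ellGamma_eq_div (p q z : ℂ) : ellGamma p q z = dPoch p q (p * q * z⁻¹) / dPoch p q z := by
  simp only [ellGamma, dPoch, eulerProd, pow_succ]
  congr 2
  · ext jk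
    ring
  · ext jk
    ring

lemma ellGamma_mul_right (hp : ‖p‖ < 1) (hq0 : q ≠ 0) (hq : ‖q‖ < 1) {z : ℂ}
    (h : dPoch p q z ≠ 0) : ellGamma p q (z * q) = theta p z * ellGamma p q z := by
  have e1 := dPoch_eq_mul_right hp hq z
  have e2 := dPoch_eq_mul_right hp hq (p * z⁻¹)
  have e3 : p * q * (z * q)⁻¹ = p * z⁻¹ := by
    rw [mul_inv]
    field_simp
  have e4 : p * z⁻¹ * q = p * q * z⁻¹ := by ring
  rw [e4] at e2
  have h1 : qPoch z p ≠ 0 := fun h0 => h (by rw [e1, h0, zero_mul])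
  have h2 : dPoch p q (z * q) ≠ 0 := fun h0 => h (by rw [e1, h0, mul_zero])
  rw [ellGamma_eq_div, ellGamma_eq_div, e3, e2, theta, e1]
  field_simp

lemma ellGamma_mul_pow (hp : ‖p‖ < 1) (hq0 : q ≠ 0) (hq : ‖q‖ < 1) {z : ℂ} (n : ℕ)
    (h : dPoch p q z ≠ 0) :
    ellGamma p q (z * q ^ n) = thetaPoch p q z n * ellGamma p q z := by
  have hn : ∀ n : ℕ, dPoch p q (z * q ^ n) ≠ 0 := by
    intro n h0
    refine h ((dPoch_eq_zero_iff hp hq _).2 ?_)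
    obtain ⟨i, j, hij⟩ := (dPoch_eq_zero_iff hp hq _).1 h0
    exact ⟨i, n + j, by rw [← hij]; ring⟩
  induction n with
  | zero => simp [thetaPoch]
  | succ n ih =>
    rw [pow_succ, ← mul_assoc, ellGamma_mul_right hp hq0 hq (hn n), ih, thetaPoch, thetaPoch,
      Finset.prod_range_succ]
    ring

lemma ellGamma_mul_reflect (hp0 : p ≠ 0) (hq0 : q ≠ 0) {z : ℂ}
    (h : dPoch p q z ≠ 0) (h' : dPoch p q (p * q * z⁻¹) ≠ 0) :
    ellGamma p q z * ellGamma p q (p * q * z⁻¹) = 1 := by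
  have e : p * q * (p * q * z⁻¹)⁻¹ = z := by
    rw [mul_inv, inv_inv, ← mul_assoc, mul_inv_cancel₀ (mul_ne_zero hp0 hq0), one_mul]
  rw [ellGamma_eq_div, ellGamma_eq_div, e, div_mul_div_cancel₀ h, div_self h']

end

end EllipticBailey

end

noncomputable section

namespace EllipticBailey

section Weierstrass

variable {p : ℂ}

/-! ### The addition formula for theta functions -/

lemma exists_zpow_mul_mem_annulus (hp0 : p ≠ 0) (hp : ‖p‖ < 1) {x : ℂ} (hx : x ≠ 0) :
    ∃ n : ℤ, ‖p‖ ≤ ‖p ^ n * x‖ ∧ ‖p ^ n * x‖ ≤ 1 := by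
  have hp' : 0 < ‖p‖ := norm_pos_iff.2 hp0
  obtain ⟨n, hn1, hn2⟩ := exists_mem_Ico_zpow (norm_pos_iff.2 hx) (one_lt_inv₀ hp' |>.2 hp)
  refine ⟨n + 1, ?_, ?_⟩
  · rw [norm_mul, norm_zpow, zpow_add₀ hp'.ne', zpow_one, mul_right_comm]
    rw [inv_zpow, inv_le_iff_one_le_mul₀' (zpow_pos hp' n)] at hn1
    exact le_mul_of_one_le_left hp'.le hn1
  · rw [norm_mul, norm_zpow]
    rw [inv_zpow, lt_inv_comm₀ (norm_pos_iff.2 hx) (zpow_pos hp' _)] at hn2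
    exact (le_inv_mul_iff₀' (norm_pos_iff.2 hx)).1 (by simpa using hn2.le)

lemma eq_of_multiplicatively_periodic (hp0 : p ≠ 0) (hp : ‖p‖ < 1) {h : ℂ → ℂ}
    (hd : ∀ x, x ≠ 0 → DifferentiableAt ℂ h x) (hper : ∀ x, x ≠ 0 → h (p * x) = h x)
    {x y : ℂ} (hx : x ≠ 0) (hy : y ≠ 0) : h x = h y := by
  have hz : ∀ (n : ℤ) (x : ℂ), x ≠ 0 → h (p ^ n * x) = h x := by
    intro n
    induction n with
    | zero => simp
    | succ n ih =>
      intro x hx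
      rw [zpow_add_one₀ hp0, mul_assoc, ih _ (mul_ne_zero hp0 hx), hper x hx]
    | pred n ih =>
      intro x hx
      have h1 : p⁻¹ * x ≠ 0 := mul_ne_zero (inv_ne_zero hp0) hx
      rw [zpow_sub_one₀ hp0, mul_assoc, ih _ h1, ← hper _ h1, mul_inv_cancel_left₀ hp0]
  have hK : IsCompact {x : ℂ | ‖p‖ ≤ ‖x‖ ∧ ‖x‖ ≤ 1} := by
    refine Metric.isCompact_of_isClosed_isBounded ?_ ?_
    · exact (isClosed_le continuous_const continuous_norm).inter
        (isClosed_le continuous_norm continuous_const)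
    · exact (Metric.isBounded_closedBall (x := (0 : ℂ)) (r := 1)).subset fun x hx => by
        simpa using hx.2
  have hcont : ContinuousOn h {x : ℂ | ‖p‖ ≤ ‖x‖ ∧ ‖x‖ ≤ 1} := fun x hx =>
    (hd x (norm_pos_iff.1 ((norm_pos_iff.2 hp0).trans_le hx.1))).continuousAt.continuousWithinAt
  have hent : Differentiable ℂ fun w => h (Complex.exp w) := fun w =>
    DifferentiableAt.fun_comp' w (hd _ (Complex.exp_ne_zero w)) (by fun_prop)
  have hb : Bornology.IsBounded (Set.range fun w => h (Complex.exp w)) := by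
    refine (hK.image_of_continuousOn hcont).isBounded.subset ?_
    rintro _ ⟨w, rfl⟩
    obtain ⟨n, hn⟩ := exists_zpow_mul_mem_annulus hp0 hp (Complex.exp_ne_zero w)
    exact ⟨_, hn, hz n _ (Complex.exp_ne_zero w)⟩
  have := hent.apply_eq_apply_of_bounded hb (Complex.log x) (Complex.log y)
  simpa [Complex.exp_log hx, Complex.exp_log hy] using this

/-- Two functions holomorphic on the punctured plane with the same multiplier `x⁻²` are
proportional if one of them vanishes at the zeros of the other, and these are simple. -/
lemma exists_eq_mul_of_quasiperiodic (hp0 : p ≠ 0) (hp : ‖p‖ < 1) {f g : ℂ → ℂ}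
    (hf : ∀ x, x ≠ 0 → DifferentiableAt ℂ f x) (hg : ∀ x, x ≠ 0 → DifferentiableAt ℂ g x)
    (hfp : ∀ x, x ≠ 0 → f (p * x) = (x ^ 2)⁻¹ * f x)
    (hgp : ∀ x, x ≠ 0 → g (p * x) = (x ^ 2)⁻¹ * g x)
    (h0 : ∀ x, x ≠ 0 → g x = 0 → f x = 0 ∧ deriv g x ≠ 0) :
    ∃ C, ∀ x, x ≠ 0 → f x = C * g x := by
  classical
  set h : ℂ → ℂ := fun x => if g x = 0 then deriv f x / deriv g x else f x / g x with hh
  have hopen : IsOpen {x : ℂ | x ≠ 0} := isOpen_ne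
  have hd : ∀ x, x ≠ 0 → DifferentiableAt ℂ h x := by
    intro x hx
    by_cases hgx : g x = 0
    · obtain ⟨hfx, hg'⟩ := h0 x hx hgx
      have hds : ∀ {F : ℂ → ℂ}, (∀ x, x ≠ 0 → DifferentiableAt ℂ F x) →
          DifferentiableAt ℂ (dslope F x) x := by
        intro F hF
        have : DifferentiableOn ℂ F {x : ℂ | x ≠ 0} := fun y hy =>
          (hF y hy).differentiableWithinAt
        exact ((Complex.differentiableOn_dslope (hopen.mem_nhds hx)).2 this x hx).differentiableAt
          (hopen.mem_nhds hx)
      have hne : dslope g x x ≠ 0 := by rwa [dslope_same]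
      have hev : h =ᶠ[𝓝 x] fun y => dslope f x y / dslope g x y := by
        filter_upwards [(hds hg).continuousAt.eventually_ne hne] with y hy
        rcases eq_or_ne y x with rfl | hyx
        · simp [hh, hgx]
        · have h1 : g y ≠ 0 := by
            intro h1
            apply hy
            rw [dslope_of_ne _ hyx, slope_def_field, h1, hgx]
            simp
          simp only [hh, if_neg h1]
          rw [dslope_of_ne _ hyx, dslope_of_ne _ hyx, slope_def_field, slope_def_field, hfx, hgx,
            sub_zero, sub_zero, div_div_div_cancel_right₀ (sub_ne_zero.2 hyx)]
      exact ((hds hf).div (hds hg) hne).congr_of_eventuallyEq hev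
    · have hev : h =ᶠ[𝓝 x] fun y => f y / g y := by
        filter_upwards [(hg x hx).continuousAt.eventually_ne hgx] with y hy
        simp [hh, hy]
      exact ((hf x hx).div (hg x hx) hgx).congr_of_eventuallyEq hev
  have hderiv : ∀ {F : ℂ → ℂ}, (∀ x, x ≠ 0 → DifferentiableAt ℂ F x) →
      (∀ x, x ≠ 0 → F (p * x) = (x ^ 2)⁻¹ * F x) → ∀ x, x ≠ 0 → F x = 0 →
      p * deriv F (p * x) = (x ^ 2)⁻¹ * deriv F x := by
    intro F hF hFp x hx hFx
    have hev : (fun y => F (p * y)) =ᶠ[𝓝 x] fun y => (y ^ 2)⁻¹ * F y := by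
      filter_upwards [hopen.mem_nhds hx] with y hy using hFp y hy
    have h1 := hev.deriv_eq
    rw [deriv_comp_mul_left, smul_eq_mul] at h1
    rw [h1, deriv_fun_mul _ (hF x hx), hFx]
    · simp
    · have : x ^ 2 ≠ 0 := pow_ne_zero 2 hx
      fun_prop (disch := assumption)
  have hper : ∀ x, x ≠ 0 → h (p * x) = h x := by
    intro x hx
    have hx2 : (x ^ 2)⁻¹ ≠ 0 := inv_ne_zero (pow_ne_zero 2 hx)
    by_cases hgx : g x = 0
    · have hgpx : g (p * x) = 0 := by rw [hgp x hx, hgx, mul_zero]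
      simp only [hh, if_pos hgx, if_pos hgpx]
      rw [← mul_div_mul_left _ _ hp0, hderiv hf hfp x hx (h0 x hx hgx).1, hderiv hg hgp x hx hgx,
        mul_div_mul_left _ _ hx2]
    · have hgpx : g (p * x) ≠ 0 := by
        rw [hgp x hx]
        exact mul_ne_zero hx2 hgx
      simp only [hh, if_neg hgx, if_neg hgpx]
      rw [hfp x hx, hgp x hx, mul_div_mul_left _ _ hx2]
  refine ⟨h 1, fun x hx => ?_⟩
  rw [eq_of_multiplicatively_periodic hp0 hp hd hper one_ne_zero hx]
  by_cases hgx : g x = 0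
  · rw [(h0 x hx hgx).1, hgx, mul_zero]
  · simp [hh, hgx]

lemma deriv_theta_zpow_ne_zero (hp0 : p ≠ 0) (hp : ‖p‖ < 1) (n : ℤ) :
    deriv (theta p) (p ^ n) ≠ 0 := by
  have hstep : ∀ n : ℤ, p * deriv (theta p) (p ^ (n + 1)) = -(p ^ n)⁻¹ * deriv (theta p) (p ^ n) := by
    intro n
    have hx : p ^ n ≠ 0 := zpow_ne_zero n hp0
    have hev : (fun y => theta p (p * y)) =ᶠ[𝓝 (p ^ n)] fun y => -y⁻¹ * theta p y := by
      filter_upwards [isOpen_ne.mem_nhds hx] with y hy using theta_mul_left hp0 hp hy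
    have h1 := hev.deriv_eq
    rw [deriv_comp_mul_left, smul_eq_mul] at h1
    rw [zpow_add_one₀ hp0, mul_comm (p ^ n) p, h1,
      deriv_fun_mul _ (differentiableAt_theta hp hx), (theta_eq_zero_iff hp0 hp hx).2 ⟨n, rfl⟩]
    · simp
    · fun_prop (disch := assumption)
  have hone : deriv (theta p) 1 ≠ 0 := by
    have hd : DifferentiableAt ℂ (fun z => qPoch (z * p) p * qPoch (p * z⁻¹) p) 1 := by
      have h1 : DifferentiableAt ℂ (fun z => qPoch (z * p) p) 1 :=
        DifferentiableAt.fun_comp' 1 (g := fun z => qPoch z p) (differentiable_qPoch hp _)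
          (by fun_prop)
      have h2 : DifferentiableAt ℂ (fun z => qPoch (p * z⁻¹) p) 1 :=
        DifferentiableAt.fun_comp' 1 (g := fun z => qPoch z p) (differentiable_qPoch hp _)
          (by fun_prop (disch := exact one_ne_zero))
      exact h1.mul h2
    have heq : theta p = fun z => (1 - z) * (qPoch (z * p) p * qPoch (p * z⁻¹) p) := by
      ext z
      rw [theta, qPoch_eq_mul hp z, mul_assoc]
    rw [heq, deriv_fun_mul (by fun_prop) hd]
    have := qPoch_ne_zero_of_norm_lt hp hp
    simpa using this
  induction n with
  | zero => simpa using hone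
  | succ n ih =>
    intro h
    have := hstep n
    rw [h, mul_zero] at this
    exact mul_ne_zero (neg_ne_zero.2 (inv_ne_zero (zpow_ne_zero _ hp0))) ih this.symm
  | pred n ih =>
    intro h
    have := hstep (-n - 1)
    rw [h, mul_zero, sub_add_cancel] at this
    exact mul_ne_zero hp0 ih this

lemma theta_mul_theta_inv (hp : ‖p‖ < 1) {x y : ℂ} (hx : x ≠ 0) (hy : y ≠ 0) :
    theta p (x / y) = -(x / y) * theta p (y / x) := by
  have := theta_inv hp (div_ne_zero hy hx)
  rwa [inv_div] at this

lemma weierstrass_of_generic (hp0 : p ≠ 0) (hp : ‖p‖ < 1) {x y z w : ℂ} (hx : x ≠ 0) (hy : y ≠ 0)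
    (hz : z ≠ 0) (hw : w ≠ 0) (h1 : theta p (w * w) ≠ 0) (h2 : theta p (z * w) ≠ 0)
    (h3 : theta p (z / w) ≠ 0) :
    theta p (x * z) * theta p (x / z) * (theta p (y * w) * theta p (y / w)) -
      theta p (x * w) * theta p (x / w) * (theta p (y * z) * theta p (y / z)) =
    y / z * (theta p (x * y) * theta p (x / y) * (theta p (z * w) * theta p (z / w))) := by
  have hdiff : ∀ {u : ℂ}, u ≠ 0 → ∀ x, x ≠ 0 →
      DifferentiableAt ℂ (fun x => theta p (x * u) * theta p (x / u)) x := by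
    intro u hu x hx
    have e1 : DifferentiableAt ℂ (fun x => theta p (x * u)) x :=
      DifferentiableAt.fun_comp' x (differentiableAt_theta hp (mul_ne_zero hx hu)) (by fun_prop)
    have e2 : DifferentiableAt ℂ (fun x => theta p (x / u)) x :=
      DifferentiableAt.fun_comp' x (differentiableAt_theta hp (div_ne_zero hx hu)) (by fun_prop)
    exact e1.mul e2
  have hqp : ∀ {u : ℂ}, u ≠ 0 → ∀ x, x ≠ 0 → theta p (p * x * u) * theta p (p * x / u) =
      (x ^ 2)⁻¹ * (theta p (x * u) * theta p (x / u)) := by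
    intro u hu x hx
    rw [mul_assoc, mul_div_assoc, theta_mul_left hp0 hp (mul_ne_zero hx hu),
      theta_mul_left hp0 hp (div_ne_zero hx hu)]
    field_simp
  have heven : ∀ {u : ℂ}, u ≠ 0 → ∀ x, x ≠ 0 → theta p (x⁻¹ * u) * theta p (x⁻¹ / u) =
      (x ^ 2)⁻¹ * (theta p (x * u) * theta p (x / u)) := by
    intro u hu x hx
    have e1 := theta_inv hp (mul_ne_zero hx hu)
    have e2 := theta_inv hp (div_ne_zero hx hu)
    rw [show x⁻¹ * u = (x / u)⁻¹ by field_simp, show x⁻¹ / u = (x * u)⁻¹ by field_simp, e1, e2]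
    field_simp
  obtain ⟨C, hC⟩ := exists_eq_mul_of_quasiperiodic hp0 hp
    (f := fun x => theta p (x * z) * theta p (x / z) * (theta p (y * w) * theta p (y / w)) -
      y / z * (theta p (x * y) * theta p (x / y) * (theta p (z * w) * theta p (z / w))))
    (g := fun x => theta p (x * w) * theta p (x / w))
    (fun x hx => by
      have := hdiff hz x hx
      have := hdiff hy x hx
      fun_prop)
    (hdiff hw)
    (fun x hx => by
      simp only [hqp hz x hx, hqp hy x hx]
      ring)
    (hqp hw)
    (by
      have hvan : theta p (w * z) * theta p (w / z) * (theta p (y * w) * theta p (y / w)) -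
          y / z * (theta p (w * y) * theta p (w / y) * (theta p (z * w) * theta p (z / w))) = 0 := by
        rw [theta_mul_theta_inv hp hw hy, theta_mul_theta_inv hp hz hw, mul_comm w z, mul_comm w y]
        field_simp
        ring
      have hshift : ∀ (n : ℤ) (x : ℂ), x ≠ 0 →
          theta p (x * z) * theta p (x / z) * (theta p (y * w) * theta p (y / w)) -
            y / z * (theta p (x * y) * theta p (x / y) * (theta p (z * w) * theta p (z / w))) = 0 →
          theta p (p ^ n * x * z) * theta p (p ^ n * x / z) * (theta p (y * w) * theta p (y / w)) -
            y / z * (theta p (p ^ n * x * y) * theta p (p ^ n * x / y) *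
              (theta p (z * w) * theta p (z / w))) = 0 := by
        intro n
        induction n with
        | zero => simp
        | succ n ih =>
          intro x hx h
          rw [zpow_add_one₀ hp0, mul_assoc (p ^ (n : ℤ))]
          refine ih _ (mul_ne_zero hp0 hx) ?_
          rw [hqp hz x hx, hqp hy x hx]
          linear_combination (x ^ 2)⁻¹ * h
        | pred n ih =>
          intro x hx h
          rw [zpow_sub_one₀ hp0, mul_assoc (p ^ (-n : ℤ))]
          have hx' : p⁻¹ * x ≠ 0 := mul_ne_zero (inv_ne_zero hp0) hx
          refine ih _ hx' ?_
          have e1 := hqp hz _ hx'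
          have e2 := hqp hy _ hx'
          rw [mul_inv_cancel_left₀ hp0] at e1 e2
          rw [e1, e2] at h
          have h2 : ((p⁻¹ * x) ^ 2)⁻¹ ≠ 0 := inv_ne_zero (pow_ne_zero 2 hx')
          refine (mul_eq_zero.1 ?_).resolve_left h2
          linear_combination h
      intro x hx hgx
      have e1 : DifferentiableAt ℂ (fun x => theta p (x * w)) x :=
        DifferentiableAt.fun_comp' x (differentiableAt_theta hp (mul_ne_zero hx hw)) (by fun_prop)
      have e2 : DifferentiableAt ℂ (fun x => theta p (x / w)) x :=
        DifferentiableAt.fun_comp' x (differentiableAt_theta hp (div_ne_zero hx hw)) (by fun_prop)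
      have d1 : deriv (fun x => theta p (x * w)) x = w * deriv (theta p) (x * w) := by
        simp only [mul_comm _ w]
        rw [deriv_comp_mul_left w (theta p), smul_eq_mul]
      have d2 : deriv (fun x => theta p (x / w)) x = w⁻¹ * deriv (theta p) (x / w) := by
        simp only [div_eq_inv_mul]
        rw [deriv_comp_mul_left w⁻¹ (theta p), smul_eq_mul]
      have hww : ∀ n : ℤ, w * w ≠ p ^ n := fun n hn =>
        h1 ((theta_eq_zero_iff hp0 hp (mul_ne_zero hw hw)).2 ⟨n, hn⟩)
      rw [deriv_fun_mul e1 e2, d1, d2]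
      rcases mul_eq_zero.1 hgx with h | h
      · obtain ⟨n, hn⟩ := (theta_eq_zero_iff hp0 hp (mul_ne_zero hx hw)).1 h
        obtain rfl : x = p ^ n * w⁻¹ := by rw [← hn]; field_simp
        refine ⟨hshift n _ (inv_ne_zero hw) ?_, ?_⟩
        · rw [heven hz w hw, heven hy w hw]
          linear_combination (w ^ 2)⁻¹ * hvan
        · rw [h, hn, zero_mul, add_zero]
          refine mul_ne_zero (mul_ne_zero hw (deriv_theta_zpow_ne_zero hp0 hp n)) fun h0 => ?_
          obtain ⟨k, hk⟩ := (theta_eq_zero_iff hp0 hp (div_ne_zero hx hw)).1 h0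
          refine hww (n - k) ?_
          rw [zpow_sub₀ hp0, ← hk]
          field_simp
      · obtain ⟨n, hn⟩ := (theta_eq_zero_iff hp0 hp (div_ne_zero hx hw)).1 h
        obtain rfl : x = p ^ n * w := by rw [← hn]; field_simp
        refine ⟨hshift n _ hw hvan, ?_⟩
        rw [h, hn, mul_zero, zero_add]
        refine mul_ne_zero (fun h0 => ?_)
          (mul_ne_zero (inv_ne_zero hw) (deriv_theta_zpow_ne_zero hp0 hp n))
        obtain ⟨k, hk⟩ := (theta_eq_zero_iff hp0 hp (mul_ne_zero hx hw)).1 h0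
        refine hww (k - n) ?_
        rw [zpow_sub₀ hp0, ← hk]
        have := zpow_ne_zero n hp0
        field_simp)
  have hCz := hC z hz
  have hCx := hC x hx
  have hCval : C = theta p (y * z) * theta p (y / z) := by
    simp only [div_self hz, theta_one hp, mul_zero, zero_mul, zero_sub] at hCz
    have e := theta_mul_theta_inv hp hz hy
    rw [e] at hCz
    refine mul_right_cancel₀ (mul_ne_zero h2 h3) ?_
    rw [← hCz, mul_comm z y]
    field_simp
  rw [hCval] at hCx
  linear_combination hCx

/-- Weierstrass' addition formula. -/
theorem theta_addition (hp0 : p ≠ 0) (hp : ‖p‖ < 1) {x y z w : ℂ} (hx : x ≠ 0) (hy : y ≠ 0)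
    (hz : z ≠ 0) (hw : w ≠ 0) :
    theta p (x * z) * theta p (x / z) * (theta p (y * w) * theta p (y / w)) -
      theta p (x * w) * theta p (x / w) * (theta p (y * z) * theta p (y / z)) =
    y / z * (theta p (x * y) * theta p (x / y) * (theta p (z * w) * theta p (z / w))) := by
  set F : ℂ → ℂ := fun w =>
    theta p (x * z) * theta p (x / z) * (theta p (y * w) * theta p (y / w)) -
      theta p (x * w) * theta p (x / w) * (theta p (y * z) * theta p (y / z)) -
    y / z * (theta p (x * y) * theta p (x / y) * (theta p (z * w) * theta p (z / w))) with hF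
  have hcm : ∀ {u : ℂ}, u ≠ 0 → ContinuousAt (fun w => theta p (u * w)) w := by
    intro u hu
    exact ContinuousAt.comp' (differentiableAt_theta hp (mul_ne_zero hu hw)).continuousAt
      (by fun_prop)
  have hcd : ∀ {u : ℂ}, u ≠ 0 → ContinuousAt (fun w => theta p (u / w)) w := by
    intro u hu
    exact ContinuousAt.comp' (differentiableAt_theta hp (div_ne_zero hu hw)).continuousAt
      (by fun_prop (disch := assumption))
  have hFc : ContinuousAt F w := by
    have h1 := (hcm hy).mul (hcd hy)
    have h2 := (hcm hx).mul (hcd hx)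
    have h3 := (hcm hz).mul (hcd hz)
    exact ((continuousAt_const.mul h1).sub (h2.mul continuousAt_const)).sub
      (continuousAt_const.mul (continuousAt_const.mul h3))
  set B : Set ℂ := {0} ∪ ((⋃ n : ℤ, {w | w * w = p ^ n}) ∪ ((⋃ n : ℤ, {w | z * w = p ^ n}) ∪
    ⋃ n : ℤ, {w | z / w = p ^ n})) with hB
  have hBc : B.Countable := by
    refine (Set.countable_singleton _).union ((Set.countable_iUnion fun n => ?_).union
      ((Set.countable_iUnion fun n => ?_).union (Set.countable_iUnion fun n => ?_)))
    · obtain ⟨v, hv⟩ := IsAlgClosed.exists_pow_nat_eq (p ^ n) two_pos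
      refine ((Set.finite_singleton v).union (Set.finite_singleton (-v))).countable.mono ?_
      intro w hw
      have : (w - v) * (w + v) = 0 := by
        have : w * w = p ^ n := hw
        linear_combination this - hv
      rcases mul_eq_zero.1 this with h | h
      · exact Or.inl (sub_eq_zero.1 h)
      · exact Or.inr (eq_neg_of_add_eq_zero_left h)
    · refine (Set.countable_singleton (p ^ n / z)).mono fun w hw => ?_
      have : z * w = p ^ n := hw
      simp only [Set.mem_singleton_iff, ← this]
      field_simp
    · refine (Set.countable_singleton (z / p ^ n)).mono fun w hw => ?_
      have : z / w = p ^ n := hw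
      simp only [Set.mem_singleton_iff, ← this]
      field_simp
  have hdense : Dense Bᶜ := hBc.dense_compl ℝ
  have hzero : ∀ w ∈ Bᶜ, F w = 0 := by
    intro w hwB
    simp only [hB, Set.mem_compl_iff, Set.mem_union, Set.mem_singleton_iff, Set.mem_iUnion,
      Set.mem_ofPred_eq, not_or, not_exists] at hwB
    obtain ⟨hw0, ha, hb, hc⟩ := hwB
    refine sub_eq_zero.2 (weierstrass_of_generic hp0 hp hx hy hz hw0 ?_ ?_ ?_)
    · rw [Ne, theta_eq_zero_iff hp0 hp (mul_ne_zero hw0 hw0)]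
      simpa using ha
    · rw [Ne, theta_eq_zero_iff hp0 hp (mul_ne_zero hz hw0)]
      simpa using hb
    · rw [Ne, theta_eq_zero_iff hp0 hp (div_ne_zero hz hw0)]
      simpa using hc
  have hmem : w ∈ closure Bᶜ := hdense w
  have : F w = 0 := by
    have hne : (𝓝[Bᶜ] w).NeBot := mem_closure_iff_nhdsWithin_neBot.1 hmem
    refine tendsto_nhds_unique (l := 𝓝[Bᶜ] w) (hFc.tendsto.mono_left nhdsWithin_le_nhds) ?_
    exact tendsto_const_nhds.congr' (by
      filter_upwards [self_mem_nhdsWithin] with w hw using (hzero w hw).symm)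
  exact sub_eq_zero.1 this

end Weierstrass

end EllipticBailey

end

noncomputable section

namespace EllipticBailey

/-! ### The Frenkel–Turaev sum -/

section FrenkelTuraev

variable {p q : ℂ}

lemma thetaPoch_zero (p q z : ℂ) : thetaPoch p q z 0 = 1 := by simp [thetaPoch]

lemma thetaPoch_succ (p q z : ℂ) (n : ℕ) :
    thetaPoch p q z (n + 1) = thetaPoch p q z n * theta p (z * q ^ n) := by
  simp [thetaPoch, Finset.prod_range_succ]

lemma thetaPoch_succ_left (p q z : ℂ) (n : ℕ) :
    thetaPoch p q z (n + 1) = theta p z * thetaPoch p q (z * q) n := by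
  rw [thetaPoch, Finset.prod_range_succ', mul_comm, thetaPoch]
  congr 1
  · simp
  · exact Finset.prod_congr rfl fun j _ => by rw [pow_succ']; ring_nf

lemma thetaPoch_add (p q z : ℂ) (m n : ℕ) :
    thetaPoch p q z (m + n) = thetaPoch p q z m * thetaPoch p q (z * q ^ m) n := by
  rw [thetaPoch, Finset.prod_range_add, thetaPoch, thetaPoch]
  congr 1
  exact Finset.prod_congr rfl fun j _ => by rw [pow_add]; ring_nf

lemma thetaPoch_ne_zero {z : ℂ} {n : ℕ} (h : ∀ j < n, theta p (z * q ^ j) ≠ 0) :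
    thetaPoch p q z n ≠ 0 :=
  Finset.prod_ne_zero_iff.2 fun j hj => h j (Finset.mem_range.1 hj)

lemma theta_addition_unbalanced (hp0 : p ≠ 0) (hp : ‖p‖ < 1) {a e x y : ℂ} (ha : a ≠ 0)
    (he : e ≠ 0) (hx : x ≠ 0) (hy : y ≠ 0) :
    theta p (e * x) * theta p (a * x / e) * (theta p y * theta p (a * y)) -
      x * (theta p e * theta p (a / e) * (theta p (y / x) * theta p (a * x * y))) =
    theta p (a * x) * theta p x * (theta p (e * y) * theta p (a * y / e)) := by
  obtain ⟨A, rfl⟩ := IsAlgClosed.exists_pow_nat_eq a two_pos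
  have hA : A ≠ 0 := by rintro rfl; simp at ha
  have h := theta_addition hp0 hp (x := A * x) (y := A * y) (z := e / A) (w := A)
    (mul_ne_zero hA hx) (mul_ne_zero hA hy) (div_ne_zero he hA) hA
  have e1 : A * x * (e / A) = e * x := by field_simp
  have e2 : A * x / (e / A) = A ^ 2 * x / e := by field_simp
  have e3 : A * y * A = A ^ 2 * y := by ring
  have e4 : A * y / A = y := by field_simp
  have e5 : A * x * A = A ^ 2 * x := by ring
  have e6 : A * x / A = x := by field_simp
  have e7 : A * y * (e / A) = e * y := by field_simp
  have e8 : A * y / (e / A) = A ^ 2 * y / e := by field_simp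
  have e9 : A * x * (A * y) = A ^ 2 * x * y := by ring
  have e10 : A * x / (A * y) = x / y := by field_simp
  have e11 : e / A * A = e := by field_simp
  have e12 : e / A / A = e / A ^ 2 := by field_simp
  rw [e1, e2, e3, e4, e5, e6, e7, e8, e9, e10, e11, e12, theta_mul_theta_inv hp hx hy,
    theta_mul_theta_inv hp he ha] at h
  have h2 : A ^ 2 * y / e * (-(x / y) * -(e / A ^ 2)) = x := by field_simp
  linear_combination h + theta p (A ^ 2 * x * y) * theta p (y / x) * theta p e *
    theta p (A ^ 2 / e) * h2

lemma theta_addition_balanced (hp0 : p ≠ 0) (hp : ‖p‖ < 1) {b c e κ : ℂ} (hb : b ≠ 0)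
    (hc : c ≠ 0) (he : e ≠ 0) (hκ : κ ≠ 0) :
    theta p (κ * b * c * e) * theta p (κ * b) * (theta p (κ * c) * theta p (κ * e)) =
      theta p κ * theta p (κ * c * e) * (theta p (κ * b * e) * theta p (κ * b * c)) +
      κ * (theta p (κ ^ 2 * b * c * e) * theta p b * (theta p c * theta p e)) := by
  obtain ⟨g, hg⟩ := IsAlgClosed.exists_pow_nat_eq (c * e) two_pos
  have hg0 : g ≠ 0 := by
    rintro rfl
    exact mul_ne_zero hc he (by rw [← hg]; simp)
  have h := theta_addition hp0 hp (x := κ * b * g) (y := κ * g) (z := g) (w := g / c)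
    (mul_ne_zero (mul_ne_zero hκ hb) hg0) (mul_ne_zero hκ hg0) hg0 (div_ne_zero hg0 hc)
  have e1 : κ * b * g * g = κ * b * c * e := by linear_combination κ * b * hg
  have e2 : κ * b * g / g = κ * b := by field_simp
  have e3 : κ * g * (g / c) = κ * e := by field_simp; linear_combination hg
  have e4 : κ * g / (g / c) = κ * c := by field_simp
  have e5 : κ * b * g * (g / c) = κ * b * e := by field_simp; linear_combination hg
  have e6 : κ * b * g / (g / c) = κ * b * c := by field_simp
  have e7 : κ * g * g = κ * c * e := by linear_combination κ * hg
  have e8 : κ * g / g = κ := by field_simp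
  have e9 : κ * b * g * (κ * g) = κ ^ 2 * b * c * e := by linear_combination κ ^ 2 * b * hg
  have e10 : κ * b * g / (κ * g) = b := by field_simp
  have e11 : g * (g / c) = e := by field_simp; linear_combination hg
  have e12 : g / (g / c) = c := by field_simp
  rw [e1, e2, e3, e4, e5, e6, e7, e8, e9, e10, e11, e12] at h
  linear_combination h

/-- The summand of the Frenkel–Turaev sum, in a form free of `q^{-L}`. -/
def ftTerm (p q a b c e κ : ℂ) (L i : ℕ) : ℂ :=
  thetaPoch p q κ (L - i) * thetaPoch p q (κ * a) (L + i) /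
      (thetaPoch p q q (L - i) * thetaPoch p q (a * q) (L + i)) *
    (theta p (a * q ^ (2 * i)) / theta p a) *
    (thetaPoch p q a i * thetaPoch p q b i * thetaPoch p q c i * thetaPoch p q e i /
      (thetaPoch p q q i * thetaPoch p q (a * q / b) i * thetaPoch p q (a * q / c) i *
        thetaPoch p q (a * q / e) i)) * κ ^ i

/-- The nonvanishing conditions under which the Frenkel–Turaev sum of length `L` makes sense. -/
structure FTGeneric (p q a b c e : ℂ) (L : ℕ) : Prop where
  base : ∀ j ≤ 2 * L, theta p (a * q ^ j) ≠ 0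
  nome : ∀ j, 1 ≤ j → j ≤ L → theta p (q ^ j) ≠ 0
  left : ∀ j, 1 ≤ j → j ≤ L → theta p (a * q ^ j / b) ≠ 0
  mid : ∀ j, 1 ≤ j → j ≤ L → theta p (a * q ^ j / c) ≠ 0
  right : ∀ j, 1 ≤ j → j ≤ 2 * L → theta p (a * q ^ j / e) ≠ 0

lemma ftTerm_recurrence_algebra {X t1 t2 t3 t4 t5 t6 t7 t8 t9 t10 t11 t12 t13 t14 t15 t16 t17 t18
    t19 t20 t21 t22 t23 t24 u1 u2 u3 u4 u5 u6 u7 u8 u9 u10 u11 u12 κ κj : ℂ}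
    (n2 : t2 ≠ 0) (n12 : t4 ≠ 0) (n11 : t5 ≠ 0) (n14 : t7 ≠ 0) (n13 : t8 ≠ 0) (n9 : t13 ≠ 0)
    (n5 : t17 ≠ 0) (n4 : t22 ≠ 0)
    (hw : t9 * t3 * (t5 * t4) - X * (t18 * t13 * (t8 * t1)) = t2 * t7 * (t11 * t10)) :
    t21 * u1 * (t19 * (t20 * u2)) / (u9 * t8 * (t17 * (t16 * u3))) * (t6 / t22) *
        (t22 * (t17 * u4) / t2 * (t23 * u5) * (t24 * u6) * (u7 * t9) /
          (u8 * t7 * (t14 * u10) * (t15 * u11) * (t13 * (t12 * u12) / t3))) *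
      (κj * κ) =
    t21 * t19 / (t5 * t4) *
        (u1 * (t20 * u2) / (u9 * (t17 * (t16 * u3) / t1)) * (t6 / t22) *
            (t22 * (t17 * u4) / t2 * (t23 * u5) * (t24 * u6) * (t18 * u7) /
              (u8 * t7 * (t14 * u10) * (t15 * u11) * (t12 * u12))) *
          (κj * κ * X)) +
      κ * t19 * t20 * t23 * t24 * t11 * t10 / (t14 * t15 * t13 * t12 * t5 * t4) *
        (t21 * u1 * u2 / (u9 * t8 * u3) * (t6 / t16) * (u4 * u5 * u6 * u7 / (u8 * u10 * u11 * u12)) * κj) := by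
  have e1 : (t17 * t22) / (t17 * t22) = 1 := div_self (mul_ne_zero n5 n4)
  have e2 : (t5*t4) / (t5*t4) = 1 := div_self (mul_ne_zero n11 n12)
  have e3 : (t13*t8) / (t13*t8) = 1 := div_self (mul_ne_zero n9 n13)
  have e4 : (t2*t7) / (t2*t7) = 1 := div_self (mul_ne_zero n2 n14)
  set G := t21*u1*t19*t20*u2*t6*u4*t23*u5*t24*u6*u7*κj*κ/(u9*t8*t16*u3*t2*u8*t7*t14*u10*t15*u11*t13*t12*u12*t5*t4) with hG
  have h1 : t21 * u1 * (t19 * (t20 * u2)) / (u9 * t8 * (t17 * (t16 * u3))) * (t6 / t22) *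
        (t22 * (t17 * u4) / t2 * (t23 * u5) * (t24 * u6) * (u7 * t9) /
          (u8 * t7 * (t14 * u10) * (t15 * u11) * (t13 * (t12 * u12) / t3))) *
      (κj * κ) = G * (t9*t3*(t5*t4)) := by
    calc _ = (t17 * t22) / (t17 * t22) * (t21 * u1 * t19 * t20 * u2 * t6*u4*t23 * u5 *t24 * u6*u7*κj*κ/(u9*t8*t16*u3*t2*u8*t7*t14*u10*t15*u11*t13*t12*u12)*(t9*t3)) := by simp only [div_eq_mul_inv, mul_inv, inv_inv]; ring
      _ = (t5*t4) / (t5*t4) * (t21 * u1 * t19 * t20 * u2 * t6*u4*t23 * u5 *t24 * u6*u7*κj*κ/(u9*t8*t16*u3*t2*u8*t7*t14*u10*t15*u11*t13*t12*u12)*(t9*t3)) := by rw [e1, e2]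
      _ = _ := by rw [hG]; ring
  rw [h1]
  have h2 : t21 * t19 / (t5 * t4) *
        (u1 * (t20 * u2) / (u9 * (t17 * (t16 * u3) / t1)) * (t6 / t22) *
            (t22 * (t17 * u4) / t2 * (t23 * u5) * (t24 * u6) * (t18 * u7) /
              (u8 * t7 * (t14 * u10) * (t15 * u11) * (t12 * u12))) *
          (κj * κ * X)) = G * (X * (t18 * t13 * (t8 * t1))) := by
    calc _ = (t17 * t22) / (t17 * t22) * (t21 * u1 * t19 * t20 * u2 * t6*u4*t23 * u5 *t24 * u6*u7*κj*κ/(u9*t16*u3*t2*u8*t7*t14*u10*t15*u11*t12*u12*t5*t4)*(X*t18*t1)) := by simp only [div_eq_mul_inv, mul_inv, inv_inv]; ring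
      _ = (t13*t8) / (t13*t8) * (t21 * u1 * t19 * t20 * u2 * t6*u4*t23 * u5 *t24 * u6*u7*κj*κ/(u9*t16*u3*t2*u8*t7*t14*u10*t15*u11*t12*u12*t5*t4)*(X*t18*t1)) := by rw [e1, e3]
      _ = _ := by rw [hG]; ring
  rw [h2]
  have h3 : κ * t19 * t20 * t23 * t24 * t11 * t10 / (t14 * t15 * t13 * t12 * t5 * t4) *
        (t21 * u1 * u2 / (u9 * t8 * u3) * (t6 / t16) * (u4 * u5 * u6 * u7 / (u8 * u10 * u11 * u12)) * κj) = G * (t2 * t7 * (t11 * t10)) := by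
    rw [← one_mul (_ / _ * _), ← e4, hG]; ring
  rw [h3]
  linear_combination G * hw

lemma ftTerm_recurrence (hp0 : p ≠ 0) (hp : ‖p‖ < 1) (hq0 : q ≠ 0) {a b c e κ : ℂ}
    (ha : a ≠ 0) (hb : b ≠ 0) (hc : c ≠ 0) (he : e ≠ 0) (j d : ℕ)
    (hgen : FTGeneric p q a b c e (j + 1 + d + 1)) :
    ftTerm p q a b c e κ (j + 1 + d + 1) (j + 1) =
      theta p κ * theta p (κ * a) / (theta p (q ^ (j + 1 + d + 1)) *
        theta p (a * q ^ (j + 1 + d + 1))) *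
        ftTerm p q a b c (e / q) (κ * q) (j + 1 + d) (j + 1) +
      κ * theta p (κ * a) * theta p (κ * a * q) * theta p b * theta p c *
        theta p (e * q ^ (j + 1 + d)) * theta p (a * q ^ (j + 1 + d + 2) / e) /
        (theta p (a * q / b) * theta p (a * q / c) * theta p (a * q / e) *
          theta p (a * q ^ 2 / e) * theta p (q ^ (j + 1 + d + 1)) *
          theta p (a * q ^ (j + 1 + d + 1))) *
        ftTerm p q (a * q ^ 2) (b * q) (c * q) e κ (j + 1 + d) j := by
  have hw := theta_addition_unbalanced hp0 hp (a := a) (e := e / q) (x := q ^ (j + 1))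
    (y := q ^ (j + 1 + d + 1)) ha (div_ne_zero he hq0) (pow_ne_zero _ hq0) (pow_ne_zero _ hq0)
  have f1 : e / q * q ^ (j + 1) = e * q ^ j := by rw [pow_succ]; field_simp
  have f2 : a * q ^ (j + 1) / (e / q) = a * q ^ (j + 2) / e := by rw [pow_succ q (j + 1)]; field_simp
  have f3 : a / (e / q) = a * q / e := by field_simp
  have f4 : q ^ (j + 1 + d + 1) / q ^ (j + 1) = q ^ (d + 1) := by
    rw [show j + 1 + d + 1 = (j + 1) + (d + 1) by ring, pow_add]; field_simp
  have f5 : a * q ^ (j + 1) * q ^ (j + 1 + d + 1) = a * q ^ (2 * j + d + 3) := by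
    rw [mul_assoc, ← pow_add]; ring_nf
  have f6 : e / q * q ^ (j + 1 + d + 1) = e * q ^ (j + 1 + d) := by rw [pow_succ]; field_simp
  have f7 : a * q ^ (j + 1 + d + 1) / (e / q) = a * q ^ (j + 1 + d + 2) / e := by
    rw [pow_succ q (j + 1 + d + 1)]; field_simp
  rw [f1, f2, f3, f4, f5, f6, f7] at hw
  have n1 : theta p (a * q ^ (2 * j + d + 3)) ≠ 0 := hgen.base _ (by omega)
  have n2 : theta p (a * q ^ (j + 1)) ≠ 0 := hgen.base _ (by omega)
  have n3 : theta p (a * q ^ (j + 2) / e) ≠ 0 := hgen.right _ (by omega) (by omega)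
  have n4 : theta p a ≠ 0 := by simpa using hgen.base 0 (by omega)
  have n5 : theta p (a * q) ≠ 0 := by simpa using hgen.base 1 (by omega)
  have n6 : theta p (a * q ^ 2) ≠ 0 := hgen.base 2 (by omega)
  have n7 : theta p (a * q / b) ≠ 0 := by simpa using hgen.left 1 (by omega) (by omega)
  have n8 : theta p (a * q / c) ≠ 0 := by simpa using hgen.mid 1 (by omega) (by omega)
  have n9 : theta p (a * q / e) ≠ 0 := by simpa using hgen.right 1 (by omega) (by omega)
  have n10 : theta p (a * q ^ 2 / e) ≠ 0 := hgen.right 2 (by omega) (by omega)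
  have n11 : theta p (q ^ (j + 1 + d + 1)) ≠ 0 := hgen.nome _ (by omega) (by omega)
  have n12 : theta p (a * q ^ (j + 1 + d + 1)) ≠ 0 := hgen.base _ (by omega)
  have n13 : theta p (q ^ (d + 1)) ≠ 0 := hgen.nome _ (by omega) (by omega)
  have n14 : theta p (q ^ (j + 1)) ≠ 0 := hgen.nome _ (by omega) (by omega)
  have m1 : thetaPoch p q q d ≠ 0 := thetaPoch_ne_zero fun i hi => by
    rw [← pow_succ']; exact hgen.nome _ (by omega) (by omega)
  have m2 : thetaPoch p q q j ≠ 0 := thetaPoch_ne_zero fun i hi => by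
    rw [← pow_succ']; exact hgen.nome _ (by omega) (by omega)
  have m3 : thetaPoch p q (a * q ^ 3) (2 * j + d + 1) ≠ 0 := thetaPoch_ne_zero fun i hi => by
    rw [mul_assoc, ← pow_add]; exact hgen.base _ (by omega)
  have m4 : thetaPoch p q (a * q ^ 2 / b) j ≠ 0 := thetaPoch_ne_zero fun i hi => by
    rw [div_mul_eq_mul_div, mul_assoc, ← pow_add]; exact hgen.left _ (by omega) (by omega)
  have m5 : thetaPoch p q (a * q ^ 2 / c) j ≠ 0 := thetaPoch_ne_zero fun i hi => by
    rw [div_mul_eq_mul_div, mul_assoc, ← pow_add]; exact hgen.mid _ (by omega) (by omega)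
  have m6 : thetaPoch p q (a * q ^ 3 / e) j ≠ 0 := thetaPoch_ne_zero fun i hi => by
    rw [div_mul_eq_mul_div, mul_assoc, ← pow_add]; exact hgen.right _ (by omega) (by omega)
  have r1 : thetaPoch p q κ (d + 1) = theta p κ * thetaPoch p q (κ * q) d :=
    thetaPoch_succ_left ..
  have r2 : thetaPoch p q (κ * a) (2 * j + d + 3) =
      theta p (κ * a) * (theta p (κ * a * q) * thetaPoch p q (κ * a * q ^ 2) (2 * j + d + 1)) := by
    rw [thetaPoch_succ_left, thetaPoch_succ_left, mul_assoc (κ * a) q q, ← sq]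
  have r3 : thetaPoch p q (κ * a * q) (2 * j + d + 2) =
      theta p (κ * a * q) * thetaPoch p q (κ * a * q ^ 2) (2 * j + d + 1) := by
    rw [thetaPoch_succ_left, mul_assoc (κ * a) q q, ← sq]
  have r4 : thetaPoch p q q (d + 1) = thetaPoch p q q d * theta p (q ^ (d + 1)) := by
    rw [thetaPoch_succ, ← pow_succ']
  have r5 : thetaPoch p q (a * q) (2 * j + d + 3) =
      theta p (a * q) * (theta p (a * q ^ 2) * thetaPoch p q (a * q ^ 3) (2 * j + d + 1)) := by
    rw [thetaPoch_succ_left, thetaPoch_succ_left, mul_assoc a q q, ← sq, mul_assoc a (q ^ 2) q,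
      ← pow_succ]
  have r6 : thetaPoch p q (a * q) (2 * j + d + 2) =
      theta p (a * q) * (theta p (a * q ^ 2) * thetaPoch p q (a * q ^ 3) (2 * j + d + 1)) /
        theta p (a * q ^ (2 * j + d + 3)) := by
    rw [← r5, eq_div_iff n1, thetaPoch_succ p q (a * q) (2 * j + d + 2), mul_assoc a q, ← pow_succ']
  have r7 : thetaPoch p q a (j + 1) =
      theta p a * (theta p (a * q) * thetaPoch p q (a * q ^ 2) j) / theta p (a * q ^ (j + 1)) := by
    rw [eq_div_iff n2, ← thetaPoch_succ, thetaPoch_succ_left, thetaPoch_succ_left, mul_assoc a q q,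
      ← sq]
  have r8 : thetaPoch p q b (j + 1) = theta p b * thetaPoch p q (b * q) j :=
    thetaPoch_succ_left ..
  have r9 : thetaPoch p q c (j + 1) = theta p c * thetaPoch p q (c * q) j :=
    thetaPoch_succ_left ..
  have r10 : thetaPoch p q q (j + 1) = thetaPoch p q q j * theta p (q ^ (j + 1)) := by
    rw [thetaPoch_succ, ← pow_succ']
  have r11 : thetaPoch p q (a * q / b) (j + 1) =
      theta p (a * q / b) * thetaPoch p q (a * q ^ 2 / b) j := by
    rw [thetaPoch_succ_left, div_mul_eq_mul_div, mul_assoc a q q, ← sq]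
  have r12 : thetaPoch p q (a * q / c) (j + 1) =
      theta p (a * q / c) * thetaPoch p q (a * q ^ 2 / c) j := by
    rw [thetaPoch_succ_left, div_mul_eq_mul_div, mul_assoc a q q, ← sq]
  have r13 : thetaPoch p q e (j + 1) = thetaPoch p q e j * theta p (e * q ^ j) :=
    thetaPoch_succ ..
  have r14 : thetaPoch p q (e / q) (j + 1) = theta p (e / q) * thetaPoch p q e j := by
    rw [thetaPoch_succ_left, div_mul_cancel₀ _ hq0]
  have r15 : thetaPoch p q (a * q ^ 2 / e) (j + 1) =
      theta p (a * q ^ 2 / e) * thetaPoch p q (a * q ^ 3 / e) j := by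
    rw [thetaPoch_succ_left, div_mul_eq_mul_div, mul_assoc a, ← pow_succ]
  have r16 : thetaPoch p q (a * q / e) (j + 1) =
      theta p (a * q / e) * (theta p (a * q ^ 2 / e) * thetaPoch p q (a * q ^ 3 / e) j) /
        theta p (a * q ^ (j + 2) / e) := by
    rw [← r15, eq_div_iff n3]
    have : a * q ^ (j + 2) / e = a * q / e * q ^ (j + 1) := by rw [pow_succ]; ring
    rw [this, ← thetaPoch_succ, thetaPoch_succ_left, div_mul_eq_mul_div, mul_assoc a q q, ← sq]
  simp only [ftTerm]
  rw [show j + 1 + d + 1 - (j + 1) = d + 1 by omega, show j + 1 + d - (j + 1) = d by omega,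
    show j + 1 + d - j = d + 1 by omega,
    show j + 1 + d + 1 + (j + 1) = 2 * j + d + 3 by omega,
    show j + 1 + d + (j + 1) = 2 * j + d + 2 by omega,
    show j + 1 + d + j = 2 * j + d + 1 by omega,
    show κ * q * a = κ * a * q by ring, show κ * (a * q ^ 2) = κ * a * q ^ 2 by ring,
    show a * q / (e / q) = a * q ^ 2 / e by field_simp,
    show a * q ^ 2 * q / (b * q) = a * q ^ 2 / b by field_simp,
    show a * q ^ 2 * q / (c * q) = a * q ^ 2 / c by field_simp,
    show a * q ^ 2 * q / e = a * q ^ 3 / e by ring,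
    show a * q ^ 2 * q = a * q ^ 3 by ring,
    show a * q ^ 2 * q ^ (2 * j) = a * q ^ (2 * (j + 1)) by ring,
    r2, r3, r4, r5, r6, r7, r8, r9, r10, r11, r12, r13, r14, r15, r16, r1]
  rw [mul_pow, pow_succ κ j]
  exact ftTerm_recurrence_algebra n2 n12 n11 n14 n13 n9 n5 n4 hw

lemma ftTerm_recurrence_last (hq0 : q ≠ 0) {a b c e κ : ℂ} (j : ℕ)
    (hgen : FTGeneric p q a b c e (j + 1)) :
    ftTerm p q a b c e κ (j + 1) (j + 1) =
      κ * theta p (κ * a) * theta p (κ * a * q) * theta p b * theta p c *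
        theta p (e * q ^ j) * theta p (a * q ^ (j + 2) / e) /
        (theta p (a * q / b) * theta p (a * q / c) * theta p (a * q / e) *
          theta p (a * q ^ 2 / e) * theta p (q ^ (j + 1)) * theta p (a * q ^ (j + 1))) *
        ftTerm p q (a * q ^ 2) (b * q) (c * q) e κ j j := by
  have n2 : theta p (a * q ^ (j + 1)) ≠ 0 := hgen.base _ (by omega)
  have n3 : theta p (a * q ^ (j + 2) / e) ≠ 0 := hgen.right _ (by omega) (by omega)
  have n4 : theta p a ≠ 0 := by simpa using hgen.base 0 (by omega)
  have n5 : theta p (a * q) ≠ 0 := by simpa using hgen.base 1 (by omega)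
  have r2 : thetaPoch p q (κ * a) (2 * j + 2) =
      theta p (κ * a) * (theta p (κ * a * q) * thetaPoch p q (κ * a * q ^ 2) (2 * j)) := by
    rw [thetaPoch_succ_left, thetaPoch_succ_left, mul_assoc (κ * a) q q, ← sq]
  have r5 : thetaPoch p q (a * q) (2 * j + 2) =
      theta p (a * q) * (theta p (a * q ^ 2) * thetaPoch p q (a * q ^ 3) (2 * j)) := by
    rw [thetaPoch_succ_left, thetaPoch_succ_left, mul_assoc a q q, ← sq, mul_assoc a (q ^ 2) q,
      ← pow_succ]
  have r7 : thetaPoch p q a (j + 1) =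
      theta p a * (theta p (a * q) * thetaPoch p q (a * q ^ 2) j) / theta p (a * q ^ (j + 1)) := by
    rw [eq_div_iff n2, ← thetaPoch_succ, thetaPoch_succ_left, thetaPoch_succ_left, mul_assoc a q q,
      ← sq]
  have r10 : thetaPoch p q q (j + 1) = thetaPoch p q q j * theta p (q ^ (j + 1)) := by
    rw [thetaPoch_succ, ← pow_succ']
  have r11 (b : ℂ) : thetaPoch p q (a * q / b) (j + 1) =
      theta p (a * q / b) * thetaPoch p q (a * q ^ 2 / b) j := by
    rw [thetaPoch_succ_left, div_mul_eq_mul_div, mul_assoc a q q, ← sq]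
  have r16 : thetaPoch p q (a * q / e) (j + 1) =
      theta p (a * q / e) * (theta p (a * q ^ 2 / e) * thetaPoch p q (a * q ^ 3 / e) j) /
        theta p (a * q ^ (j + 2) / e) := by
    rw [eq_div_iff n3]
    have : a * q ^ (j + 2) / e = a * q / e * q ^ (j + 1) := by rw [pow_succ]; ring
    rw [this, ← thetaPoch_succ, thetaPoch_succ_left, div_mul_eq_mul_div, mul_assoc a q q, ← sq,
      thetaPoch_succ_left, div_mul_eq_mul_div, mul_assoc a, ← pow_succ]
  simp only [ftTerm]
  rw [Nat.sub_self, Nat.sub_self, show j + 1 + (j + 1) = 2 * j + 2 by omega,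
    show j + j = 2 * j by omega, show κ * (a * q ^ 2) = κ * a * q ^ 2 by ring,
    show a * q ^ 2 * q / (b * q) = a * q ^ 2 / b by field_simp,
    show a * q ^ 2 * q / (c * q) = a * q ^ 2 / c by field_simp,
    show a * q ^ 2 * q / e = a * q ^ 3 / e by ring,
    show a * q ^ 2 * q = a * q ^ 3 by ring,
    show a * q ^ 2 * q ^ (2 * j) = a * q ^ (2 * (j + 1)) by ring,
    r2, r5, r7, thetaPoch_succ_left p q b, thetaPoch_succ_left p q c, thetaPoch_succ p q e, r10,
    r16, r11, r11, thetaPoch_zero, thetaPoch_zero, pow_succ κ j]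
  have e1 : (theta p a * theta p (a * q)) / (theta p a * theta p (a * q)) = 1 :=
    div_self (mul_ne_zero n4 n5)
  rw [← one_mul (κ * theta p (κ * a) * _ * _ * _ * _ * _ / _ * _), ← e1]
  simp only [div_eq_mul_inv, mul_inv, inv_inv]
  ring

/-- The Frenkel–Turaev summation formula. -/
theorem frenkel_turaev (hp0 : p ≠ 0) (hp : ‖p‖ < 1) (hq0 : q ≠ 0) (L : ℕ) :
    ∀ {a b c e κ : ℂ}, a ≠ 0 → b ≠ 0 → c ≠ 0 → e ≠ 0 → κ ≠ 0 → κ * b * c * e = a * q →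
    FTGeneric p q a b c e L →
    ∑ i ∈ Finset.range (L + 1), ftTerm p q a b c e κ L i =
      thetaPoch p q (κ * a) L * thetaPoch p q (κ * b) L * thetaPoch p q (κ * c) L *
        thetaPoch p q (κ * e) L /
        (thetaPoch p q q L * thetaPoch p q (a * q / b) L * thetaPoch p q (a * q / c) L *
          thetaPoch p q (a * q / e) L) := by
  induction L with
  | zero =>
    intro a b c e κ _ _ _ _ _ _ hgen
    have : theta p a ≠ 0 := by simpa using hgen.base 0 (by omega)
    simp [ftTerm, thetaPoch_zero, this]
  | succ L ih =>
    intro a b c e κ ha hb hc he hκ hbal hgen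
    have hgen1 : FTGeneric p q a b c (e / q) L :=
      { base := fun j hj => hgen.base j (by omega)
        nome := fun j hj hj' => hgen.nome j hj (by omega)
        left := fun j hj hj' => hgen.left j hj (by omega)
        mid := fun j hj hj' => hgen.mid j hj (by omega)
        right := fun j hj hj' => by
          have := hgen.right (j + 1) (by omega) (by omega)
          rwa [show a * q ^ (j + 1) / e = a * q ^ j / (e / q) by rw [pow_succ]; field_simp] at this }
    have hgen2 : FTGeneric p q (a * q ^ 2) (b * q) (c * q) e L :=
      { base := fun j hj => by
          rw [mul_assoc, ← pow_add]
          exact hgen.base _ (by omega)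
        nome := fun j hj hj' => hgen.nome j hj (by omega)
        left := fun j hj hj' => by
          have := hgen.left (j + 1) (by omega) (by omega)
          rwa [show a * q ^ (j + 1) / b = a * q ^ 2 * q ^ j / (b * q) by
            rw [pow_succ]; field_simp] at this
        mid := fun j hj hj' => by
          have := hgen.mid (j + 1) (by omega) (by omega)
          rwa [show a * q ^ (j + 1) / c = a * q ^ 2 * q ^ j / (c * q) by
            rw [pow_succ]; field_simp] at this
        right := fun j hj hj' => by
          rw [mul_assoc, ← pow_add]
          exact hgen.right _ (by omega) (by omega) }
    have ih1 := ih (κ := κ * q) ha hb hc (div_ne_zero he hq0) (mul_ne_zero hκ hq0)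
      (by rw [← hbal]; field_simp) hgen1
    have ih2 := ih (κ := κ) (mul_ne_zero ha (pow_ne_zero 2 hq0)) (mul_ne_zero hb hq0)
      (mul_ne_zero hc hq0) he hκ (by linear_combination q ^ 2 * hbal) hgen2
    have n1 : theta p (q ^ (L + 1)) ≠ 0 := hgen.nome _ (by omega) (by omega)
    have n2 : theta p (a * q ^ (L + 1)) ≠ 0 := hgen.base _ (by omega)
    have n3 : theta p (a * q ^ (L + 2) / e) ≠ 0 := hgen.right _ (by omega) (by omega)
    have n4 : theta p (a * q / b) ≠ 0 := by simpa using hgen.left 1 (by omega) (by omega)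
    have n5 : theta p (a * q / c) ≠ 0 := by simpa using hgen.mid 1 (by omega) (by omega)
    have n6 : theta p (a * q / e) ≠ 0 := by simpa using hgen.right 1 (by omega) (by omega)
    have n7 : theta p (a * q ^ 2 / e) ≠ 0 := hgen.right 2 (by omega) (by omega)
    have n8 : theta p (a * q ^ (L + 1) / b) ≠ 0 := hgen.left _ (by omega) (by omega)
    have n9 : theta p (a * q ^ (L + 1) / c) ≠ 0 := hgen.mid _ (by omega) (by omega)
    set X := theta p κ * theta p (κ * a) / (theta p (q ^ (L + 1)) * theta p (a * q ^ (L + 1)))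
      with hX
    set Y := κ * theta p (κ * a) * theta p (κ * a * q) * theta p b * theta p c *
        theta p (e * q ^ L) * theta p (a * q ^ (L + 2) / e) /
        (theta p (a * q / b) * theta p (a * q / c) * theta p (a * q / e) *
          theta p (a * q ^ 2 / e) * theta p (q ^ (L + 1)) * theta p (a * q ^ (L + 1))) with hY
    have hsum : ∑ i ∈ Finset.range (L + 1 + 1), ftTerm p q a b c e κ (L + 1) i =
        X * ∑ i ∈ Finset.range (L + 1), ftTerm p q a b c (e / q) (κ * q) L i +
        Y * ∑ i ∈ Finset.range (L + 1), ftTerm p q (a * q ^ 2) (b * q) (c * q) e κ L i := by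
      rw [Finset.sum_range_succ, ftTerm_recurrence_last hq0 L hgen, ← hY, Finset.sum_range_succ',
        Finset.sum_range_succ' (fun i => ftTerm p q a b c (e / q) (κ * q) L i),
        Finset.sum_range_succ (fun i => ftTerm p q (a * q ^ 2) (b * q) (c * q) e κ L i)]
      have h0 : ftTerm p q a b c e κ (L + 1) 0 = X * ftTerm p q a b c (e / q) (κ * q) L 0 := by
        simp only [ftTerm, Nat.sub_zero, add_zero, thetaPoch_zero]
        rw [thetaPoch_succ_left p q κ, thetaPoch_succ_left p q (κ * a), thetaPoch_succ p q q,
          thetaPoch_succ p q (a * q), show q * q ^ L = q ^ (L + 1) by ring,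
          show a * q * q ^ L = a * q ^ (L + 1) by ring, show κ * q * a = κ * a * q by ring, hX]
        simp only [div_eq_mul_inv, mul_inv]
        ring
      have h1 : ∀ j ∈ Finset.range L, ftTerm p q a b c e κ (L + 1) (j + 1) =
          X * ftTerm p q a b c (e / q) (κ * q) L (j + 1) +
          Y * ftTerm p q (a * q ^ 2) (b * q) (c * q) e κ L j := by
        intro j hj
        obtain ⟨d, rfl⟩ := Nat.exists_eq_add_of_le (Nat.succ_le_of_lt (Finset.mem_range.1 hj))
        exact ftTerm_recurrence hp0 hp hq0 ha hb hc he j d hgen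
      rw [Finset.sum_congr rfl h1, Finset.sum_add_distrib, h0, ← Finset.mul_sum, ← Finset.mul_sum]
      ring
    have hw := theta_addition_balanced hp0 hp (e := e * q ^ L) hb hc
      (mul_ne_zero he (pow_ne_zero L hq0)) hκ
    rw [show κ * b * c * (e * q ^ L) = a * q ^ (L + 1) by linear_combination q ^ L * hbal,
      show κ * c * (e * q ^ L) = a * q ^ (L + 1) / b by
        rw [eq_div_iff hb]; linear_combination q ^ L * hbal,
      show κ * b * (e * q ^ L) = a * q ^ (L + 1) / c by
        rw [eq_div_iff hc]; linear_combination q ^ L * hbal,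
      show κ * b * c = a * q / e by rw [eq_div_iff he]; linear_combination hbal,
      show κ ^ 2 * b * c * (e * q ^ L) = κ * a * q ^ (L + 1) by
        linear_combination κ * q ^ L * hbal, ← mul_assoc κ e] at hw
    rw [hsum, ih1, ih2]
    rw [show κ * q * a = κ * a * q by ring, show κ * q * b = κ * b * q by ring,
      show κ * q * c = κ * c * q by ring, show κ * q * (e / q) = κ * e by field_simp,
      show a * q / (e / q) = a * q ^ 2 / e by field_simp,
      show κ * (a * q ^ 2) = κ * a * q * q by ring, show κ * (b * q) = κ * b * q by ring,
      show κ * (c * q) = κ * c * q by ring,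
      show a * q ^ 2 * q / (b * q) = a * q ^ 2 / b by field_simp,
      show a * q ^ 2 * q / (c * q) = a * q ^ 2 / c by field_simp,
      show a * q ^ 2 * q / e = a * q ^ 3 / e by ring]
    have s1 : thetaPoch p q (κ * a * q) L * theta p (κ * a * q ^ (L + 1)) =
        theta p (κ * a * q) * thetaPoch p q (κ * a * q * q) L := by
      rw [← thetaPoch_succ_left, thetaPoch_succ, mul_assoc _ q, ← pow_succ']
    have s2 (b : ℂ) : thetaPoch p q (a * q / b) L * theta p (a * q ^ (L + 1) / b) =
        theta p (a * q / b) * thetaPoch p q (a * q ^ 2 / b) L := by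
      rw [show a * q ^ (L + 1) / b = a * q / b * q ^ L by rw [pow_succ]; ring, ← thetaPoch_succ,
        thetaPoch_succ_left, div_mul_eq_mul_div, mul_assoc a q q, ← sq]
    have s3 : thetaPoch p q (a * q ^ 2 / e) L * theta p (a * q ^ (L + 2) / e) =
        theta p (a * q ^ 2 / e) * thetaPoch p q (a * q ^ 3 / e) L := by
      rw [show a * q ^ (L + 2) / e = a * q ^ 2 / e * q ^ L by rw [pow_add]; ring, ← thetaPoch_succ,
        thetaPoch_succ_left, div_mul_eq_mul_div, mul_assoc a, ← pow_succ]
    have s4 : thetaPoch p q q (L + 1) = thetaPoch p q q L * theta p (q ^ (L + 1)) := by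
      rw [thetaPoch_succ, ← pow_succ']
    have s5 (b : ℂ) : thetaPoch p q (a * q / b) (L + 1) =
        theta p (a * q / b) * thetaPoch p q (a * q ^ 2 / b) L := by
      rw [thetaPoch_succ_left, div_mul_eq_mul_div, mul_assoc a q q, ← sq]
    have t1 : thetaPoch p q (a * q / b) L =
        theta p (a * q / b) * thetaPoch p q (a * q ^ 2 / b) L / theta p (a * q ^ (L + 1) / b) := by
      rw [eq_div_iff n8, s2]
    have t2 : thetaPoch p q (a * q / c) L =
        theta p (a * q / c) * thetaPoch p q (a * q ^ 2 / c) L / theta p (a * q ^ (L + 1) / c) := by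
      rw [eq_div_iff n9, s2]
    have t3 : thetaPoch p q (a * q ^ 3 / e) L = thetaPoch p q (a * q ^ 2 / e) L *
        theta p (a * q ^ (L + 2) / e) / theta p (a * q ^ 2 / e) := by
      rw [s3, mul_div_cancel_left₀ _ n7]
    rw [s4, s5, s5, s5, thetaPoch_succ_left p q (κ * a), thetaPoch_succ_left p q (κ * b),
      thetaPoch_succ_left p q (κ * c), thetaPoch_succ p q (κ * e), t1, t2, t3, hX, hY]
    set G := theta p (κ * a) * thetaPoch p q (κ * a * q) L * thetaPoch p q (κ * b * q) L *
      thetaPoch p q (κ * c * q) L * thetaPoch p q (κ * e) L /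
      (thetaPoch p q q L * theta p (q ^ (L + 1)) * (theta p (a * q / b) *
        thetaPoch p q (a * q ^ 2 / b) L) * (theta p (a * q / c) * thetaPoch p q (a * q ^ 2 / c) L) *
        (theta p (a * q / e) * thetaPoch p q (a * q ^ 2 / e) L)) with hG
    have e1 : theta p (a * q / e) / theta p (a * q / e) = 1 := div_self n6
    have e2 : theta p (a * q ^ 2 / e) / theta p (a * q ^ 2 / e) = 1 := div_self n7
    have e3 : theta p (a * q ^ (L + 2) / e) / theta p (a * q ^ (L + 2) / e) = 1 := div_self n3
    have g1 : theta p κ * theta p (κ * a) / (theta p (q ^ (L + 1)) * theta p (a * q ^ (L + 1))) *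
        (thetaPoch p q (κ * a * q) L * thetaPoch p q (κ * b * q) L * thetaPoch p q (κ * c * q) L *
          thetaPoch p q (κ * e) L / (thetaPoch p q q L *
          (theta p (a * q / b) * thetaPoch p q (a * q ^ 2 / b) L / theta p (a * q ^ (L + 1) / b)) *
          (theta p (a * q / c) * thetaPoch p q (a * q ^ 2 / c) L / theta p (a * q ^ (L + 1) / c)) *
          thetaPoch p q (a * q ^ 2 / e) L)) =
        G * (theta p κ * theta p (a * q ^ (L + 1) / b) * (theta p (a * q ^ (L + 1) / c) *
          theta p (a * q / e)) / theta p (a * q ^ (L + 1))) := by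
      rw [← one_mul (_ * _ / _ * _), ← e1, hG]
      simp only [div_eq_mul_inv, mul_inv, inv_inv]
      ring
    have g2 : κ * theta p (κ * a) * theta p (κ * a * q) * theta p b * theta p c *
        theta p (e * q ^ L) * theta p (a * q ^ (L + 2) / e) /
        (theta p (a * q / b) * theta p (a * q / c) * theta p (a * q / e) *
          theta p (a * q ^ 2 / e) * theta p (q ^ (L + 1)) * theta p (a * q ^ (L + 1))) *
        (thetaPoch p q (κ * a * q * q) L * thetaPoch p q (κ * b * q) L *
          thetaPoch p q (κ * c * q) L * thetaPoch p q (κ * e) L / (thetaPoch p q q L *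
          thetaPoch p q (a * q ^ 2 / b) L * thetaPoch p q (a * q ^ 2 / c) L *
          (thetaPoch p q (a * q ^ 2 / e) L * theta p (a * q ^ (L + 2) / e) /
            theta p (a * q ^ 2 / e)))) =
        G * (κ * (theta p (κ * a * q ^ (L + 1)) * theta p b * (theta p c * theta p (e * q ^ L))) /
          theta p (a * q ^ (L + 1))) := by
      calc _ = (theta p (a * q ^ (L + 2) / e) / theta p (a * q ^ (L + 2) / e)) *
            (theta p (a * q ^ 2 / e) / theta p (a * q ^ 2 / e)) *
            ((theta p (κ * a * q) * thetaPoch p q (κ * a * q * q) L) * (κ * theta p (κ * a) *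
            theta p b * theta p c * theta p (e * q ^ L)) * (thetaPoch p q (κ * b * q) L *
            thetaPoch p q (κ * c * q) L * thetaPoch p q (κ * e) L) /
            (theta p (a * q / b) * theta p (a * q / c) * theta p (a * q / e) *
            theta p (q ^ (L + 1)) * theta p (a * q ^ (L + 1)) * (thetaPoch p q q L *
            thetaPoch p q (a * q ^ 2 / b) L * thetaPoch p q (a * q ^ 2 / c) L *
            thetaPoch p q (a * q ^ 2 / e) L))) := by
              simp only [div_eq_mul_inv, mul_inv, inv_inv]
              ring
        _ = _ := by
              rw [e2, e3, ← s1, hG]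
              simp only [div_eq_mul_inv, mul_inv]
              ring
    rw [g1, g2, ← mul_add, ← add_div, ← hw]
    have e4 : theta p (a * q ^ (L + 1)) / theta p (a * q ^ (L + 1)) = 1 := div_self n2
    calc _ = (theta p (a * q ^ (L + 1)) / theta p (a * q ^ (L + 1))) * (G * (theta p (κ * b) *
          (theta p (κ * c) * theta p (κ * e * q ^ L)))) := by ring
      _ = _ := by
        rw [e4, hG]
        ring

end FrenkelTuraev

end EllipticBailey

end

noncomputable section

namespace EllipticBailey

/-! ### The matrix identity -/

section MatrixIdentity

variable {p q : ℂ}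

/-- The nonvanishing conditions for the matrix form of the star-triangle relation. -/
structure StarGeneric (p q τ a b c : ℂ) (N : ℕ) : Prop where
  base : ∀ j ≤ 2 * N, theta p (a * q ^ j) ≠ 0
  inner : ∀ j ≤ 2 * N, theta p (τ * q ^ j) ≠ 0
  nome : ∀ j, 1 ≤ j → j ≤ N → theta p (q ^ j) ≠ 0
  base_left : ∀ j, 1 ≤ j → j ≤ N → theta p (a * q ^ j / b) ≠ 0
  base_right : ∀ j, 1 ≤ j → j ≤ N → theta p (a * q ^ j / c) ≠ 0
  inner_left : ∀ j, 1 ≤ j → j ≤ N → theta p (τ * q ^ j / b) ≠ 0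
  inner_right : ∀ j, 1 ≤ j → j ≤ N → theta p (τ * q ^ j / c) ≠ 0

lemma entry_mul_eq_ftTerm {τ a b c k : ℂ} {m L i : ℕ} (hi : i ≤ L) (hq0 : q ≠ 0) (ha : a ≠ 0)
    (hb : b ≠ 0) (hc : c ≠ 0) (hτ : τ ≠ 0) (hbal : k * b * c = q * a * τ)
    (hgen : StarGeneric p q τ a b c (m + L)) :
    entryM p q a k (m + L) (m + i) * entryD p q a b c (m + i) * entryM p q τ a (m + i) m =
      thetaPoch p q k (2 * m) * thetaPoch p q b m * thetaPoch p q c m /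
        (thetaPoch p q (a * q / b) m * thetaPoch p q (a * q / c) m *
          thetaPoch p q (q * τ) (2 * m)) *
        (theta p (τ * q ^ (2 * m)) / theta p τ) * (a ^ L * (a * q / (b * c)) ^ m) *
        ftTerm p q (a * q ^ (2 * m)) (b * q ^ m) (c * q ^ m) (a / τ) (k / a) L i := by
  have n0 : theta p a ≠ 0 := by simpa using hgen.base 0 (by omega)
  have n1 : theta p (a * q ^ (2 * m)) ≠ 0 := hgen.base _ (by omega)
  have n2 : thetaPoch p q (q * a) (2 * m) ≠ 0 := thetaPoch_ne_zero fun j hj => by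
    rw [mul_comm q a, mul_assoc, ← pow_succ']
    exact hgen.base _ (by omega)
  have r0 : thetaPoch p q a (2 * m) =
      theta p a * thetaPoch p q (q * a) (2 * m) / theta p (a * q ^ (2 * m)) := by
    rw [eq_div_iff n1, ← thetaPoch_succ, thetaPoch_succ_left, mul_comm a q]
  have hpow : a ^ (L - i) * (a * q / (b * c)) ^ (m + i) * τ ^ i =
      a ^ L * (a * q / (b * c)) ^ m * (k / a) ^ i := by
    have h1 : k / a = a * q / (b * c) * τ / a := by
      field_simp
      linear_combination hbal
    have h2 : a ^ L = a ^ (L - i) * a ^ i := by rw [← pow_add, Nat.sub_add_cancel hi]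
    generalize a * q / (b * c) = P at *
    rw [h1, h2, div_pow, mul_pow, pow_add]
    field_simp
  simp only [entryM, entryD, ftTerm]
  rw [if_pos (by omega), if_pos (by omega), show m + L - (m + i) = L - i by omega,
    show m + i - m = i by omega, show m + L + (m + i) = 2 * m + (L + i) by omega,
    show m + i + m = 2 * m + i by omega, thetaPoch_add p q k, thetaPoch_add p q (q * a),
    thetaPoch_add p q a, thetaPoch_add p q (q * τ), thetaPoch_add p q b, thetaPoch_add p q c,
    thetaPoch_add p q (a * q / b), thetaPoch_add p q (a * q / c),
    show k / a * (a * q ^ (2 * m)) = k * q ^ (2 * m) by field_simp,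
    show a * q ^ (2 * m) * q = q * a * q ^ (2 * m) by ring,
    show q * a * q ^ (2 * m) / (b * q ^ m) = a * q / b * q ^ m by
      rw [two_mul, pow_add]; field_simp,
    show q * a * q ^ (2 * m) / (c * q ^ m) = a * q / c * q ^ m by
      rw [two_mul, pow_add]; field_simp,
    show q * a * q ^ (2 * m) / (a / τ) = q * τ * q ^ (2 * m) by field_simp,
    show a * q ^ (2 * m) * q ^ (2 * i) = a * q ^ (2 * (m + i)) by ring, r0]
  have e1 : theta p a / theta p a = 1 := div_self n0
  have e2 : thetaPoch p q (q * a) (2 * m) / thetaPoch p q (q * a) (2 * m) = 1 := div_self n2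
  trans (theta p a / theta p a) *
    (thetaPoch p q (q * a) (2 * m) / thetaPoch p q (q * a) (2 * m)) *
    (a ^ (L - i) * (a * q / (b * c)) ^ (m + i) * τ ^ i) *
    (thetaPoch p q k (2 * m) * thetaPoch p q b m * thetaPoch p q c m /
        (thetaPoch p q (a * q / b) m * thetaPoch p q (a * q / c) m *
          thetaPoch p q (q * τ) (2 * m)) *
        (theta p (τ * q ^ (2 * m)) / theta p τ) *
      (thetaPoch p q (k / a) (L - i) * thetaPoch p q (k * q ^ (2 * m)) (L + i) /
        (thetaPoch p q q (L - i) * thetaPoch p q (q * a * q ^ (2 * m)) (L + i)) *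
        (theta p (a * q ^ (2 * (m + i))) / theta p (a * q ^ (2 * m))) *
        (thetaPoch p q (a * q ^ (2 * m)) i * thetaPoch p q (b * q ^ m) i *
          thetaPoch p q (c * q ^ m) i * thetaPoch p q (a / τ) i /
        (thetaPoch p q q i * thetaPoch p q (a * q / b * q ^ m) i *
          thetaPoch p q (a * q / c * q ^ m) i * thetaPoch p q (q * τ * q ^ (2 * m)) i))))
  · generalize (a * q / (b * c)) ^ (m + i) = P
    simp only [div_eq_mul_inv, mul_inv]
    ring
  · rw [e1, e2, hpow]
    generalize (a * q / (b * c)) ^ m = P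
    generalize (k / a) ^ i = P'
    simp only [div_eq_mul_inv, mul_inv]
    ring

lemma sum_entry_eq (hp0 : p ≠ 0) (hp : ‖p‖ < 1) (hq0 : q ≠ 0) {τ a b c k : ℂ} {m L : ℕ}
    (hk : k ≠ 0) (ha : a ≠ 0) (hb : b ≠ 0) (hc : c ≠ 0) (hτ : τ ≠ 0)
    (hbal : k * b * c = q * a * τ) (hgen : StarGeneric p q τ a b c (m + L)) :
    ∑ i ∈ Finset.range (L + 1), entryM p q a k (m + L) (m + i) * entryD p q a b c (m + i) *
        entryM p q τ a (m + i) m =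
      entryD p q k (q * τ / c) (q * τ / b) (m + L) * entryM p q τ k (m + L) m *
        entryD p q τ b c m := by
  have hgen' : FTGeneric p q (a * q ^ (2 * m)) (b * q ^ m) (c * q ^ m) (a / τ) L :=
    { base := fun j hj => by
        rw [mul_assoc, ← pow_add]
        exact hgen.base _ (by omega)
      nome := fun j hj hj' => hgen.nome j hj (by omega)
      left := fun j hj hj' => by
        have := hgen.base_left (m + j) (by omega) (by omega)
        rwa [show a * q ^ (m + j) / b = a * q ^ (2 * m) * q ^ j / (b * q ^ m) by
          rw [two_mul, pow_add, pow_add]; field_simp] at this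
      mid := fun j hj hj' => by
        have := hgen.base_right (m + j) (by omega) (by omega)
        rwa [show a * q ^ (m + j) / c = a * q ^ (2 * m) * q ^ j / (c * q ^ m) by
          rw [two_mul, pow_add, pow_add]; field_simp] at this
      right := fun j hj hj' => by
        have := hgen.inner (2 * m + j) (by omega)
        rwa [show τ * q ^ (2 * m + j) = a * q ^ (2 * m) * q ^ j / (a / τ) by
          rw [pow_add]; field_simp] at this }
  have hft := frenkel_turaev hp0 hp hq0 L (κ := k / a) (mul_ne_zero ha (pow_ne_zero _ hq0))
    (mul_ne_zero hb (pow_ne_zero _ hq0)) (mul_ne_zero hc (pow_ne_zero _ hq0))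
    (div_ne_zero ha hτ) (div_ne_zero hk ha) (by
      rw [two_mul, pow_add]
      field_simp
      linear_combination hbal) hgen'
  rw [Finset.sum_congr rfl fun i hi =>
    entry_mul_eq_ftTerm (by have := Finset.mem_range.1 hi; omega) hq0 ha hb hc hτ hbal hgen,
    ← Finset.mul_sum, hft]
  have n1 : thetaPoch p q (q * τ / b) m ≠ 0 := thetaPoch_ne_zero fun j hj => by
    have := hgen.inner_left (j + 1) (by omega) (by omega)
    rwa [show τ * q ^ (j + 1) / b = q * τ / b * q ^ j by rw [pow_succ]; ring] at this
  have n2 : thetaPoch p q (q * τ / c) m ≠ 0 := thetaPoch_ne_zero fun j hj => by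
    have := hgen.inner_right (j + 1) (by omega) (by omega)
    rwa [show τ * q ^ (j + 1) / c = q * τ / c * q ^ j by rw [pow_succ]; ring] at this
  have hpow : (k * q / (q * τ / c * (q * τ / b))) ^ (m + L) * τ ^ L * (τ * q / (b * c)) ^ m =
      a ^ L * (a * q / (b * c)) ^ m := by
    have h1 : k * q / (q * τ / c * (q * τ / b)) = a / τ := by
      field_simp
      linear_combination hbal
    have h2 : τ * q / (b * c) = a * q / (b * c) * (τ / a) := by field_simp
    generalize a * q / (b * c) = P at *
    rw [h1, h2, pow_add, mul_pow, div_pow, div_pow, div_pow]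
    field_simp
  simp only [entryM, entryD]
  rw [if_pos (by omega), show m + L - m = L by omega, show m + L + m = 2 * m + L by omega,
    thetaPoch_add p q k, thetaPoch_add p q (q * τ), mul_comm τ q,
    thetaPoch_add p q (q * τ / c), thetaPoch_add p q (q * τ / b),
    show k * q / (q * τ / c) = a * q / b by field_simp; linear_combination hbal,
    show k * q / (q * τ / b) = a * q / c by field_simp; linear_combination hbal,
    thetaPoch_add p q (a * q / b), thetaPoch_add p q (a * q / c),
    show k / a * (a * q ^ (2 * m)) = k * q ^ (2 * m) by field_simp,
    show k / a * (b * q ^ m) = q * τ / c * q ^ m by field_simp; linear_combination hbal,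
    show k / a * (c * q ^ m) = q * τ / b * q ^ m by field_simp; linear_combination hbal,
    show k / a * (a / τ) = k / τ by field_simp,
    show a * q ^ (2 * m) * q / (b * q ^ m) = a * q / b * q ^ m by
      rw [two_mul, pow_add]; field_simp,
    show a * q ^ (2 * m) * q / (c * q ^ m) = a * q / c * q ^ m by
      rw [two_mul, pow_add]; field_simp,
    show a * q ^ (2 * m) * q / (a / τ) = q * τ * q ^ (2 * m) by field_simp, ← hpow, mul_comm q τ]
  rw [mul_comm q τ] at n1 n2
  have e1 : thetaPoch p q (τ * q / b) m / thetaPoch p q (τ * q / b) m = 1 := div_self n1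
  have e2 : thetaPoch p q (τ * q / c) m / thetaPoch p q (τ * q / c) m = 1 := div_self n2
  rw [← one_mul (_ * (_ / _)), ← mul_one (1 : ℂ)]
  nth_rw 1 [← e1]
  rw [← e2]
  generalize (k * q / (τ * q / c * (τ * q / b))) ^ (m + L) = P
  generalize (τ * q / (b * c)) ^ m = P'
  simp only [div_eq_mul_inv, mul_inv]
  ring

theorem matrix_star_triangle (hp0 : p ≠ 0) (hp : ‖p‖ < 1) (hq0 : q ≠ 0) {τ a b c k : ℂ} {N : ℕ}
    (hk : k ≠ 0) (ha : a ≠ 0) (hb : b ≠ 0) (hc : c ≠ 0) (hτ : τ ≠ 0)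
    (hbal : k * b * c = q * a * τ) (hgen : StarGeneric p q τ a b c N) :
    matM p q N a k * matD p q N a b c * matM p q N τ a =
      matD p q N k (q * τ / c) (q * τ / b) * matM p q N τ k * matD p q N τ b c := by
  ext n m
  rw [matD, matD, matD, Matrix.mul_diagonal, Matrix.diagonal_mul, Matrix.mul_apply]
  simp only [Matrix.mul_diagonal, matM, Matrix.of_apply]
  rw [Fin.sum_univ_eq_sum_range (fun j => entryM p q a k n j * entryD p q a b c j *
    entryM p q τ a j m) (N + 1)]
  by_cases hmn : (m : ℕ) ≤ n
  · obtain ⟨L, hL⟩ := Nat.exists_eq_add_of_le hmn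
    have hnN : (n : ℕ) ≤ N := Nat.lt_succ_iff.1 n.2
    have hgen' : StarGeneric p q τ a b c (m + L) :=
      { base := fun j hj => hgen.base j (by omega)
        inner := fun j hj => hgen.inner j (by omega)
        nome := fun j hj hj' => hgen.nome j hj (by omega)
        base_left := fun j hj hj' => hgen.base_left j hj (by omega)
        base_right := fun j hj hj' => hgen.base_right j hj (by omega)
        inner_left := fun j hj hj' => hgen.inner_left j hj (by omega)
        inner_right := fun j hj hj' => hgen.inner_right j hj (by omega) }
    rw [hL, ← sum_entry_eq hp0 hp hq0 hk ha hb hc hτ hbal hgen']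
    have hsub : Finset.Ico (m : ℕ) (m + (L + 1)) ⊆ Finset.range (N + 1) := by
      intro j hj
      rw [Finset.mem_Ico] at hj
      exact Finset.mem_range.2 (by omega)
    rw [← Finset.sum_subset hsub, Finset.sum_Ico_eq_sum_range]
    · simp
    · intro j _ hj
      rw [Finset.mem_Ico, not_and_or] at hj
      rcases hj with hj | hj
      · rw [show entryM p q τ a j m = 0 from if_neg hj, mul_zero]
      · rw [show entryM p q a k (m + L) j = 0 from if_neg (by omega), zero_mul, zero_mul]
  · rw [show entryM p q τ k n m = 0 from if_neg hmn, mul_zero, zero_mul]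
    refine Finset.sum_eq_zero fun j _ => ?_
    by_cases hj : j ≤ n
    · rw [show entryM p q τ a j m = 0 from if_neg (by omega), mul_zero]
    · rw [show entryM p q a k n j = 0 from if_neg hj, zero_mul, zero_mul]

end MatrixIdentity

end EllipticBailey

end

noncomputable section

namespace EllipticBailey

/-! ### Analytic continuation of contour integrals -/

lemma differentiableOn_circleIntegral {U : Set ℂ} (hU : IsOpen U) {r : ℝ} (hr : 0 ≤ r)
    {F : ℂ → ℂ → ℂ} (hF : ContinuousOn (fun w : ℂ × ℂ => F w.1 w.2) (U ×ˢ Metric.sphere 0 r))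
    (hd : ∀ z ∈ Metric.sphere (0 : ℂ) r, DifferentiableOn ℂ (fun x => F x z) U) :
    DifferentiableOn ℂ (fun x => ∮ z in C(0, r), F x z) U := by
  intro x₀ hx₀
  obtain ⟨δ, hδ, hball⟩ := Metric.isOpen_iff.1 hU x₀ hx₀
  have hcb : Metric.closedBall x₀ (δ / 2) ⊆ U :=
    (Metric.closedBall_subset_ball (by linarith)).trans hball
  have hK : IsCompact (Metric.closedBall x₀ (δ / 2) ×ˢ Metric.sphere (0 : ℂ) r) :=
    (isCompact_closedBall _ _).prod (isCompact_sphere _ _)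
  obtain ⟨C, hC⟩ := hK.exists_bound_of_continuousOn (hF.mono (Set.prod_mono_left hcb))
  have hmem : ∀ θ, circleMap 0 r θ ∈ Metric.sphere (0 : ℂ) r := circleMap_mem_sphere 0 hr
  have hcontθ : ∀ x ∈ U, Continuous fun θ => F x (circleMap 0 r θ) := by
    intro x hx
    rw [← continuousOn_univ]
    exact hF.comp (f := fun θ => (x, circleMap 0 r θ))
      (by fun_prop) (fun θ _ => ⟨hx, hmem θ⟩)
  have hball4 : Metric.ball x₀ (δ / 4) ∈ 𝓝 x₀ := Metric.ball_mem_nhds _ (by linarith)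
  set G : ℂ → ℝ → ℂ := fun x θ => deriv (circleMap 0 r) θ • F x (circleMap 0 r θ) with hG
  have hGc : ∀ x ∈ U, Continuous (G x) := fun x hx => by
    have : Continuous (deriv (circleMap 0 r)) := by
      have : deriv (circleMap 0 r) = fun θ => circleMap 0 r θ * Complex.I := by
        ext θ
        exact deriv_circleMap 0 r θ
      rw [this]
      fun_prop
    exact this.smul (hcontθ x hx)
  have hGd : ∀ θ, DifferentiableOn ℂ (fun x => G x θ) U := fun θ =>
    (hd _ (hmem θ)).fun_const_smul _
  have hderiv : ∀ θ, ∀ x ∈ Metric.ball x₀ (δ / 4),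
      HasDerivAt (fun x => G x θ) (deriv (fun x => G x θ) x) x := by
    intro θ x hx
    have hxU : x ∈ U := hcb (Metric.ball_subset_closedBall
      (Metric.ball_subset_ball (by linarith) hx))
    exact ((hGd θ x hxU).differentiableAt (hU.mem_nhds hxU)).hasDerivAt
  have hbound : ∀ θ, ∀ x ∈ Metric.ball x₀ (δ / 4),
      ‖deriv (fun x => G x θ) x‖ ≤ |r| * C / (δ / 4) := by
    intro θ x hx
    have hsub : Metric.closedBall x (δ / 4) ⊆ Metric.closedBall x₀ (δ / 2) := by
      refine Metric.closedBall_subset_closedBall' ?_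
      have := Metric.mem_ball.1 hx
      linarith
    refine Complex.norm_deriv_le_of_forall_mem_sphere_norm_le (by linarith) ?_ fun y hy => ?_
    · refine DifferentiableOn.diffContOnCl ((hGd θ).mono ?_)
      exact Metric.closure_ball_subset_closedBall.trans (hsub.trans hcb)
    · have h1 : ‖F y (circleMap 0 r θ)‖ ≤ C :=
        hC (y, circleMap 0 r θ) ⟨hsub (Metric.sphere_subset_closedBall hy), hmem θ⟩
      simp only [hG, norm_smul, deriv_circleMap, norm_mul, norm_circleMap_zero, Complex.norm_I,
        mul_one]
      exact mul_le_mul_of_nonneg_left h1 (abs_nonneg _)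
  have hmeas : MeasureTheory.AEStronglyMeasurable (fun θ => deriv (fun x => G x θ) x₀)
      (MeasureTheory.volume.restrict (Set.uIoc 0 (2 * Real.pi))) := by
    obtain ⟨u, hu0, hu⟩ : ∃ u : ℕ → ℂ, (∀ n, u n ≠ 0 ∧ x₀ + u n ∈ U) ∧
        Tendsto u atTop (𝓝[≠] 0) := by
      have hlim : Tendsto (fun n : ℕ => ((δ / 2 / (n + 1 : ℝ) : ℝ) : ℂ)) atTop (𝓝 0) := by
        have : Tendsto (fun n : ℕ => δ / 2 / (n + 1 : ℝ)) atTop (𝓝 0) :=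
          (tendsto_const_div_atTop_nhds_zero_nat (δ / 2)).comp (tendsto_add_atTop_nat 1) |>.congr
            fun n => by simp
        exact_mod_cast (Complex.continuous_ofReal.tendsto 0).comp this
      have hne : ∀ n : ℕ, ((δ / 2 / (n + 1 : ℝ) : ℝ) : ℂ) ≠ 0 := fun n =>
        Complex.ofReal_ne_zero.2 (by positivity)
      refine ⟨fun n : ℕ => ((δ / 2 / (n + 1 : ℝ) : ℝ) : ℂ), fun n => ⟨hne n, hcb ?_⟩,
        tendsto_nhdsWithin_iff.2 ⟨hlim, .of_forall hne⟩⟩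
      rw [Metric.mem_closedBall, dist_self_add_left, Complex.norm_real, Real.norm_eq_abs,
        abs_of_pos (by positivity)]
      exact div_le_self (by linarith) (by linarith [(Nat.cast_nonneg n : (0 : ℝ) ≤ n)])
    refine aestronglyMeasurable_of_tendsto_ae atTop
      (f := fun n θ => (u n)⁻¹ • (G (x₀ + u n) θ - G x₀ θ)) (fun n => ?_) (.of_forall fun θ => ?_)
    · exact (((hGc _ (hu0 n).2).sub (hGc _ hx₀)).const_smul (u n)⁻¹).aestronglyMeasurable
    · exact (hderiv θ x₀ (Metric.mem_ball_self (by linarith))).tendsto_slope_zero.comp hu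
  have := (intervalIntegral.hasDerivAt_integral_of_dominated_loc_of_deriv_le (F := G)
    (F' := fun x θ => deriv (fun x => G x θ) x) (bound := fun _ => |r| * C / (δ / 4))
    (a := 0) (b := 2 * Real.pi) (μ := MeasureTheory.volume) hball4
    (by
      filter_upwards [hU.mem_nhds hx₀] with x hx
      exact (hGc x hx).aestronglyMeasurable)
    ((hGc x₀ hx₀).intervalIntegrable _ _) hmeas
    (.of_forall fun θ _ x hx => hbound θ x hx) (by simp)
    (.of_forall fun θ _ x hx => hderiv θ x hx)).2
  exact this.differentiableAt.differentiableWithinAt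

/-- The integral over the unit circle of `H / (∏ (z - aᵢ) ∏ (1 - bⱼ z))`. -/
def poleIntegral (H : ℂ → ℂ → ℂ) (as bs : List (ℂ → ℂ)) (x : ℂ) : ℂ :=
  ∮ z in C(0, 1), H x z / ((as.map fun a => z - a x).prod * (bs.map fun b => 1 - b x * z).prod)

/-- The product `∏ (1 - aᵢ bⱼ)`, whose zeros are the possible poles of the continuation of
`poleIntegral`. -/
def pairProd (as bs : List (ℂ → ℂ)) (x : ℂ) : ℂ :=
  (as.map fun a => (bs.map fun b => 1 - a x * b x).prod).prod

lemma pairProd_cons_left (a : ℂ → ℂ) (as bs : List (ℂ → ℂ)) (x : ℂ) :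
    pairProd (a :: as) bs x = (bs.map fun b => 1 - a x * b x).prod * pairProd as bs x := by
  simp [pairProd]

lemma pairProd_cons_right (b : ℂ → ℂ) (as bs : List (ℂ → ℂ)) (x : ℂ) :
    pairProd as (b :: bs) x = (as.map fun a => 1 - a x * b x).prod * pairProd as bs x := by
  induction as with
  | nil => simp [pairProd]
  | cons a as ih =>
    rw [pairProd_cons_left, ih, pairProd_cons_left]
    simp only [List.map_cons, List.prod_cons]
    ring

lemma list_prod_ne_zero_of_forall {ι : Type*} (l : List ι) (f : ι → ℂ) (h : ∀ i ∈ l, f i ≠ 0) :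
    (l.map f).prod ≠ 0 := by
  rw [Ne, List.prod_eq_zero_iff, List.mem_map]
  rintro ⟨i, hi, h0⟩
  exact h i hi h0

lemma pairProd_ne_zero {as bs : List (ℂ → ℂ)} {x : ℂ}
    (h : ∀ a ∈ as, ∀ b ∈ bs, a x * b x ≠ 1) : pairProd as bs x ≠ 0 :=
  list_prod_ne_zero_of_forall _ _ fun a ha =>
    list_prod_ne_zero_of_forall _ _ fun b hb => sub_ne_zero.2 (h a ha b hb).symm

lemma differentiableOn_list_prod {E ι : Type*} [NormedAddCommGroup E] [NormedSpace ℂ E] {s : Set E}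
    (l : List ι) (f : ι → E → ℂ) (h : ∀ i ∈ l, DifferentiableOn ℂ (f i) s) :
    DifferentiableOn ℂ (fun x => (l.map fun i => f i x).prod) s := by
  induction l with
  | nil => simp [differentiableOn_const]
  | cons i l ih =>
    simp only [List.map_cons, List.prod_cons]
    exact (h i (by simp)).mul (ih fun j hj => h j (by simp [hj]))

lemma differentiableOn_pairProd {as bs : List (ℂ → ℂ)} {U : Set ℂ}
    (has : ∀ a ∈ as, DifferentiableOn ℂ a U) (hbs : ∀ b ∈ bs, DifferentiableOn ℂ b U) :
    DifferentiableOn ℂ (pairProd as bs) U :=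
  differentiableOn_list_prod _ _ fun a ha => differentiableOn_list_prod _ _ fun b hb =>
    (differentiableOn_const 1).sub ((has a ha).mul (hbs b hb))

lemma one_sub_mul_circleIntegral {Φ : ℂ → ℂ} {a b : ℂ} (ha : ‖a‖ < 1) (hb : ‖b‖ < 1)
    (hΦ : ContinuousOn Φ (Metric.sphere 0 1)) :
    (1 - a * b) * ∮ z in C(0, 1), Φ z / ((z - a) * (1 - b * z)) =
      (∮ z in C(0, 1), Φ z / (z - a)) + b * ∮ z in C(0, 1), Φ z / (1 - b * z) := by
  have hza : ∀ z ∈ Metric.sphere (0 : ℂ) 1, z - a ≠ 0 := by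
    intro z hz h
    rw [sub_eq_zero.1 h, mem_sphere_zero_iff_norm] at hz
    exact ha.ne hz
  have hzb : ∀ z ∈ Metric.sphere (0 : ℂ) 1, 1 - b * z ≠ 0 := by
    intro z hz h
    have := congrArg norm (sub_eq_zero.1 h)
    rw [norm_one, norm_mul, mem_sphere_zero_iff_norm.1 hz, mul_one] at this
    exact hb.ne this.symm
  have h1 : CircleIntegrable (fun z => Φ z / (z - a)) 0 1 :=
    (hΦ.div (by fun_prop) hza).circleIntegrable zero_le_one
  have h2 : CircleIntegrable (fun z => b * (Φ z / (1 - b * z))) 0 1 :=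
    (continuousOn_const.mul (hΦ.div (by fun_prop) hzb)).circleIntegrable zero_le_one
  rw [← circleIntegral.integral_const_mul, ← circleIntegral.integral_const_mul,
    ← circleIntegral.integral_add h1 h2]
  refine circleIntegral.integral_congr zero_le_one fun z hz => ?_
  have := hza z hz
  have := hzb z hz
  field_simp
  ring

lemma circleIntegral_sub_circleIntegral {A : Set ℂ} (hA : IsOpen A) {r R : ℝ} (hr : 0 < r)
    (hrR : r < R) (hsub : ∀ z, r ≤ ‖z‖ → ‖z‖ ≤ R → z ∈ A) {f : ℂ → ℂ}
    (hf : DifferentiableOn ℂ f A) {a : ℂ} (har : r < ‖a‖) (haR : ‖a‖ < R) :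
    (∮ z in C(0, R), f z / (z - a)) - (∮ z in C(0, r), f z / (z - a)) =
      2 * Real.pi * Complex.I * f a := by
  have haA : a ∈ A := hsub a har.le haR.le
  have hg : DifferentiableOn ℂ (dslope f a) A :=
    (Complex.differentiableOn_dslope (hA.mem_nhds haA)).2 hf
  have hsph : ∀ {ρ : ℝ}, r ≤ ρ → ρ ≤ R → Metric.sphere (0 : ℂ) ρ ⊆ A := fun h1 h2 z hz => by
    rw [mem_sphere_zero_iff_norm] at hz
    exact hsub z (hz ▸ h1) (hz ▸ h2)
  have hann : (∮ z in C(0, R), dslope f a z) = ∮ z in C(0, r), dslope f a z := by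
    refine Complex.circleIntegral_eq_of_differentiable_on_annulus_off_countable hr hrR.le
      Set.countable_empty (hg.continuousOn.mono fun z hz => ?_) fun z hz => ?_
    · simp only [Set.mem_sdiff, Metric.mem_closedBall, dist_zero_right, Metric.mem_ball,
        not_lt] at hz
      exact hsub z hz.2 hz.1
    · simp only [Set.mem_sdiff, Metric.mem_closedBall, dist_zero_right, Metric.mem_ball,
        not_le] at hz
      have hz' : z ∈ A := hsub z hz.1.2.le hz.1.1.le
      exact (hg z hz').differentiableAt (hA.mem_nhds hz')
  have hsplit : ∀ {ρ : ℝ}, r ≤ ρ → ρ ≤ R → ρ ≠ ‖a‖ → (∮ z in C(0, ρ), f z / (z - a)) =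
      (∮ z in C(0, ρ), dslope f a z) + f a * ∮ z in C(0, ρ), (z - a)⁻¹ := by
    intro ρ h1 h2 h3
    have hne : ∀ z ∈ Metric.sphere (0 : ℂ) ρ, z - a ≠ 0 := by
      intro z hz h
      rw [sub_eq_zero.1 h, mem_sphere_zero_iff_norm] at hz
      exact h3 hz.symm
    have i1 : CircleIntegrable (dslope f a) 0 ρ :=
      (hg.continuousOn.mono (hsph h1 h2)).circleIntegrable (hr.le.trans h1)
    have i2 : CircleIntegrable (fun z => f a * (z - a)⁻¹) 0 ρ :=
      (continuousOn_const.mul (ContinuousOn.inv₀ (by fun_prop) hne)).circleIntegrable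
        (hr.le.trans h1)
    rw [← circleIntegral.integral_const_mul, ← circleIntegral.integral_add i1 i2]
    refine circleIntegral.integral_congr (hr.le.trans h1) fun z hz => ?_
    have hz' := hne z hz
    rw [dslope_of_ne _ (sub_ne_zero.1 hz'), slope_def_field]
    field_simp
    ring
  have hR : (∮ z in C(0, R), (z - a)⁻¹) = 2 * Real.pi * Complex.I :=
    circleIntegral.integral_sub_inv_of_mem_ball (by simpa using haR)
  have hr' : (∮ z in C(0, r), (z - a)⁻¹) = 0 := by
    refine Complex.circleIntegral_eq_zero_of_differentiable_on_off_countable hr.le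
      Set.countable_empty (ContinuousOn.inv₀ (by fun_prop) fun z hz h => ?_) fun z hz => ?_
    · rw [sub_eq_zero.1 h, mem_closedBall_zero_iff] at hz
      exact har.not_ge hz
    · have : z - a ≠ 0 := by
        intro h
        have hz1 := hz.1
        rw [sub_eq_zero.1 h, mem_ball_zero_iff] at hz1
        exact har.not_gt hz1
      fun_prop (disch := assumption)
  rw [hsplit hrR.le le_rfl haR.ne', hsplit le_rfl hrR.le har.ne, hann, hR, hr']
  ring

end EllipticBailey

end

noncomputable section

namespace EllipticBailey

section PoleIntegral

variable {U A : Set ℂ} {r R : ℝ} {H : ℂ → ℂ → ℂ} {as bs : List (ℂ → ℂ)}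

/-- The setting for the continuation of `poleIntegral`: a numerator `H` holomorphic for `x ∈ U`
and `z` in a neighbourhood `A` of the annulus `r ≤ |z| ≤ R`. -/
structure ContourSetting (U A : Set ℂ) (r R : ℝ) (H : ℂ → ℂ → ℂ) : Prop where
  isOpen_left : IsOpen U
  isOpen_right : IsOpen A
  pos : 0 < r
  lt_one : r < 1
  one_lt : 1 < R
  annulus : ∀ z : ℂ, r ≤ ‖z‖ → ‖z‖ ≤ R → z ∈ A
  holomorphic : DifferentiableOn ℂ (fun w : ℂ × ℂ => H w.1 w.2) (U ×ˢ A)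

/-- A list of holomorphic functions on `U` bounded by `C`. -/
def IsPoleList (U : Set ℂ) (C : ℝ) (as : List (ℂ → ℂ)) : Prop :=
  ∀ a ∈ as, DifferentiableOn ℂ a U ∧ ∀ x ∈ U, ‖a x‖ < C

lemma IsPoleList.tail {C : ℝ} {a : ℂ → ℂ} (h : IsPoleList U C (a :: as)) : IsPoleList U C as :=
  fun b hb => h b (by simp [hb])

lemma IsPoleList.head {C : ℝ} {a : ℂ → ℂ} (h : IsPoleList U C (a :: as)) :
    DifferentiableOn ℂ a U ∧ ∀ x ∈ U, ‖a x‖ < C := h a (by simp)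

lemma IsPoleList.diff {C : ℝ} (h : IsPoleList U C as) : ∀ a ∈ as, DifferentiableOn ℂ a U :=
  fun a ha => (h a ha).1

namespace ContourSetting

lemma differentiableOn_left (hS : ContourSetting U A r R H)
    {z : ℂ} (hz : z ∈ A) : DifferentiableOn ℂ (fun x => H x z) U :=
  hS.holomorphic.comp (f := fun x => (x, z)) (by fun_prop) fun x hx => ⟨hx, hz⟩

lemma differentiableOn_right (hS : ContourSetting U A r R H)
    {x : ℂ} (hx : x ∈ U) : DifferentiableOn ℂ (H x) A :=
  hS.holomorphic.comp (f := fun z => (x, z)) (by fun_prop) fun z hz => ⟨hx, hz⟩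

lemma sphere_subset (hS : ContourSetting U A r R H)
    {ρ : ℝ} (h1 : r ≤ ρ) (h2 : ρ ≤ R) : Metric.sphere (0 : ℂ) ρ ⊆ A :=
  fun z hz => by
    rw [mem_sphere_zero_iff_norm] at hz
    exact hS.annulus z (hz ▸ h1) (hz ▸ h2)

lemma continuousOn_sphere (hS : ContourSetting U A r R H)
    {x : ℂ} (hx : x ∈ U) : ContinuousOn (H x) (Metric.sphere 0 1) :=
  (hS.differentiableOn_right hx).continuousOn.mono
    (hS.sphere_subset hS.lt_one.le hS.one_lt.le)

lemma differentiableOn_integral (hS : ContourSetting U A r R H) {ρ : ℝ} (h1 : r ≤ ρ) (h2 : ρ ≤ R)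
    (has : ∀ a ∈ as, DifferentiableOn ℂ a U) (hbs : ∀ b ∈ bs, DifferentiableOn ℂ b U)
    (hne : ∀ x ∈ U, ∀ z ∈ Metric.sphere (0 : ℂ) ρ,
      (as.map fun a => z - a x).prod * (bs.map fun b => 1 - b x * z).prod ≠ 0) :
    DifferentiableOn ℂ (fun x => ∮ z in C(0, ρ), H x z /
      ((as.map fun a => z - a x).prod * (bs.map fun b => 1 - b x * z).prod)) U := by
  have hsub := hS.sphere_subset h1 h2
  refine differentiableOn_circleIntegral hS.isOpen_left (hS.pos.le.trans h1) ?_ fun z hz => ?_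
  · refine ContinuousOn.div (hS.holomorphic.continuousOn.mono (Set.prod_mono_right hsub)) ?_
      fun w hw => hne w.1 hw.1 w.2 hw.2
    refine DifferentiableOn.continuousOn (𝕜 := ℂ) (DifferentiableOn.mul ?_ ?_)
    · refine differentiableOn_list_prod _ (fun (a : ℂ → ℂ) (w : ℂ × ℂ) => w.2 - a w.1) fun a ha => ?_
      exact differentiableOn_snd.sub
        ((has a ha).comp differentiableOn_fst fun w hw => hw.1)
    · refine differentiableOn_list_prod _ (fun (b : ℂ → ℂ) (w : ℂ × ℂ) => 1 - b w.1 * w.2)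
        fun b hb => ?_
      exact (differentiableOn_const 1).sub
        (((hbs b hb).comp differentiableOn_fst fun w hw => hw.1).mul differentiableOn_snd)
  · refine (hS.differentiableOn_left (hsub hz)).div (DifferentiableOn.mul ?_ ?_)
      fun x hx => hne x hx z hz
    · exact differentiableOn_list_prod _ (fun (a : ℂ → ℂ) x => z - a x) fun a ha =>
        (differentiableOn_const z).sub (has a ha)
    · exact differentiableOn_list_prod _ (fun (b : ℂ → ℂ) x => 1 - b x * z) fun b hb =>
        (differentiableOn_const 1).sub ((hbs b hb).mul (differentiableOn_const z))

lemma circleIntegral_eq (hS : ContourSetting U A r R H)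
    {ρ₁ ρ₂ : ℝ} (h1 : r ≤ ρ₁) (h12 : ρ₁ ≤ ρ₂) (h2 : ρ₂ ≤ R) {x : ℂ}
    (hx : x ∈ U) (hne : ∀ z : ℂ, ρ₁ ≤ ‖z‖ → ‖z‖ ≤ ρ₂ →
      (as.map fun a => z - a x).prod * (bs.map fun b => 1 - b x * z).prod ≠ 0) :
    (∮ z in C(0, ρ₂), H x z /
      ((as.map fun a => z - a x).prod * (bs.map fun b => 1 - b x * z).prod)) =
    ∮ z in C(0, ρ₁), H x z /
      ((as.map fun a => z - a x).prod * (bs.map fun b => 1 - b x * z).prod) := by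
  have hd : ∀ z : ℂ, ρ₁ ≤ ‖z‖ → ‖z‖ ≤ ρ₂ → DifferentiableAt ℂ (fun z => H x z /
      ((as.map fun a => z - a x).prod * (bs.map fun b => 1 - b x * z).prod)) z := by
    intro z hz1 hz2
    have hzA : z ∈ A := hS.annulus z (h1.trans hz1) (hz2.trans h2)
    refine DifferentiableAt.div ((hS.differentiableOn_right hx z hzA).differentiableAt
      (hS.isOpen_right.mem_nhds hzA)) (DifferentiableAt.mul ?_ ?_) (hne z hz1 hz2)
    · have := differentiableOn_list_prod (s := Set.univ) as (fun (a : ℂ → ℂ) (z : ℂ) => z - a x)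
        fun a _ => by fun_prop
      exact (this z trivial).differentiableAt univ_mem
    · have := differentiableOn_list_prod (s := Set.univ) bs (fun (b : ℂ → ℂ) (z : ℂ) => 1 - b x * z)
        fun a _ => by fun_prop
      exact (this z trivial).differentiableAt univ_mem
  refine Complex.circleIntegral_eq_of_differentiable_on_annulus_off_countable
    (hS.pos.trans_le h1) h12 Set.countable_empty (fun z hz => ?_) fun z hz => ?_
  · simp only [Set.mem_sdiff, Metric.mem_closedBall, dist_zero_right, Metric.mem_ball,
      not_lt] at hz
    exact (hd z hz.2 hz.1).continuousAt.continuousWithinAt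
  · simp only [Set.mem_sdiff, Metric.mem_closedBall, dist_zero_right, Metric.mem_ball,
      not_le] at hz
    exact hd z hz.1.2.le hz.1.1.le

lemma exists_continuation_nil_left (hS : ContourSetting U A r R H) (hbs : IsPoleList U r⁻¹ bs) :
    DifferentiableOn ℂ (fun x => ∮ z in C(0, r), H x z /
      ((([] : List (ℂ → ℂ)).map fun a => z - a x).prod *
        (bs.map fun b => 1 - b x * z).prod)) U ∧
    ∀ x ∈ U, (∀ b ∈ bs, ‖b x‖ < 1) → (∮ z in C(0, r), H x z /
      ((([] : List (ℂ → ℂ)).map fun a => z - a x).prod *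
        (bs.map fun b => 1 - b x * z).prod)) = poleIntegral H [] bs x := by
  constructor
  · refine hS.differentiableOn_integral le_rfl (hS.lt_one.le.trans hS.one_lt.le) (by simp)
      hbs.diff fun x hx z hz => ?_
    rw [List.map_nil, List.prod_nil, one_mul]
    refine list_prod_ne_zero_of_forall _ _ fun b hb h => ?_
    have h' := congrArg norm (sub_eq_zero.1 h)
    rw [norm_one, norm_mul, mem_sphere_zero_iff_norm.1 hz] at h'
    have := mul_lt_mul_of_pos_right ((hbs b hb).2 x hx) hS.pos
    rw [← h', inv_mul_cancel₀ hS.pos.ne'] at this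
    exact this.false
  · intro x hx hb1
    refine (hS.circleIntegral_eq le_rfl hS.lt_one.le hS.one_lt.le hx fun z _ hz => ?_).symm
    rw [List.map_nil, List.prod_nil, one_mul]
    refine list_prod_ne_zero_of_forall _ _ fun b hb h => ?_
    have h' := congrArg norm (sub_eq_zero.1 h)
    rw [norm_one, norm_mul] at h'
    have : ‖b x‖ * ‖z‖ ≤ ‖b x‖ := mul_le_of_le_one_right (norm_nonneg _) hz
    linarith [hb1 b hb]

lemma exists_continuation_nil_right (hS : ContourSetting U A r R H) (has : IsPoleList U R as) :
    DifferentiableOn ℂ (fun x => ∮ z in C(0, R), H x z /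
      ((as.map fun a => z - a x).prod *
        (([] : List (ℂ → ℂ)).map fun b => 1 - b x * z).prod)) U ∧
    ∀ x ∈ U, (∀ a ∈ as, ‖a x‖ < 1) → (∮ z in C(0, R), H x z /
      ((as.map fun a => z - a x).prod *
        (([] : List (ℂ → ℂ)).map fun b => 1 - b x * z).prod)) = poleIntegral H as [] x := by
  constructor
  · refine hS.differentiableOn_integral (hS.lt_one.le.trans hS.one_lt.le) le_rfl has.diff
      (by simp) fun x hx z hz => ?_
    rw [List.map_nil, List.prod_nil, mul_one]
    refine list_prod_ne_zero_of_forall _ _ fun a ha h => ?_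
    rw [sub_eq_zero.1 h, mem_sphere_zero_iff_norm] at hz
    exact ((has a ha).2 x hx).ne hz
  · intro x hx ha1
    refine hS.circleIntegral_eq hS.lt_one.le hS.one_lt.le le_rfl hx fun z hz _ => ?_
    rw [List.map_nil, List.prod_nil, mul_one]
    refine list_prod_ne_zero_of_forall _ _ fun a ha h => ?_
    rw [sub_eq_zero.1 h] at hz
    exact (ha1 a ha).not_ge hz

/-- Partial fractions with respect to one pole inside and one pole outside the unit circle. -/
lemma poleIntegral_split (hS : ContourSetting U A r R H)
    {a b : ℂ → ℂ} {as₁ as₂ bs₁ bs₂ : List (ℂ → ℂ)} {x : ℂ} (hx : x ∈ U)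
    (has : ∀ a' ∈ as₁ ++ a :: as₂, ‖a' x‖ < 1) (hbs : ∀ b' ∈ bs₁ ++ b :: bs₂, ‖b' x‖ < 1) :
    (1 - a x * b x) * poleIntegral H (as₁ ++ a :: as₂) (bs₁ ++ b :: bs₂) x =
      poleIntegral H (as₁ ++ a :: as₂) (bs₁ ++ bs₂) x +
        b x * poleIntegral H (as₁ ++ as₂) (bs₁ ++ b :: bs₂) x := by
  set Φ : ℂ → ℂ := fun z => H x z / (((as₁ ++ as₂).map fun a => z - a x).prod *
    ((bs₁ ++ bs₂).map fun b => 1 - b x * z).prod) with hΦ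
  have hΦc : ContinuousOn Φ (Metric.sphere 0 1) := by
    refine (hS.continuousOn_sphere hx).div ?_ fun z hz => mul_ne_zero ?_ ?_
    · refine DifferentiableOn.continuousOn (𝕜 := ℂ) (DifferentiableOn.mul ?_ ?_)
      · exact differentiableOn_list_prod _ (fun (a : ℂ → ℂ) (z : ℂ) => z - a x)
          fun a _ => by fun_prop
      · exact differentiableOn_list_prod _ (fun (b : ℂ → ℂ) (z : ℂ) => 1 - b x * z)
          fun a _ => by fun_prop
    · refine list_prod_ne_zero_of_forall _ _ fun a' ha h => ?_
      rw [sub_eq_zero.1 h, mem_sphere_zero_iff_norm] at hz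
      refine (has a' ?_).ne hz
      rw [List.mem_append] at ha ⊢
      exact ha.imp_right fun h => List.mem_cons_of_mem _ h
    · refine list_prod_ne_zero_of_forall _ _ fun b' hb h => ?_
      have h' := congrArg norm (sub_eq_zero.1 h)
      rw [norm_one, norm_mul, mem_sphere_zero_iff_norm.1 hz, mul_one] at h'
      refine (hbs b' ?_).ne' h'
      rw [List.mem_append] at hb ⊢
      exact hb.imp_right fun h => List.mem_cons_of_mem _ h
  have h := one_sub_mul_circleIntegral (has a (by simp)) (hbs b (by simp)) hΦc
  have e1 : poleIntegral H (as₁ ++ a :: as₂) (bs₁ ++ b :: bs₂) x =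
      ∮ z in C(0, 1), Φ z / ((z - a x) * (1 - b x * z)) := by
    simp only [poleIntegral, hΦ, div_div]
    congr 1
    ext z
    simp only [List.map_append, List.map_cons, List.prod_append, List.prod_cons]
    congr 1
    ring
  have e2 : poleIntegral H (as₁ ++ a :: as₂) (bs₁ ++ bs₂) x =
      ∮ z in C(0, 1), Φ z / (z - a x) := by
    simp only [poleIntegral, hΦ, div_div]
    congr 1
    ext z
    simp only [List.map_append, List.map_cons, List.prod_append, List.prod_cons]
    congr 1
    ring
  have e3 : poleIntegral H (as₁ ++ as₂) (bs₁ ++ b :: bs₂) x =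
      ∮ z in C(0, 1), Φ z / (1 - b x * z) := by
    simp only [poleIntegral, hΦ, div_div]
    congr 1
    ext z
    simp only [List.map_append, List.map_cons, List.prod_append, List.prod_cons]
    congr 1
    ring
  rw [e1, e2, e3, h]

/-- After multiplication by `pairProd`, `poleIntegral` continues holomorphically to all of `U`. -/
theorem exists_continuation (hS : ContourSetting U A r R H)
    (has : IsPoleList U R as) (hbs : IsPoleList U r⁻¹ bs) :
    ∃ J : ℂ → ℂ, DifferentiableOn ℂ J U ∧ ∀ x ∈ U, (∀ a ∈ as, ‖a x‖ < 1) →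
      (∀ b ∈ bs, ‖b x‖ < 1) → J x = pairProd as bs x * poleIntegral H as bs x := by
  induction as generalizing bs with
  | nil =>
    obtain ⟨h1, h2⟩ := hS.exists_continuation_nil_left hbs
    exact ⟨_, h1, fun x hx _ hb => by rw [h2 x hx hb]; simp [pairProd]⟩
  | cons a as iha =>
    induction bs with
    | nil =>
      obtain ⟨h1, h2⟩ := hS.exists_continuation_nil_right has
      exact ⟨_, h1, fun x hx ha _ => by rw [h2 x hx ha]; simp [pairProd]⟩
    | cons b bs ihb =>
      obtain ⟨J₁, hJ₁, hJ₁'⟩ := ihb hbs.tail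
      obtain ⟨J₂, hJ₂, hJ₂'⟩ := iha has.tail hbs
      refine ⟨fun x => (as.map fun a => 1 - a x * b x).prod * J₁ x +
        b x * (bs.map fun b => 1 - a x * b x).prod * J₂ x, ?_, fun x hx ha hb => ?_⟩
      · have d1 : DifferentiableOn ℂ (fun x => (as.map fun a => 1 - a x * b x).prod) U :=
          differentiableOn_list_prod _ _ fun a' ha' => (differentiableOn_const 1).sub
            ((has.tail.diff a' ha').mul hbs.head.1)
        have d2 : DifferentiableOn ℂ (fun x => (bs.map fun b => 1 - a x * b x).prod) U :=
          differentiableOn_list_prod _ _ fun b' hb' => (differentiableOn_const 1).sub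
            (has.head.1.mul (hbs.tail.diff b' hb'))
        exact (d1.mul hJ₁).add ((hbs.head.1.mul d2).mul hJ₂)
      · have hsplit := hS.poleIntegral_split (as₁ := []) (bs₁ := []) hx ha hb
        simp only [List.nil_append] at hsplit
        beta_reduce
        rw [hJ₁' x hx ha fun b' hb' => hb b' (by simp [hb']),
          hJ₂' x hx (fun a' ha' => ha a' (by simp [ha'])) hb]
        simp only [pairProd_cons_left, pairProd_cons_right, List.map_cons, List.prod_cons]
        linear_combination -(as.map fun a => 1 - a x * b x).prod *
          (bs.map fun b => 1 - a x * b x).prod * pairProd as bs x * hsplit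

/-- The value of the continuation of `pairProd * poleIntegral` at a point where a pole `a` inside
the circle and a pole `1 / b` outside the circle pinch the contour. -/
theorem exists_continuation_pinch (hS : ContourSetting U A r R H)
    {a b : ℂ → ℂ} (has : IsPoleList U R (a :: as))
    (hbs : IsPoleList U r⁻¹ (b :: bs)) :
    ∃ J : ℂ → ℂ, DifferentiableOn ℂ J U ∧ (∀ x ∈ U, (∀ a' ∈ a :: as, ‖a' x‖ < 1) →
      (∀ b' ∈ b :: bs, ‖b' x‖ < 1) →
      J x = pairProd (a :: as) (b :: bs) x * poleIntegral H (a :: as) (b :: bs) x) ∧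
      ∀ x ∈ U, a x * b x = 1 →
        J x = 2 * Real.pi * Complex.I * H x (a x) * b x ^ as.length * pairProd as bs x := by
  induction as with
  | nil =>
    induction bs with
    | nil =>
      obtain ⟨h1, h1'⟩ := hS.exists_continuation_nil_right has
      obtain ⟨h2, h2'⟩ := hS.exists_continuation_nil_left hbs
      refine ⟨_, h1.add (hbs.head.1.mul h2), fun x hx ha hb => ?_, fun x hx hab => ?_⟩
      · have hsplit := hS.poleIntegral_split (as₁ := []) (bs₁ := []) hx ha hb
        simp only [List.nil_append] at hsplit
        simp only [Pi.add_apply, Pi.mul_apply]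
        rw [h1' x hx ha, h2' x hx hb, ← hsplit]
        simp [pairProd]
      · have hbne : b x ≠ 0 := right_ne_zero_of_mul_eq_one hab
        have har : r < ‖a x‖ := by
          have h := hbs.head.2 x hx
          rw [eq_inv_of_mul_eq_one_left hab, norm_inv]
          exact (lt_inv_comm₀ (norm_pos_iff.2 hbne) hS.pos).1 h
        have hres := circleIntegral_sub_circleIntegral hS.isOpen_right hS.pos
          (hS.lt_one.trans hS.one_lt) hS.annulus (hS.differentiableOn_right hx) har
          (has.head.2 x hx)
        simp only [Pi.add_apply, Pi.mul_apply, List.map_cons, List.map_nil, List.prod_cons,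
          List.prod_nil, mul_one, one_mul, List.length_nil, pow_zero, pairProd]
        rw [← hres, sub_eq_add_neg]
        congr 1
        rw [← circleIntegral.integral_const_mul, ← neg_one_mul,
          ← circleIntegral.integral_const_mul]
        refine circleIntegral.integral_congr hS.pos.le fun z hz => ?_
        have hza : 1 - b x * z = -(b x) * (z - a x) := by linear_combination (-1 : ℂ) * hab
        rw [hza]
        have : z - a x ≠ 0 := by
          intro h
          rw [sub_eq_zero.1 h, mem_sphere_zero_iff_norm] at hz
          exact har.ne' hz
        field_simp
    | cons d bs ihb =>
      have hbs1 : IsPoleList U r⁻¹ (b :: bs) := fun b' hb' => hbs b' (by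
        rcases List.mem_cons.1 hb' with h | h
        · simp [h]
        · simp [h])
      obtain ⟨J₁, hJ₁, hJ₁', hJ₁''⟩ := ihb hbs1
      obtain ⟨J₂, hJ₂, hJ₂'⟩ := hS.exists_continuation has.tail hbs
      have hd := (hbs d (by simp)).1
      refine ⟨fun x => J₁ x + d x * ((1 - a x * b x) * (bs.map fun b => 1 - a x * b x).prod) * J₂ x,
        ?_, fun x hx ha hb => ?_, fun x hx hab => ?_⟩
      · have d2 : DifferentiableOn ℂ (fun x => (bs.map fun b => 1 - a x * b x).prod) U :=
          differentiableOn_list_prod _ _ fun b' hb' => (differentiableOn_const 1).sub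
            (has.head.1.mul (hbs.tail.tail.diff b' hb'))
        exact hJ₁.add ((hd.mul (((differentiableOn_const 1).sub
          (has.head.1.mul hbs.head.1)).mul d2)).mul hJ₂)
      · have hsplit := hS.poleIntegral_split (as₁ := []) (bs₁ := [b]) hx ha hb
        simp only [List.nil_append, List.singleton_append] at hsplit
        beta_reduce
        rw [hJ₁' x hx ha fun b' hb' => hb b' (by
            rcases List.mem_cons.1 hb' with h | h
            · simp [h]
            · simp [h]),
          hJ₂' x hx (by simp) hb]
        simp only [pairProd, List.map_cons, List.map_nil, List.prod_cons, List.prod_nil, mul_one,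
          one_mul]
        linear_combination -(1 - a x * b x) * (bs.map fun b => 1 - a x * b x).prod * hsplit
      · beta_reduce
        rw [hJ₁'' x hx hab, hab]
        simp [pairProd]
  | cons c as iha =>
    have has1 : IsPoleList U R (a :: as) := fun a' ha' => has a' (by
      rcases List.mem_cons.1 ha' with h | h
      · simp [h]
      · simp [h])
    obtain ⟨J₁, hJ₁, hJ₁', hJ₁''⟩ := iha has1
    obtain ⟨J₂, hJ₂, hJ₂'⟩ := hS.exists_continuation has hbs.tail
    refine ⟨fun x => b x * (bs.map fun b => 1 - c x * b x).prod * J₁ x +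
      (1 - a x * b x) * (as.map fun a => 1 - a x * b x).prod * J₂ x,
      ?_, fun x hx ha hb => ?_, fun x hx hab => ?_⟩
    · have d1 : DifferentiableOn ℂ (fun x => (as.map fun a => 1 - a x * b x).prod) U :=
        differentiableOn_list_prod _ _ fun a' ha' => (differentiableOn_const 1).sub
          ((has.tail.tail.diff a' ha').mul hbs.head.1)
      have d2 : DifferentiableOn ℂ (fun x => (bs.map fun b => 1 - c x * b x).prod) U :=
        differentiableOn_list_prod _ _ fun b' hb' => (differentiableOn_const 1).sub
          (has.tail.head.1.mul (hbs.tail.diff b' hb'))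
      exact ((hbs.head.1.mul d2).mul hJ₁).add ((((differentiableOn_const 1).sub
        (has.head.1.mul hbs.head.1)).mul d1).mul hJ₂)
    · have hsplit := hS.poleIntegral_split (as₁ := [a]) (bs₁ := []) hx ha hb
      simp only [List.nil_append, List.singleton_append] at hsplit
      beta_reduce
      rw [hJ₁' x hx (fun a' ha' => ha a' (by
          rcases List.mem_cons.1 ha' with h | h
          · simp [h]
          · simp [h])) hb,
        hJ₂' x hx ha fun b' hb' => hb b' (by simp [hb'])]
      simp only [pairProd_cons_left, pairProd_cons_right, List.map_cons, List.prod_cons]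
      linear_combination -(1 - a x * b x) * (as.map fun a => 1 - a x * b x).prod *
        (bs.map fun b => 1 - a x * b x).prod * (bs.map fun b => 1 - c x * b x).prod *
        pairProd as bs x * hsplit
    · beta_reduce
      rw [hJ₁'' x hx hab, hab, pairProd_cons_left, List.length_cons, pow_succ]
      ring

end ContourSetting

end PoleIntegral

end EllipticBailey

end

noncomputable section

namespace EllipticBailey

/-! ### Gluing of meromorphic functions on annuli -/

/-- The annulus `B⁻¹ < |x| < B`. -/
def annulus (B : ℝ) : Set ℂ := {x | B⁻¹ < ‖x‖ ∧ ‖x‖ < B}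

lemma isOpen_annulus (B : ℝ) : IsOpen (annulus B) :=
  (isOpen_lt continuous_const continuous_norm).inter (isOpen_lt continuous_norm continuous_const)

lemma ne_zero_of_mem_annulus {B : ℝ} {x : ℂ} (hx : x ∈ annulus B) : x ≠ 0 := by
  rintro rfl
  obtain ⟨h1, h2⟩ := hx
  rw [norm_zero] at h1 h2
  exact absurd (inv_lt_zero.1 h1) h2.not_gt

lemma inv_mem_annulus {B : ℝ} {x : ℂ} (hx : x ∈ annulus B) : x⁻¹ ∈ annulus B := by
  have h0 : 0 < ‖x‖ := norm_pos_iff.2 (ne_zero_of_mem_annulus hx)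
  have hB : 0 < B := h0.trans hx.2
  refine ⟨?_, ?_⟩
  · rw [norm_inv]
    exact (inv_lt_inv₀ hB h0).2 hx.2
  · rw [norm_inv]
    exact (inv_lt_comm₀ h0 hB).2 hx.1

lemma one_mem_annulus {B : ℝ} (hB : 1 < B) : (1 : ℂ) ∈ annulus B :=
  ⟨by rw [norm_one]; exact inv_lt_one_of_one_lt₀ hB, by rwa [norm_one]⟩

lemma mem_annulus_of_norm_eq_one {B : ℝ} (hB : 1 < B) {x : ℂ} (hx : ‖x‖ = 1) : x ∈ annulus B :=
  ⟨by rw [hx]; exact inv_lt_one_of_one_lt₀ hB, by rwa [hx]⟩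

lemma annulus_subset {B B' : ℝ} (hB : 0 < B) (h : B ≤ B') : annulus B ⊆ annulus B' :=
  fun _ hx => ⟨(inv_anti₀ hB h).trans_lt hx.1, hx.2.trans_le h⟩

lemma mem_annulus_min {B B' : ℝ} {x : ℂ} (hx : x ∈ annulus B) (hx' : x ∈ annulus B') :
    x ∈ annulus (min B B') := by
  rcases min_choice B B' with h | h <;> rw [h] <;> assumption

lemma mem_annulus_self {x : ℂ} (hx : x ≠ 0) : x ∈ annulus (‖x‖ + ‖x‖⁻¹ + 1) := by
  have h0 : 0 < ‖x‖ := norm_pos_iff.2 hx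
  have h1 : 0 < ‖x‖⁻¹ := inv_pos.2 h0
  exact ⟨(inv_lt_comm₀ (by linarith) h0).2 (by linarith), by linarith⟩

lemma one_lt_of_ne_zero {x : ℂ} (hx : x ≠ 0) : 1 < ‖x‖ + ‖x‖⁻¹ + 1 := by
  have h0 : 0 < ‖x‖ := norm_pos_iff.2 hx
  have h1 : 0 < ‖x‖⁻¹ := inv_pos.2 h0
  linarith

lemma isConnected_annulus {B : ℝ} (hB : 1 < B) : IsConnected (annulus B) := by
  refine ⟨⟨1, one_mem_annulus hB⟩, ?_⟩
  have hB0 : 0 < B := one_pos.trans hB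
  have h : annulus B = Complex.exp '' (Complex.re ⁻¹' Set.Ioo (-Real.log B) (Real.log B)) := by
    ext x
    constructor
    · intro hx
      have h0 := ne_zero_of_mem_annulus hx
      refine ⟨Complex.log x, ?_, Complex.exp_log h0⟩
      rw [Set.mem_preimage, Complex.log_re, Set.mem_Ioo, ← Real.log_inv]
      exact ⟨Real.log_lt_log (inv_pos.2 hB0) hx.1, Real.log_lt_log (norm_pos_iff.2 h0) hx.2⟩
    · rintro ⟨w, hw, rfl⟩
      rw [Set.mem_preimage, Set.mem_Ioo] at hw
      refine ⟨?_, ?_⟩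
      · rw [Complex.norm_exp, ← Real.exp_log hB0, ← Real.exp_neg]
        exact Real.exp_lt_exp.2 hw.1
      · rw [Complex.norm_exp, ← Real.exp_log hB0]
        exact Real.exp_lt_exp.2 hw.2
  rw [h]
  exact ((convex_Ioo _ _).linear_preimage Complex.reLm).isPreconnected.image _
    Complex.continuous_exp.continuousOn

/-- Two functions meromorphic on an annulus that agree near `1` agree near every point. -/
lemma eventuallyEq_of_eventuallyEq_one {B : ℝ} (hB : 1 < B) {F G : ℂ → ℂ}
    (hF : MeromorphicOn F (annulus B)) (hG : MeromorphicOn G (annulus B))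
    (h : F =ᶠ[𝓝 1] G) {x : ℂ} (hx : x ∈ annulus B) : F =ᶠ[𝓝[≠] x] G := by
  have hone : meromorphicOrderAt (F - G) 1 = ⊤ := by
    rw [meromorphicOrderAt_eq_top_iff]
    filter_upwards [h.filter_mono nhdsWithin_le_nhds] with z hz
    simp [hz]
  have hall : meromorphicOrderAt (F - G) x = ⊤ := by
    by_contra hne
    exact ((hF.sub hG).exists_meromorphicOrderAt_ne_top_iff_forall_mem
      (isConnected_annulus hB)).1 ⟨x, hx, hne⟩ 1 (one_mem_annulus hB) hone
  rw [meromorphicOrderAt_eq_top_iff] at hall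
  filter_upwards [hall] with z hz
  exact sub_eq_zero.1 hz

lemma eventuallyEq_of_eqOn_annulus {B ρ : ℝ} (hB : 1 < B) (hρ : 1 < ρ) {f F G : ℂ → ℂ}
    (hF : MeromorphicOn F (annulus B)) (hG : MeromorphicOn G (annulus B))
    (hFf : Set.EqOn F f (annulus B ∩ annulus ρ)) (hGf : Set.EqOn G f (annulus B ∩ annulus ρ))
    {x : ℂ} (hx : x ∈ annulus B) : F =ᶠ[𝓝[≠] x] G := by
  refine eventuallyEq_of_eventuallyEq_one hB hF hG ?_ hx
  filter_upwards [(isOpen_annulus B).mem_nhds (one_mem_annulus hB),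
    (isOpen_annulus ρ).mem_nhds (one_mem_annulus hρ)] with z h1 h2
  rw [hFf ⟨h1, h2⟩, hGf ⟨h1, h2⟩]

/-- Continuations of `f` to all annuli combine to a continuation to the punctured plane. -/
theorem exists_continuation_of_annuli {ρ : ℝ} (hρ : 1 < ρ) {f : ℂ → ℂ}
    (hf : DifferentiableOn ℂ f (annulus ρ))
    (h : ∀ B, 1 < B → ∃ F : ℂ → ℂ, MeromorphicOn F (annulus B) ∧
      Set.EqOn F f (annulus B ∩ annulus ρ)) :
    ∃ F : ℂ → ℂ, MeromorphicOn F {w | w ≠ 0} ∧ Set.EqOn F f (annulus ρ) := by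
  choose! Φ hΦ hΦf using h
  set β : ℂ → ℝ := fun x => ‖x‖ + ‖x‖⁻¹ + 1 with hβ
  refine ⟨fun x => toMeromorphicNFAt (Φ (β x)) x x, fun x hx => ?_, fun x hx => ?_⟩
  · have hx0 : x ≠ 0 := hx
    have hβx : 1 < β x := one_lt_of_ne_zero hx0
    have hxm : x ∈ annulus (β x) := mem_annulus_self hx0
    refine (hΦ (β x) hβx x hxm).congr ?_
    filter_upwards [(hΦ (β x) hβx x hxm).eventually_analyticAt,
      nhdsWithin_le_nhds ((isOpen_annulus (β x)).mem_nhds hxm)] with y hy hym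
    have hy0 := ne_zero_of_mem_annulus hym
    have hβy : 1 < β y := one_lt_of_ne_zero hy0
    have hgerm : Φ (β y) =ᶠ[𝓝[≠] y] Φ (β x) := by
      have s1 : annulus (min (β y) (β x)) ⊆ annulus (β y) :=
        annulus_subset (one_pos.trans (lt_min hβy hβx)) (min_le_left _ _)
      have s2 : annulus (min (β y) (β x)) ⊆ annulus (β x) :=
        annulus_subset (one_pos.trans (lt_min hβy hβx)) (min_le_right _ _)
      exact eventuallyEq_of_eqOn_annulus (lt_min hβy hβx) hρ ((hΦ _ hβy).mono_set s1)
        ((hΦ _ hβx).mono_set s2) ((hΦf _ hβy).mono (Set.inter_subset_inter_left _ s1))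
        ((hΦf _ hβx).mono (Set.inter_subset_inter_left _ s2))
        (mem_annulus_min (mem_annulus_self hy0) hym)
    rw [(toMeromorphicNFAt_eventuallyEq_nhds_congr hgerm).eq_of_nhds,
      toMeromorphicNFAt_eq_self.2 hy.meromorphicNFAt]
  · have hx0 := ne_zero_of_mem_annulus hx
    have hβx : 1 < β x := one_lt_of_ne_zero hx0
    have hgerm : Φ (β x) =ᶠ[𝓝[≠] x] f := by
      filter_upwards [nhdsWithin_le_nhds ((isOpen_annulus (β x)).mem_nhds (mem_annulus_self hx0)),
        nhdsWithin_le_nhds ((isOpen_annulus ρ).mem_nhds hx)] with z h1 h2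
      exact hΦf _ hβx ⟨h1, h2⟩
    have han : AnalyticAt ℂ f x := hf.analyticAt ((isOpen_annulus ρ).mem_nhds hx)
    change toMeromorphicNFAt (Φ (β x)) x x = f x
    rw [(toMeromorphicNFAt_eventuallyEq_nhds_congr hgerm).eq_of_nhds,
      toMeromorphicNFAt_eq_self.2 han.meromorphicNFAt]

end EllipticBailey

end

noncomputable section

namespace EllipticBailey

variable {p q : ℂ}

/-! ### The kernel of the transformation -/

/-- A factorization of `(v;p,q)_∞` into the linear factors `1 - c v`, `c ∈ L`, and an entire
function without zeros in the disc of radius `T`. -/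
structure IsSplit (p q : ℂ) (T : ℝ) (L : List ℂ) (E : ℂ → ℂ) : Prop where
  differentiable : Differentiable ℂ E
  ne_zero : ∀ v, ‖v‖ < T → E v ≠ 0
  eq : ∀ v, dPoch p q v = (L.map fun c => 1 - c * v).prod * E v
  mem : ∀ c ∈ L, ∃ i j : ℕ, c = p ^ i * q ^ j

lemma exists_isSplit_cons (hp : ‖p‖ < 1) (hq : ‖q‖ < 1) (T : ℝ) (k : ℕ) :
    ∃ L E, IsSplit p q T (q ^ k :: L) E := by
  have hc := summable_norm_pow_mul_pow hp hq
  have hfin : {jk : ℕ × ℕ | ¬ ‖p ^ jk.1 * q ^ jk.2‖ < (|T| + 1)⁻¹}.Finite := by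
    have := hc.tendsto_cofinite_zero.eventually_lt_const (inv_pos.2 (by positivity : 0 < |T| + 1))
    exact this
  set C : Finset (ℕ × ℕ) := hfin.toFinset ∪ {(0, k)} with hC
  have hmem : (0, k) ∈ C := by simp [hC]
  have hsum : Summable fun i : {i // i ∉ C} => ‖p ^ i.1.1 * q ^ i.1.2‖ :=
    hc.comp_injective Subtype.val_injective
  refine ⟨(C.erase (0, k)).toList.map fun jk => p ^ jk.1 * q ^ jk.2,
    eulerProd (fun i : {i // i ∉ C} => p ^ i.1.1 * q ^ i.1.2), differentiable_eulerProd hsum,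
    fun v hv => eulerProd_ne_zero_of_norm_lt hsum fun i => ?_, fun v => ?_, fun c hcm => ?_⟩
  · have hi : ‖p ^ i.1.1 * q ^ i.1.2‖ < (|T| + 1)⁻¹ := by
      by_contra h
      exact i.2 (by simp only [hC, Finset.mem_union, Set.Finite.mem_toFinset]; exact Or.inl h)
    rw [norm_mul]
    have hT : ‖v‖ < |T| + 1 := by linarith [le_abs_self T]
    calc ‖v‖ * ‖p ^ i.1.1 * q ^ i.1.2‖ ≤ (|T| + 1) * ‖p ^ i.1.1 * q ^ i.1.2‖ :=
          mul_le_mul_of_nonneg_right hT.le (norm_nonneg _)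
      _ < (|T| + 1) * (|T| + 1)⁻¹ := mul_lt_mul_of_pos_left hi (by positivity)
      _ = 1 := mul_inv_cancel₀ (by positivity)
  · rw [dPoch, eulerProd_eq_prod_mul hc C v, ← Finset.mul_prod_erase C _ hmem]
    simp only [List.map_cons, List.map_map, List.prod_cons, pow_zero, one_mul,
      Function.comp_def, Finset.prod_map_toList, mul_comm v]
  · rcases List.mem_cons.1 hcm with rfl | h
    · exact ⟨0, k, by simp⟩
    · obtain ⟨jk, -, rfl⟩ := List.mem_map.1 h
      exact ⟨_, _, rfl⟩

lemma inv_ellGamma_mul_ellGamma_inv (hp : ‖p‖ < 1) (hq : ‖q‖ < 1) {Z : ℂ} (hZ : Z ≠ 0)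
    (h1 : dPoch p q (p * q * Z) ≠ 0) (h2 : dPoch p q (p * q * Z⁻¹) ≠ 0) :
    (ellGamma p q Z * ellGamma p q Z⁻¹)⁻¹ = theta p Z * theta q Z⁻¹ := by
  have e : ∀ v, dPoch p q v = qPoch v p * (qPoch (v * q) q * dPoch p q (p * q * v)) := fun v => by
    rw [dPoch_eq_mul_right hp hq v, dPoch_eq_mul_left hp hq (v * q)]
    ring_nf
  rw [ellGamma_eq_div, ellGamma_eq_div, inv_inv, e Z, e Z⁻¹, theta, theta, inv_inv,
    qPoch_eq_mul hp Z⁻¹, qPoch_eq_mul hq Z⁻¹, mul_comm q Z, mul_comm p Z⁻¹]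
  generalize dPoch p q (p * q * Z) = d₁ at h1 ⊢
  generalize dPoch p q (p * q * Z⁻¹) = d₂ at h2 ⊢
  field_simp

/-- The numerator of the kernel of the transformation, after the factors that may vanish have been
removed from the denominator. -/
def kernelNum (p q t : ℂ) (d : ℕ) (E E' : ℂ → ℂ) (x z : ℂ) : ℂ :=
  z ^ (d + d) * (dPoch p q (p * q * (t * x * z)⁻¹) * dPoch p q (p * q * (t * x * z⁻¹)⁻¹) *
    dPoch p q (p * q * (t * x⁻¹ * z)⁻¹) * dPoch p q (p * q * (t * x⁻¹ * z⁻¹)⁻¹)) /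
    (E (t * x * z) * E (t * x * z⁻¹) * E' (t * x⁻¹ * z) * E (t * x⁻¹ * z⁻¹)) *
    (theta p (z ^ 2) * theta q (z ^ 2)⁻¹)

/-- The poles inside the circle: those of the kernel and the elements of `σ`. -/
def innerPoles (t : ℂ) (L σ : List ℂ) : List (ℂ → ℂ) :=
  σ.map (fun a _ => a) ++ (L.map (fun c x => c * t * x) ++ L.map (fun c x => c * t * x⁻¹))

/-- The reciprocals of the poles outside the circle: those of the kernel and the elements of
`σ`. -/
def outerPoles (t : ℂ) (L L' σ : List ℂ) : List (ℂ → ℂ) :=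
  L'.map (fun c x => c * t * x⁻¹) ++ (L.map (fun c x => c * t * x) ++ σ.map (fun a _ => a))

lemma mem_innerPoles {t : ℂ} {L σ : List ℂ} {a : ℂ → ℂ} (h : a ∈ innerPoles t L σ) :
    (∃ s ∈ σ, a = fun _ => s) ∨ (∃ c ∈ L, a = fun x => c * t * x) ∨
      ∃ c ∈ L, a = fun x => c * t * x⁻¹ := by
  simp only [innerPoles, List.mem_append, List.mem_map] at h
  rcases h with ⟨s, hs, rfl⟩ | ⟨c, hc, rfl⟩ | ⟨c, hc, rfl⟩
  · exact Or.inl ⟨s, hs, rfl⟩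
  · exact Or.inr (Or.inl ⟨c, hc, rfl⟩)
  · exact Or.inr (Or.inr ⟨c, hc, rfl⟩)

lemma mem_outerPoles {t : ℂ} {L L' σ : List ℂ} {a : ℂ → ℂ} (h : a ∈ outerPoles t L L' σ) :
    (∃ s ∈ σ, a = fun _ => s) ∨ (∃ c ∈ L, a = fun x => c * t * x) ∨
      ∃ c ∈ L', a = fun x => c * t * x⁻¹ := by
  simp only [outerPoles, List.mem_append, List.mem_map] at h
  rcases h with ⟨c, hc, rfl⟩ | ⟨c, hc, rfl⟩ | ⟨s, hs, rfl⟩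
  · exact Or.inr (Or.inr ⟨c, hc, rfl⟩)
  · exact Or.inr (Or.inl ⟨c, hc, rfl⟩)
  · exact Or.inl ⟨s, hs, rfl⟩

lemma list_prod_sub_mul {z : ℂ} (hz : z ≠ 0) (v : ℂ) (L : List ℂ) :
    (L.map fun c => 1 - c * (v * z⁻¹)).prod = z⁻¹ ^ L.length * (L.map fun c => z - c * v).prod := by
  induction L with
  | nil => simp
  | cons c L ih =>
    simp only [List.map_cons, List.prod_cons, List.length_cons, ih, pow_succ]
    field_simp

lemma norm_mul_lt_one_of_mem_annulus {t x : ℂ} (ht0 : t ≠ 0) (hx : x ∈ annulus ‖t‖⁻¹) :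
    ‖t * x‖ < 1 ∧ ‖t * x⁻¹‖ < 1 := by
  have h : ∀ x ∈ annulus ‖t‖⁻¹, ‖t * x‖ < 1 := fun x hx => by
    have := mul_lt_mul_of_pos_left hx.2 (norm_pos_iff.2 ht0)
    rwa [mul_inv_cancel₀ (norm_ne_zero_iff.2 ht0), ← norm_mul] at this
  exact ⟨h x hx, h _ (inv_mem_annulus hx)⟩

lemma opM_eq_poleIntegral (hp : ‖p‖ < 1) (hq : ‖q‖ < 1) {t : ℂ} {T : ℝ}
    {L L' : List ℂ} {E E' : ℂ → ℂ} (hL : IsSplit p q T L E) (hL' : IsSplit p q T L' E')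
    {f φ : ℂ → ℂ} {σ σ' : List ℂ}
    (hf : ∀ z, ‖z‖ = 1 → f z / z =
      φ z / ((σ.map fun a => z - a).prod * (σ'.map fun a => 1 - a * z).prod))
    (x : ℂ) :
    opM p q t f x = kappa p q / ellGamma p q (t ^ 2) *
      poleIntegral (fun x z => kernelNum p q t L.length E E' x z * φ z) (innerPoles t L σ)
        (outerPoles t L L' σ') x := by
  rw [opM, poleIntegral, div_eq_mul_inv (kappa p q), mul_assoc]
  congr 1
  rw [← circleIntegral.integral_const_mul]
  refine circleIntegral.integral_congr zero_le_one fun z hz => ?_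
  rw [mem_sphere_zero_iff_norm] at hz
  have hz0 : z ≠ 0 := fun h => by simp [h] at hz
  have hZ : ‖z ^ 2‖ = 1 := by rw [norm_pow, hz, one_pow]
  have hpq : ‖p * q‖ < 1 := by
    rw [norm_mul]
    exact mul_lt_one_of_nonneg_of_lt_one_left (norm_nonneg _) hp hq.le
  have hW := inv_ellGamma_mul_ellGamma_inv hp hq (pow_ne_zero 2 hz0)
    (dPoch_ne_zero_of_norm_lt hp hq (by rwa [norm_mul, hZ, mul_one]))
    (dPoch_ne_zero_of_norm_lt hp hq (by rwa [norm_mul, norm_inv, hZ, inv_one, mul_one]))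
  rw [mul_div_assoc, hf z hz, div_eq_mul_inv (ellGamma4 p q t x z), mul_inv (ellGamma p q (t ^ 2)),
    hW, ellGamma4, ellGamma_eq_div, ellGamma_eq_div, ellGamma_eq_div, ellGamma_eq_div,
    hL.eq (t * x * z), hL.eq (t * x * z⁻¹), hL'.eq (t * x⁻¹ * z), hL.eq (t * x⁻¹ * z⁻¹),
    list_prod_sub_mul hz0, list_prod_sub_mul hz0]
  have e1 : ∀ (K : List ℂ) (w : ℂ), (K.map fun c => 1 - c * (t * w * z)).prod =
      (K.map fun c => 1 - c * t * w * z).prod := fun K w => by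
    congr 1
    exact List.map_congr_left fun c _ => by ring
  have e2 : ∀ (K : List ℂ) (w : ℂ), (K.map fun c => z - c * (t * w)).prod =
      (K.map fun c => z - c * t * w).prod := fun K w => by
    congr 1
    exact List.map_congr_left fun c _ => by ring
  simp only [innerPoles, outerPoles, kernelNum, List.map_append, List.map_map, List.prod_append,
    Function.comp_def, e1, e2]
  simp only [div_eq_mul_inv, mul_inv, inv_inv, inv_pow]
  ring

/-- The kernel fits the setting of the continuation theorems. -/
lemma contourSetting_kernelNum (hp : ‖p‖ < 1) (hq : ‖q‖ < 1) {t : ℂ}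
    (ht0 : t ≠ 0) (ht : ‖t‖ < 1) {B : ℝ} (hB : 1 < B) {d : ℕ} {L L' : List ℂ} {E E' : ℂ → ℂ}
    (hL : IsSplit p q (B * (B + 1)) L E) (hL' : IsSplit p q (B * (B + 1)) L' E') {φ : ℂ → ℂ}
    (hφ : DifferentiableOn ℂ φ (annulus (B + 1))) :
    ContourSetting (annulus B) (annulus (B + 1)) B⁻¹ B
      fun x z => kernelNum p q t d E E' x z * φ z := by
  have hB0 : 0 < B := one_pos.trans hB
  refine ⟨isOpen_annulus _, isOpen_annulus _, inv_pos.2 hB0, inv_lt_one_of_one_lt₀ hB, hB,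
    fun z h1 h2 => ⟨lt_of_lt_of_le ((inv_lt_inv₀ (by linarith) hB0).2 (by linarith)) h1,
      by linarith⟩, ?_⟩
  rintro ⟨x, z⟩ ⟨hx, hz⟩
  have hx0 := ne_zero_of_mem_annulus hx
  have hz0 := ne_zero_of_mem_annulus hz
  have hbound : ∀ x' ∈ annulus B, ∀ z' ∈ annulus (B + 1), ‖t * x' * z'‖ < B * (B + 1) := by
    intro x' hx' z' hz'
    rw [norm_mul, norm_mul]
    have h1 : ‖t‖ * ‖x'‖ < B :=
      (mul_le_of_le_one_left (norm_nonneg _) ht.le).trans_lt hx'.2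
    exact mul_lt_mul'' h1 hz'.2 (by positivity) (norm_nonneg _)
  have hxi := inv_mem_annulus hx
  have hzi := inv_mem_annulus hz
  refine DifferentiableAt.differentiableWithinAt (DifferentiableAt.mul ?_ ?_)
  · have hd := differentiable_dPoch hp hq
    have h1 : DifferentiableAt ℂ (fun w : ℂ × ℂ => w.1⁻¹) (x, z) := by
      fun_prop (disch := assumption)
    have h2 : DifferentiableAt ℂ (fun w : ℂ × ℂ => w.2⁻¹) (x, z) := by
      fun_prop (disch := assumption)
    have v1 : DifferentiableAt ℂ (fun w : ℂ × ℂ => t * w.1 * w.2) (x, z) := by fun_prop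
    have v2 : DifferentiableAt ℂ (fun w : ℂ × ℂ => t * w.1 * w.2⁻¹) (x, z) := by fun_prop
    have v3 : DifferentiableAt ℂ (fun w : ℂ × ℂ => t * w.1⁻¹ * w.2) (x, z) := by fun_prop
    have v4 : DifferentiableAt ℂ (fun w : ℂ × ℂ => t * w.1⁻¹ * w.2⁻¹) (x, z) := by fun_prop
    have n1 : t * x * z ≠ 0 := by simp [ht0, hx0, hz0]
    have n2 : t * x * z⁻¹ ≠ 0 := by simp [ht0, hx0, hz0]
    have n3 : t * x⁻¹ * z ≠ 0 := by simp [ht0, hx0, hz0]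
    have n4 : t * x⁻¹ * z⁻¹ ≠ 0 := by simp [ht0, hx0, hz0]
    have hnum : ∀ v : ℂ × ℂ → ℂ, DifferentiableAt ℂ v (x, z) → v (x, z) ≠ 0 →
        DifferentiableAt ℂ (fun w => dPoch p q (p * q * (v w)⁻¹)) (x, z) := fun v hv hv0 =>
      DifferentiableAt.fun_comp' (x, z) (g := dPoch p q) (hd _) ((hv.fun_inv hv0).const_mul _)
    have hden : ∀ (E : ℂ → ℂ) (v : ℂ × ℂ → ℂ), Differentiable ℂ E → DifferentiableAt ℂ v (x, z) →
        DifferentiableAt ℂ (fun w => E (v w)) (x, z) := fun E v hE hv =>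
      DifferentiableAt.fun_comp' (x, z) (g := E) (hE _) hv
    have hth : ∀ {p : ℂ} (v : ℂ × ℂ → ℂ), ‖p‖ < 1 → DifferentiableAt ℂ v (x, z) → v (x, z) ≠ 0 →
        DifferentiableAt ℂ (fun w => theta p (v w)) (x, z) := fun v hp hv hv0 =>
      DifferentiableAt.fun_comp' (x, z) (differentiableAt_theta hp hv0) hv
    have hsq : DifferentiableAt ℂ (fun w : ℂ × ℂ => w.2 ^ 2) (x, z) := by fun_prop
    have hpow : DifferentiableAt ℂ (fun w : ℂ × ℂ => w.2 ^ (d + d)) (x, z) := by fun_prop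
    simp only [kernelNum, div_eq_mul_inv]
    refine DifferentiableAt.fun_mul (DifferentiableAt.fun_mul (DifferentiableAt.fun_mul hpow
      ((((hnum _ v1 n1).fun_mul (hnum _ v2 n2)).fun_mul (hnum _ v3 n3)).fun_mul (hnum _ v4 n4)))
      (DifferentiableAt.fun_inv ((((hden _ _ hL.differentiable v1).fun_mul
        (hden _ _ hL.differentiable v2)).fun_mul
        (hden _ _ hL'.differentiable v3)).fun_mul (hden _ _ hL.differentiable v4)) ?_))
      ((hth _ hp hsq (pow_ne_zero 2 hz0)).mul (hth _ hq (hsq.fun_inv (pow_ne_zero 2 hz0))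
        (inv_ne_zero (pow_ne_zero 2 hz0))))
    exact mul_ne_zero (mul_ne_zero (mul_ne_zero (hL.ne_zero _ (hbound _ hx _ hz))
      (hL.ne_zero _ (hbound _ hx _ hzi))) (hL'.ne_zero _ (hbound _ hxi _ hz)))
      (hL.ne_zero _ (hbound _ hxi _ hzi))
  · exact DifferentiableAt.fun_comp' (x, z) (g := φ)
      ((hφ z hz).differentiableAt ((isOpen_annulus _).mem_nhds hz)) differentiableAt_snd

end EllipticBailey

end

noncomputable section

namespace EllipticBailey

variable {p q : ℂ}

lemma isPoleList_innerPoles (hp : ‖p‖ < 1) (hq : ‖q‖ < 1) {t : ℂ} (ht : ‖t‖ < 1) {B : ℝ}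
    (hB : 1 < B) {L σ : List ℂ} (hL : ∀ c ∈ L, ∃ i j : ℕ, c = p ^ i * q ^ j)
    (hσ : ∀ a ∈ σ, ‖a‖ < 1) : IsPoleList (annulus B) B (innerPoles t L σ) := by
  have key : ∀ c ∈ L, ∀ x ∈ annulus B, ‖c * t * x‖ < B := by
    intro c hc x hx
    obtain ⟨i, j, rfl⟩ := hL c hc
    rw [norm_mul, norm_mul]
    exact (mul_le_of_le_one_left (norm_nonneg _) (mul_le_one₀ (norm_pow_mul_pow_le_one hp hq i j)
      (norm_nonneg _) ht.le)).trans_lt hx.2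
  intro a ha
  rcases mem_innerPoles ha with ⟨s, hs, rfl⟩ | ⟨c, hc, rfl⟩ | ⟨c, hc, rfl⟩
  · exact ⟨differentiableOn_const _, fun x _ => (hσ s hs).trans hB⟩
  · exact ⟨by fun_prop, fun x hx => key c hc x hx⟩
  · exact ⟨(differentiableOn_const _).mul
      (differentiableOn_inv.mono fun x hx => ne_zero_of_mem_annulus hx),
      fun x hx => key c hc _ (inv_mem_annulus hx)⟩

lemma isPoleList_outerPoles (hp : ‖p‖ < 1) (hq : ‖q‖ < 1) {t : ℂ} (ht : ‖t‖ < 1) {B : ℝ}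
    (hB : 1 < B) {L L' σ : List ℂ} (hL : ∀ c ∈ L, ∃ i j : ℕ, c = p ^ i * q ^ j)
    (hL' : ∀ c ∈ L', ∃ i j : ℕ, c = p ^ i * q ^ j)
    (hσ : ∀ a ∈ σ, ‖a‖ < 1) : IsPoleList (annulus B) B⁻¹⁻¹ (outerPoles t L L' σ) := by
  have key : ∀ c, (c ∈ L ∨ c ∈ L') → ∀ x ∈ annulus B, ‖c * t * x‖ < B := by
    intro c hc x hx
    obtain ⟨i, j, rfl⟩ := hc.elim (hL c) (hL' c)
    rw [norm_mul, norm_mul]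
    exact (mul_le_of_le_one_left (norm_nonneg _) (mul_le_one₀ (norm_pow_mul_pow_le_one hp hq i j)
      (norm_nonneg _) ht.le)).trans_lt hx.2
  intro a ha
  rw [inv_inv]
  rcases mem_outerPoles ha with ⟨s, hs, rfl⟩ | ⟨c, hc, rfl⟩ | ⟨c, hc, rfl⟩
  · exact ⟨differentiableOn_const _, fun x _ => (hσ s hs).trans hB⟩
  · exact ⟨by fun_prop, fun x hx => key c (Or.inl hc) x hx⟩
  · exact ⟨(differentiableOn_const _).mul
      (differentiableOn_inv.mono fun x hx => ne_zero_of_mem_annulus hx),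
      fun x hx => key c (Or.inr hc) _ (inv_mem_annulus hx)⟩

lemma norm_lt_one_of_mem_innerPoles (hp : ‖p‖ < 1) (hq : ‖q‖ < 1) {t x : ℂ} (ht0 : t ≠ 0)
    {L σ : List ℂ} (hL : ∀ c ∈ L, ∃ i j : ℕ, c = p ^ i * q ^ j)
    (hσ : ∀ a ∈ σ, ‖a‖ < 1) (hx : x ∈ annulus ‖t‖⁻¹) {a : ℂ → ℂ} (ha : a ∈ innerPoles t L σ) :
    ‖a x‖ < 1 := by
  obtain ⟨h1, h2⟩ := norm_mul_lt_one_of_mem_annulus ht0 hx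
  have key : ∀ c ∈ L, ∀ v : ℂ, ‖v‖ < 1 → ‖c * v‖ < 1 := by
    intro c hc v hv
    obtain ⟨i, j, rfl⟩ := hL c hc
    rw [norm_mul]
    exact (mul_le_of_le_one_left (norm_nonneg _) (norm_pow_mul_pow_le_one hp hq i j)).trans_lt hv
  rcases mem_innerPoles ha with ⟨s, hs, rfl⟩ | ⟨c, hc, rfl⟩ | ⟨c, hc, rfl⟩
  · exact hσ s hs
  · beta_reduce
    rw [mul_assoc]
    exact key c hc _ h1
  · beta_reduce
    rw [mul_assoc]
    exact key c hc _ h2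

lemma norm_lt_one_of_mem_outerPoles (hp : ‖p‖ < 1) (hq : ‖q‖ < 1) {t x : ℂ} (ht0 : t ≠ 0)
    {L L' σ : List ℂ} (hL : ∀ c ∈ L, ∃ i j : ℕ, c = p ^ i * q ^ j)
    (hL' : ∀ c ∈ L', ∃ i j : ℕ, c = p ^ i * q ^ j)
    (hσ : ∀ a ∈ σ, ‖a‖ < 1) (hx : x ∈ annulus ‖t‖⁻¹) {a : ℂ → ℂ}
    (ha : a ∈ outerPoles t L L' σ) : ‖a x‖ < 1 := by
  obtain ⟨h1, h2⟩ := norm_mul_lt_one_of_mem_annulus ht0 hx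
  have key : ∀ c, (c ∈ L ∨ c ∈ L') → ∀ v : ℂ, ‖v‖ < 1 → ‖c * v‖ < 1 := by
    intro c hc v hv
    obtain ⟨i, j, rfl⟩ := hc.elim (hL c) (hL' c)
    rw [norm_mul]
    exact (mul_le_of_le_one_left (norm_nonneg _) (norm_pow_mul_pow_le_one hp hq i j)).trans_lt hv
  rcases mem_outerPoles ha with ⟨s, hs, rfl⟩ | ⟨c, hc, rfl⟩ | ⟨c, hc, rfl⟩
  · exact hσ s hs
  · beta_reduce
    rw [mul_assoc]
    exact key c (Or.inl hc) _ h1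
  · beta_reduce
    rw [mul_assoc]
    exact key c (Or.inr hc) _ h2

lemma mul_ne_one_of_norm_lt {a b : ℂ} (ha : ‖a‖ < 1) (hb : ‖b‖ < 1) : a * b ≠ 1 := fun h => by
  have := congrArg norm h
  rw [norm_mul, norm_one] at this
  exact (mul_lt_one_of_nonneg_of_lt_one_left (norm_nonneg _) ha hb.le).ne this

/-- Pairs of poles that do not pinch the contour. -/
lemma mul_ne_one_of_mem_poles (hp : ‖p‖ < 1) (hq : ‖q‖ < 1) {t x : ℂ} (ht0 : t ≠ 0)
    (ht : ‖t‖ < 1) (hx0 : x ≠ 0) (hx1 : ‖x‖ < 1) {L L' σ σ' : List ℂ}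
    (hL : ∀ c ∈ L, ∃ i j : ℕ, c = p ^ i * q ^ j)
    (hL' : ∀ c ∈ L', ∃ i j : ℕ, c = p ^ i * q ^ j)
    (hσ : ∀ a ∈ σ, ‖a‖ < 1) (hσ' : ∀ a ∈ σ', ‖a‖ < 1)
    (hxQ : ∀ i j : ℕ, (x / t) ^ 2 ≠ p ^ i * q ^ j)
    (hxσ : ∀ s ∈ σ, ∀ i j : ℕ, x / t ≠ s * (p ^ i * q ^ j))
    (hxσ' : ∀ s ∈ σ', ∀ i j : ℕ, x / t ≠ s * (p ^ i * q ^ j))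
    {a b : ℂ → ℂ} (ha : a ∈ innerPoles t L σ) (hb : b ∈ outerPoles t L L' σ') :
    a x * b x ≠ 1 := by
  have htx : ‖t * x‖ < 1 := by
    rw [norm_mul]
    exact mul_lt_one_of_nonneg_of_lt_one_left (norm_nonneg _) ht hx1.le
  have htt : ‖t * t‖ < 1 := by
    rw [norm_mul]
    exact mul_lt_one_of_nonneg_of_lt_one_left (norm_nonneg _) ht ht.le
  have hc : ∀ {c : ℂ}, (∃ i j : ℕ, c = p ^ i * q ^ j) → ∀ v : ℂ, ‖v‖ < 1 → ‖c * v‖ < 1 := by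
    rintro c ⟨i, j, rfl⟩ v hv
    rw [norm_mul]
    exact (mul_le_of_le_one_left (norm_nonneg _) (norm_pow_mul_pow_le_one hp hq i j)).trans_lt hv
  have hcc : ∀ {c d : ℂ}, (∃ i j : ℕ, c = p ^ i * q ^ j) → (∃ i j : ℕ, d = p ^ i * q ^ j) →
      ∃ i j : ℕ, c * d = p ^ i * q ^ j := by
    rintro c d ⟨i, j, rfl⟩ ⟨i', j', rfl⟩
    exact ⟨i + i', j + j', by ring⟩
  have hmix : ∀ {s c : ℂ}, (∀ i j : ℕ, x / t ≠ s * (p ^ i * q ^ j)) →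
      (∃ i j : ℕ, c = p ^ i * q ^ j) → s * (c * t * x⁻¹) ≠ 1 := by
    rintro s c hs ⟨i, j, rfl⟩ h
    refine hs i j ?_
    field_simp at h ⊢
    exact h.symm
  have hlt : ∀ {v : ℂ}, ‖v‖ < 1 → v ≠ 1 := fun hv h => by simp [h] at hv
  rcases mem_innerPoles ha with ⟨s, hs, rfl⟩ | ⟨c, hcm, rfl⟩ | ⟨c, hcm, rfl⟩ <;>
  rcases mem_outerPoles hb with ⟨s', hs', rfl⟩ | ⟨d, hdm, rfl⟩ | ⟨d, hdm, rfl⟩ <;>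
  beta_reduce
  · exact mul_ne_one_of_norm_lt (hσ s hs) (hσ' s' hs')
  · refine mul_ne_one_of_norm_lt (hσ s hs) ?_
    rw [mul_assoc]
    exact hc (hL d hdm) _ htx
  · exact hmix (hxσ s hs) (hL' d hdm)
  · refine mul_ne_one_of_norm_lt ?_ (hσ' s' hs')
    rw [mul_assoc]
    exact hc (hL c hcm) _ htx
  · refine mul_ne_one_of_norm_lt ?_ ?_ <;> rw [mul_assoc]
    · exact hc (hL c hcm) _ htx
    · exact hc (hL d hdm) _ htx
  · have e : c * t * x * (d * t * x⁻¹) = c * d * (t * t) := by field_simp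
    rw [e]
    exact hlt (hc (hcc (hL c hcm) (hL' d hdm)) _ htt)
  · rw [mul_comm]
    exact hmix (hxσ' s' hs') (hL c hcm)
  · have e : c * t * x⁻¹ * (d * t * x) = c * d * (t * t) := by field_simp
    rw [e]
    exact hlt (hc (hcc (hL c hcm) (hL d hdm)) _ htt)
  · obtain ⟨i, j, hij⟩ := hcc (hL c hcm) (hL' d hdm)
    intro h
    refine hxQ i j ?_
    rw [← hij]
    field_simp at h ⊢
    exact h.symm

/-- Continuation of `opM p q t f` to an annulus, if on the unit circle `f` is the restriction of a
meromorphic function. -/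
lemma exists_continuation_opM (hp : ‖p‖ < 1) (hq : ‖q‖ < 1) {t : ℂ} (ht0 : t ≠ 0) (ht : ‖t‖ < 1)
    {B : ℝ} (hB : 1 < B) {f φ : ℂ → ℂ} {σ σ' : List ℂ} (hσ : ∀ a ∈ σ, ‖a‖ < 1)
    (hσ' : ∀ a ∈ σ', ‖a‖ < 1) (hφ : DifferentiableOn ℂ φ (annulus (B + 1)))
    (hf : ∀ z, ‖z‖ = 1 → f z / z =
      φ z / ((σ.map fun a => z - a).prod * (σ'.map fun a => 1 - a * z).prod)) :
    ∃ F : ℂ → ℂ, MeromorphicOn F (annulus B) ∧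
      Set.EqOn F (opM p q t f) (annulus B ∩ annulus ‖t‖⁻¹) ∧
      ∀ x ∈ annulus B, (x ∈ annulus ‖t‖⁻¹ ∨ ‖x‖ < 1 ∧ (∀ i j : ℕ, (x / t) ^ 2 ≠ p ^ i * q ^ j) ∧
        (∀ s ∈ σ, ∀ i j : ℕ, x / t ≠ s * (p ^ i * q ^ j)) ∧
        ∀ s ∈ σ', ∀ i j : ℕ, x / t ≠ s * (p ^ i * q ^ j)) → AnalyticAt ℂ F x := by
  obtain ⟨L, E, hL⟩ := exists_isSplit_cons hp hq (B * (B + 1)) 0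
  have hS := contourSetting_kernelNum (d := (q ^ 0 :: L).length) hp hq ht0 ht hB hL hL hφ
  have h1 := isPoleList_innerPoles hp hq ht hB hL.mem hσ
  have h2 := isPoleList_outerPoles hp hq ht hB hL.mem hL.mem hσ'
  obtain ⟨J, hJ, hJ'⟩ := hS.exists_continuation h1 h2
  have hR := differentiableOn_pairProd h1.diff h2.diff
  have hop := isOpen_annulus B
  have hmer : ∀ {g : ℂ → ℂ}, DifferentiableOn ℂ g (annulus B) → MeromorphicOn g (annulus B) :=
    fun hg x hx => (hg.analyticAt (hop.mem_nhds hx)).meromorphicAt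
  have hV : ∀ x ∈ annulus ‖t‖⁻¹,
      pairProd (innerPoles t (q ^ 0 :: L) σ) (outerPoles t (q ^ 0 :: L) (q ^ 0 :: L) σ') x ≠ 0 :=
    fun x hx => pairProd_ne_zero fun a ha b hb => mul_ne_one_of_norm_lt
      (norm_lt_one_of_mem_innerPoles hp hq ht0 hL.mem hσ hx ha)
      (norm_lt_one_of_mem_outerPoles hp hq ht0 hL.mem hL.mem hσ' hx hb)
  refine ⟨fun x => kappa p q / ellGamma p q (t ^ 2) * (J x /
    pairProd (innerPoles t (q ^ 0 :: L) σ) (outerPoles t (q ^ 0 :: L) (q ^ 0 :: L) σ') x),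
    (MeromorphicOn.const _).mul ((hmer hJ).div (hmer hR)), ?_, ?_⟩
  · rintro x ⟨hx, hxt⟩
    beta_reduce
    rw [hJ' x hx
      (fun a ha => norm_lt_one_of_mem_innerPoles hp hq ht0 hL.mem hσ hxt ha)
      (fun b hb => norm_lt_one_of_mem_outerPoles hp hq ht0 hL.mem hL.mem hσ' hxt hb),
      mul_div_cancel_left₀ _ (hV x hxt), opM_eq_poleIntegral hp hq hL hL hf]
  · intro x hx hcond
    refine analyticAt_const.mul ((hJ.analyticAt (hop.mem_nhds hx)).div
      (hR.analyticAt (hop.mem_nhds hx)) ?_)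
    rcases hcond with h | ⟨hx1, hxQ, hxσ, hxσ'⟩
    · exact hV x h
    · exact pairProd_ne_zero fun a ha b hb => mul_ne_one_of_mem_poles hp hq ht0 ht
        (ne_zero_of_mem_annulus hx) hx1 hL.mem hL.mem hσ hσ' hxQ hxσ hxσ' ha hb

end EllipticBailey

end

noncomputable section

namespace EllipticBailey

variable {p q : ℂ}

lemma dPoch_eq_prod_mul (hp : ‖p‖ < 1) (hq : ‖q‖ < 1) (v : ℂ) (k : ℕ) :
    dPoch p q v = (∏ j ∈ Finset.range k, qPoch (v * q ^ j) p) * dPoch p q (v * q ^ k) := by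
  induction k with
  | zero => simp
  | succ k ih =>
    rw [ih, Finset.prod_range_succ, dPoch_eq_mul_right hp hq (v * q ^ k), pow_succ, mul_assoc,
      mul_assoc]

/-- The product `(v;p,q)_∞` without its factor `1 - v q^k`. -/
lemma IsSplit.tail_eq (hp : ‖p‖ < 1) (hq0 : q ≠ 0) (hq : ‖q‖ < 1) {T : ℝ} {k : ℕ} {L : List ℂ}
    {E : ℂ → ℂ} (h : IsSplit p q T (q ^ k :: L) E) (v : ℂ) :
    (L.map fun c => 1 - c * v).prod * E v = (∏ j ∈ Finset.range k, qPoch (v * q ^ j) p) *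
      (qPoch (v * q ^ k * p) p * dPoch p q (v * q ^ k * q)) := by
  have hlist : Continuous fun v : ℂ => (L.map fun c => 1 - c * v).prod := by
    have := differentiableOn_list_prod (s := Set.univ) L (fun c v : ℂ => 1 - c * v)
      fun a _ => by fun_prop
    exact continuousOn_univ.1 this.continuousOn
  have hq' : Continuous fun z => qPoch z p := (differentiable_qPoch hp).continuous
  have hd := (differentiable_dPoch hp hq).continuous
  have h1 : Continuous fun v => (L.map fun c => 1 - c * v).prod * E v :=
    hlist.mul h.differentiable.continuous
  have h2 : Continuous fun v => (∏ j ∈ Finset.range k, qPoch (v * q ^ j) p) *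
      (qPoch (v * q ^ k * p) p * dPoch p q (v * q ^ k * q)) := by
    refine (continuous_finsetProd _ fun j _ => ?_).mul (Continuous.mul ?_ ?_)
    · exact hq'.comp (f := fun v => v * q ^ j) (by fun_prop)
    · exact hq'.comp (f := fun v => v * q ^ k * p) (by fun_prop)
    · exact hd.comp (f := fun v => v * q ^ k * q) (by fun_prop)
  have hk : q ^ k ≠ 0 := pow_ne_zero k hq0
  refine congrFun (h1.ext_on (dense_compl_singleton ((q ^ k)⁻¹ : ℂ)) h2 fun v hv => ?_) v
  have hv' : 1 - q ^ k * v ≠ 0 := by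
    intro h0
    apply hv
    rw [Set.mem_singleton_iff]
    field_simp
    linear_combination -h0
  have e1 := h.eq v
  rw [dPoch_eq_prod_mul hp hq v k, dPoch_eq_mul_right hp hq (v * q ^ k),
    qPoch_eq_mul hp (v * q ^ k), List.map_cons, List.prod_cons] at e1
  refine mul_left_cancel₀ hv' ?_
  beta_reduce
  linear_combination -e1

lemma prod_qPoch_mul_prod_qPoch (hq0 : q ≠ 0) (k : ℕ) :
    (∏ j ∈ Finset.range k, qPoch ((q ^ k)⁻¹ * q ^ j) p) *
      (∏ j ∈ Finset.range k, qPoch (p * q * q ^ j) p) =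
      ∏ j ∈ Finset.range k, theta p (q ^ (j + 1))⁻¹ := by
  rw [← Finset.prod_range_reflect, ← Finset.prod_mul_distrib]
  refine Finset.prod_congr rfl fun j hj => ?_
  rw [Finset.mem_range] at hj
  rw [theta, inv_inv]
  congr 2
  · have : q ^ k = q ^ (j + 1) * q ^ (k - 1 - j) := by
      rw [← pow_add]
      congr 1
      omega
    rw [this, mul_inv, mul_assoc, inv_mul_cancel₀ (pow_ne_zero _ hq0), mul_one]
  · ring

lemma tail_value (hp : ‖p‖ < 1) (hq0 : q ≠ 0) (hq : ‖q‖ < 1) {T : ℝ} {k : ℕ} {L : List ℂ}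
    {E : ℂ → ℂ} (h : IsSplit p q T (q ^ k :: L) E) :
    dPoch p q (p * q * q ^ k) *
      ((L.map fun c => 1 - c * (q ^ k)⁻¹).prod * E (q ^ k)⁻¹) =
      qPoch p p * qPoch q q * dPoch p q (p * q * q ^ k) ^ 2 *
        ∏ j ∈ Finset.range k, theta p (q ^ (j + 1))⁻¹ := by
  rw [h.tail_eq hp hq0 hq, ← prod_qPoch_mul_prod_qPoch hq0,
    inv_mul_cancel₀ (pow_ne_zero k hq0), one_mul, one_mul, dPoch_eq_mul_left hp hq q, mul_comm q p,
    dPoch_eq_prod_mul hp hq (p * q) k]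
  ring

lemma norm_pow_mul_lt_one (hp : ‖p‖ < 1) (hq : ‖q‖ < 1) (k : ℕ) : ‖p * q * q ^ k‖ < 1 := by
  rw [norm_mul, norm_mul, norm_pow]
  exact mul_lt_one_of_nonneg_of_lt_one_left (by positivity)
    (mul_lt_one_of_nonneg_of_lt_one_left (norm_nonneg _) hp hq.le)
    (pow_le_one₀ (norm_nonneg _) hq.le)

/-- The polar part, at `x = t a q^k`, of the continuation of the transform of `2 / (1 - a / z)`. -/
lemma exists_continuation_opM_pinch (hp : ‖p‖ < 1) (hq0 : q ≠ 0) (hq : ‖q‖ < 1)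
    {t a : ℂ} (ht0 : t ≠ 0) (ht : ‖t‖ < 1) (ha0 : a ≠ 0) (ha : ‖a‖ < 1) (k : ℕ)
    (hnome : ∀ j < k, theta p (q ^ (j + 1))⁻¹ ≠ 0)
    (hQ : ∀ i j : ℕ, (a * q ^ k) ^ 2 ≠ p ^ i * q ^ j) {x₀ : ℂ} (hx₀ : x₀ = t * a * q ^ k) :
    ∃ B : ℝ, 1 < B ∧ x₀ ∈ annulus B ∧ ∃ F : ℂ → ℂ, MeromorphicOn F (annulus B) ∧
      Set.EqOn F (opM p q t fun z => 2 / (1 - a / z)) (annulus B ∩ annulus ‖t‖⁻¹) ∧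
      Tendsto (fun x => (1 - x₀ / x) * F x) (𝓝[≠] x₀) (𝓝 ((ellGamma p q (t ^ 2))⁻¹ *
        (ellGamma p q (t * x₀ * a) * ellGamma p q (t * x₀ * a⁻¹) *
          ellGamma p q (t * x₀⁻¹ * a⁻¹)) *
        (∏ j ∈ Finset.range k, theta p (q ^ (j + 1))⁻¹)⁻¹ *
        (theta p (a ^ 2) * theta q (a ^ 2)⁻¹))) := by
  have hqk : q ^ k ≠ 0 := pow_ne_zero k hq0
  have hx0 : x₀ ≠ 0 := by
    rw [hx₀]
    exact mul_ne_zero (mul_ne_zero ht0 ha0) hqk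
  have hqk1 : ‖q ^ k‖ ≤ 1 := by
    rw [norm_pow]
    exact pow_le_one₀ (norm_nonneg _) hq.le
  have hx1 : ‖x₀‖ < 1 := by
    rw [hx₀, norm_mul, norm_mul]
    exact mul_lt_one_of_nonneg_of_lt_one_left (by positivity)
      (mul_lt_one_of_nonneg_of_lt_one_left (norm_nonneg _) ht ha.le) hqk1
  have hB := one_lt_of_ne_zero hx0
  have hxB := mem_annulus_self hx0
  set B : ℝ := ‖x₀‖ + ‖x₀‖⁻¹ + 1
  refine ⟨B, hB, hxB, ?_⟩
  obtain ⟨L, E, hL⟩ : ∃ L E, IsSplit p q (B * (B + 1)) L E := by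
    obtain ⟨L, E, h⟩ := exists_isSplit_cons hp hq (B * (B + 1)) 0
    exact ⟨_, E, h⟩
  obtain ⟨L', E', hL'⟩ := exists_isSplit_cons hp hq (B * (B + 1)) k
  have hmem' : ∀ c ∈ L', ∃ i j : ℕ, c = p ^ i * q ^ j := fun c hc =>
    hL'.mem c (List.mem_cons_of_mem _ hc)
  have hS := contourSetting_kernelNum (φ := fun _ => 2) (d := L.length) hp hq ht0 ht hB hL hL'
    (differentiableOn_const 2)
  have hσ : ∀ s ∈ [a], ‖s‖ < 1 := by simpa using ha
  have hσ' : ∀ s ∈ ([] : List ℂ), ‖s‖ < 1 := by simp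
  have h1 := isPoleList_innerPoles hp hq ht hB hL.mem hσ
  have h2 := isPoleList_outerPoles hp hq ht hB hL.mem hL'.mem hσ'
  have ei : innerPoles t L [a] = (fun _ => a) :: innerPoles t L [] := rfl
  have eo : outerPoles t L (q ^ k :: L') [] =
    (fun x => q ^ k * t * x⁻¹) :: outerPoles t L L' [] := rfl
  rw [ei] at h1
  rw [eo] at h2
  obtain ⟨J, hJ, hJ', hJ''⟩ := hS.exists_continuation_pinch h1 h2
  have hop := isOpen_annulus B
  have hmer : ∀ {g : ℂ → ℂ}, DifferentiableOn ℂ g (annulus B) → MeromorphicOn g (annulus B) :=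
    fun hg x hx => (hg.analyticAt (hop.mem_nhds hx)).meromorphicAt
  have hR := differentiableOn_pairProd h1.diff h2.diff
  set Q : ℂ → ℂ := fun x => ((outerPoles t L L' []).map fun b => 1 - a * b x).prod *
    ((innerPoles t L []).map fun a' => 1 - a' x * (q ^ k * t * x⁻¹)).prod *
    pairProd (innerPoles t L []) (outerPoles t L L' []) x with hQdef
  have hRQ : ∀ x, pairProd ((fun _ => a) :: innerPoles t L [])
      ((fun x => q ^ k * t * x⁻¹) :: outerPoles t L L' []) x = (1 - x₀ / x) * Q x := by
    intro x
    simp only [pairProd_cons_left, pairProd_cons_right, List.map_cons, List.prod_cons, hQdef, hx₀]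
    ring
  have hQd : DifferentiableOn ℂ Q (annulus B) := by
    refine (DifferentiableOn.mul ?_ ?_).mul (differentiableOn_pairProd h1.tail.diff h2.tail.diff)
    · exact differentiableOn_list_prod _ _ fun b hb => (differentiableOn_const 1).sub
        ((differentiableOn_const a).mul (h2.tail.diff b hb))
    · exact differentiableOn_list_prod _ _ fun a' ha' => (differentiableOn_const 1).sub
        ((h1.tail.diff a' ha').mul h2.head.1)
  have hax : a * (q ^ k * t * x₀⁻¹) = 1 := by
    rw [hx₀]
    field_simp
  have hb : q ^ k * t * x₀⁻¹ = a⁻¹ := eq_inv_of_mul_eq_one_right hax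
  have hv3 : t * x₀⁻¹ * a = (q ^ k)⁻¹ := by
    rw [hx₀]
    field_simp
  -- the linear factors at the point of collision
  have eouter : ((outerPoles t L L' []).map fun b => 1 - a * b x₀).prod =
      (L'.map fun c => 1 - c * (t * x₀⁻¹ * a)).prod * (L.map fun c => 1 - c * (t * x₀ * a)).prod := by
    simp only [outerPoles, List.map_append, List.map_map, List.prod_append, Function.comp_def,
      List.map_nil, List.prod_nil, mul_one]
    congr 2 <;> exact List.map_congr_left fun c _ => by ring
  have einner : ((innerPoles t L []).map fun a' => 1 - a' x₀ * (q ^ k * t * x₀⁻¹)).prod =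
      (L.map fun c => 1 - c * (t * x₀ * a⁻¹)).prod *
        (L.map fun c => 1 - c * (t * x₀⁻¹ * a⁻¹)).prod := by
    simp only [innerPoles, List.map_append, List.map_map, List.prod_append, Function.comp_def,
      List.map_nil, List.prod_nil, one_mul, hb]
    congr 2 <;> exact List.map_congr_left fun c _ => by ring
  have d1 : dPoch p q (t * x₀ * a) ≠ 0 := by
    refine dPoch_ne_zero_of_norm_lt hp hq ?_
    rw [norm_mul, norm_mul]
    exact mul_lt_one_of_nonneg_of_lt_one_left (by positivity)
      (mul_lt_one_of_nonneg_of_lt_one_left (norm_nonneg _) ht hx1.le) ha.le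
  have d2 : dPoch p q (t * x₀ * a⁻¹) ≠ 0 := by
    have e : t * x₀ * a⁻¹ = t * t * q ^ k := by
      rw [hx₀]
      field_simp
    refine dPoch_ne_zero_of_norm_lt hp hq ?_
    rw [e, norm_mul, norm_mul]
    exact mul_lt_one_of_nonneg_of_lt_one_left (by positivity)
      (mul_lt_one_of_nonneg_of_lt_one_left (norm_nonneg _) ht ht.le) hqk1
  have d4 : dPoch p q (t * x₀⁻¹ * a⁻¹) ≠ 0 := by
    intro h0
    obtain ⟨i, j, hij⟩ := (dPoch_eq_zero_iff hp hq _).1 h0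
    refine hQ i (j + k) ?_
    rw [hx₀] at hij
    field_simp at hij
    rw [pow_add]
    linear_combination -q ^ k * hij
  have hpk : dPoch p q (p * q * q ^ k) ≠ 0 :=
    dPoch_ne_zero_of_norm_lt hp hq (norm_pow_mul_lt_one hp hq k)
  have htheta : (∏ j ∈ Finset.range k, theta p (q ^ (j + 1))⁻¹) ≠ 0 :=
    Finset.prod_ne_zero_iff.2 fun j hj => hnome j (Finset.mem_range.1 hj)
  have hpp : qPoch p p ≠ 0 := qPoch_ne_zero_of_norm_lt hp hp
  have hqq : qPoch q q ≠ 0 := qPoch_ne_zero_of_norm_lt hq hq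
  have hval := tail_value hp hq0 hq hL'
  rw [← hv3] at hval
  have d3 : (L'.map fun c => 1 - c * (t * x₀⁻¹ * a)).prod * E' (t * x₀⁻¹ * a) ≠ 0 := by
    refine right_ne_zero_of_mul (a := dPoch p q (p * q * q ^ k)) ?_
    rw [hval]
    exact mul_ne_zero (mul_ne_zero (mul_ne_zero hpp hqq) (pow_ne_zero 2 hpk)) htheta
  have hpair : pairProd (innerPoles t L []) (outerPoles t L L' []) x₀ ≠ 0 := by
    refine pairProd_ne_zero fun a' ha' b' hb' => mul_ne_one_of_mem_poles hp hq ht0 ht hx0 hx1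
      hL.mem hmem' hσ' hσ' ?_ (by simp) (by simp) ha' hb'
    intro i j hij
    refine hQ i j ?_
    rw [← hij, hx₀]
    field_simp
  have m1 := d1
  have m2 := d2
  have m4 := d4
  rw [hL.eq] at m1 m2 m4
  have hQ0 : Q x₀ ≠ 0 := by
    simp only [hQdef]
    rw [eouter, einner]
    exact mul_ne_zero (mul_ne_zero (mul_ne_zero (left_ne_zero_of_mul d3) (left_ne_zero_of_mul m1))
      (mul_ne_zero (left_ne_zero_of_mul m2) (left_ne_zero_of_mul m4))) hpair
  have hlt1 : ∀ x ∈ annulus ‖t‖⁻¹, ∀ a' ∈ (fun _ => a) :: innerPoles t L [], ‖a' x‖ < 1 :=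
    fun x hx a' ha' => norm_lt_one_of_mem_innerPoles hp hq ht0 hL.mem hσ hx ha'
  have hlt2 : ∀ x ∈ annulus ‖t‖⁻¹, ∀ b' ∈ (fun x => q ^ k * t * x⁻¹) :: outerPoles t L L' [],
      ‖b' x‖ < 1 :=
    fun x hx b' hb' => norm_lt_one_of_mem_outerPoles hp hq ht0 hL.mem hL'.mem hσ' hx hb'
  refine ⟨fun x => kappa p q / ellGamma p q (t ^ 2) * (J x /
    pairProd ((fun _ => a) :: innerPoles t L [])
      ((fun x => q ^ k * t * x⁻¹) :: outerPoles t L L' []) x),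
    (MeromorphicOn.const _).mul ((hmer hJ).div (hmer hR)), ?_, ?_⟩
  · rintro x ⟨hx, hxt⟩
    beta_reduce
    rw [hJ' x hx (hlt1 x hxt) (hlt2 x hxt), mul_div_cancel_left₀ _
      (pairProd_ne_zero fun a' ha' b' hb' => mul_ne_one_of_norm_lt (hlt1 x hxt a' ha')
        (hlt2 x hxt b' hb')), opM_eq_poleIntegral (φ := fun _ => 2) (σ := [a]) (σ' := [])
        hp hq hL hL' fun z hz => ?_]
    · rfl
    · have hz0 : z ≠ 0 := fun h => by simp [h] at hz
      have hza : z - a ≠ 0 := fun h => by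
        rw [← sub_eq_zero.1 h, hz] at ha
        exact ha.false
      simp only [List.map_cons, List.map_nil, List.prod_cons, List.prod_nil, mul_one]
      field_simp
  · have hcont : Tendsto (fun x => kappa p q / ellGamma p q (t ^ 2) * (J x / Q x)) (𝓝[≠] x₀)
        (𝓝 (kappa p q / ellGamma p q (t ^ 2) * (J x₀ / Q x₀))) := by
      refine Tendsto.mono_left ?_ nhdsWithin_le_nhds
      exact tendsto_const_nhds.mul
        ((hJ.continuousOn.continuousAt (hop.mem_nhds hxB)).div
          (hQd.continuousOn.continuousAt (hop.mem_nhds hxB)) hQ0)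
    have hlen : (innerPoles t L []).length = L.length + L.length := by simp [innerPoles]
    have hlim : kappa p q / ellGamma p q (t ^ 2) * (J x₀ / Q x₀) = (ellGamma p q (t ^ 2))⁻¹ *
        (ellGamma p q (t * x₀ * a) * ellGamma p q (t * x₀ * a⁻¹) *
          ellGamma p q (t * x₀⁻¹ * a⁻¹)) *
        (∏ j ∈ Finset.range k, theta p (q ^ (j + 1))⁻¹)⁻¹ *
        (theta p (a ^ 2) * theta q (a ^ 2)⁻¹) := by
      rw [hJ'' x₀ hxB hax, hlen]
      simp only [hQdef]
      rw [eouter, einner, hb, kernelNum, ellGamma_eq_div p q (t * x₀ * a),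
        ellGamma_eq_div p q (t * x₀ * a⁻¹), ellGamma_eq_div p q (t * x₀⁻¹ * a⁻¹),
        hL.eq (t * x₀ * a), hL.eq (t * x₀ * a⁻¹), hL.eq (t * x₀⁻¹ * a⁻¹), kappa]
      have ek : p * q * (t * x₀⁻¹ * a)⁻¹ = p * q * q ^ k := by rw [hv3, inv_inv]
      rw [ek]
      have hπ : (Real.pi : ℂ) ≠ 0 := Complex.ofReal_ne_zero.2 Real.pi_ne_zero
      have key : qPoch p p * qPoch q q * (dPoch p q (p * q * q ^ k) *
          ((L'.map fun c => 1 - c * (t * x₀⁻¹ * a)).prod * E' (t * x₀⁻¹ * a))⁻¹) =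
          (∏ j ∈ Finset.range k, theta p (q ^ (j + 1))⁻¹)⁻¹ := by
        rw [← div_eq_mul_inv, ← mul_div_assoc, div_eq_iff d3, eq_comm, inv_mul_eq_div,
          div_eq_iff htheta]
        refine mul_left_cancel₀ hpk ?_
        rw [hval]
        ring
      rw [← key]
      have haa : a ^ (L.length + L.length) * a⁻¹ ^ (L.length + L.length) = 1 := by
        rw [← mul_pow, mul_inv_cancel₀ ha0, one_pow]
      have hpi : 2 * (Real.pi : ℂ) * Complex.I * 2 * (4 * Real.pi * Complex.I)⁻¹ = 1 := by
        have : (4 : ℂ) * Real.pi * Complex.I ≠ 0 := by simp [hπ]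
        field_simp
        norm_num
      have hpr := mul_inv_cancel₀ hpair
      rw [div_eq_mul_inv (qPoch p p * qPoch q q)]
      generalize pairProd (innerPoles t L []) (outerPoles t L L' []) x₀ = R at hpr ⊢
      generalize (4 * (Real.pi : ℂ) * Complex.I)⁻¹ = P at hpi ⊢
      generalize a ^ (L.length + L.length) = u at haa ⊢
      generalize a⁻¹ ^ (L.length + L.length) = u' at haa ⊢
      have hone : ∀ X A B C : ℂ, A = 1 → B = 1 → C = 1 → X * (A * B * C) = X := by
        rintro X _ _ _ rfl rfl rfl
        ring
      refine Eq.trans ?_ (hone _ _ _ _ hpi haa hpr)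
      simp only [div_eq_mul_inv, mul_inv]
      ring
    rw [← hlim]
    refine hcont.congr' ?_
    filter_upwards [self_mem_nhdsWithin, nhdsWithin_le_nhds (hop.mem_nhds hxB)] with x hx hxB'
    have hxx : 1 - x₀ / x ≠ 0 := by
      have hx0' := ne_zero_of_mem_annulus hxB'
      rw [Ne, sub_eq_zero, eq_div_iff hx0', one_mul]
      exact hx
    rw [hRQ]
    field_simp

end EllipticBailey

end

noncomputable section

namespace EllipticBailey

variable {p q : ℂ}

lemma theta_ne_zero_of_norm_lt (hp0 : p ≠ 0) (hp : ‖p‖ < 1) {v : ℂ} (hv0 : v ≠ 0) (hv : ‖v‖ < 1)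
    (h : ∀ i : ℕ, v ≠ p ^ i) : theta p v ≠ 0 := by
  intro h0
  obtain ⟨l, hl⟩ := (theta_eq_zero_iff hp0 hp hv0).1 h0
  rcases l with i | i
  · exact h i (by simpa using hl)
  · rw [zpow_negSucc] at hl
    rw [hl, norm_inv, norm_pow] at hv
    have := pow_le_one₀ (n := i + 1) (norm_nonneg p) hp.le
    have hpos : 0 < ‖p‖ ^ (i + 1) := pow_pos (norm_pos_iff.2 hp0) _
    exact hv.not_ge ((one_le_inv₀ hpos).2 this)

lemma prod_theta_inv (hp : ‖p‖ < 1) {v : ℕ → ℂ} (hv : ∀ j, v j ≠ 0) (k : ℕ) :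
    ∏ j ∈ Finset.range k, theta p (v j)⁻¹ =
      (-1) ^ k * (∏ j ∈ Finset.range k, (v j)⁻¹) * ∏ j ∈ Finset.range k, theta p (v j) := by
  induction k with
  | zero => simp
  | succ k ih =>
    rw [Finset.prod_range_succ, ih, Finset.prod_range_succ, Finset.prod_range_succ,
      theta_inv hp (hv k)]
    ring

lemma thetaPoch_inv_eq (hq0 : q ≠ 0) (τ : ℂ) (e k : ℕ) :
    thetaPoch p q (τ * q ^ (e + k))⁻¹ k =
      ∏ j ∈ Finset.range k, theta p (τ * q ^ (e + 1 + j))⁻¹ := by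
  rw [thetaPoch, ← Finset.prod_range_reflect]
  refine Finset.prod_congr rfl fun j hj => ?_
  rw [Finset.mem_range] at hj
  have : q ^ (e + k) = q ^ (e + 1 + j) * q ^ (k - 1 - j) := by
    rw [← pow_add]
    congr 1
    omega
  rw [this, ← mul_assoc, mul_inv, mul_assoc, inv_mul_cancel₀ (pow_ne_zero _ hq0), mul_one]

lemma pow_mul_prod_inv (hq0 : q ≠ 0) {τ : ℂ} (hτ : τ ≠ 0) (m k : ℕ) :
    q ^ ((m + k) * (m + k + 1)) * τ ^ k * ((∏ j ∈ Finset.range k, (q ^ (j + 1))⁻¹) *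
      ∏ j ∈ Finset.range k, (τ * q ^ (2 * m + 1 + j))⁻¹) = q ^ (m * (m + 1)) := by
  induction k with
  | zero => simp
  | succ k ih =>
    rw [← ih, Finset.prod_range_succ, Finset.prod_range_succ]
    have e : q ^ ((m + (k + 1)) * (m + (k + 1) + 1)) =
        q ^ ((m + k) * (m + k + 1)) * (q ^ (k + 1) * q ^ (2 * m + 1 + k)) := by
      rw [← pow_add, ← pow_add]
      congr 1
      ring
    rw [e, pow_succ τ, mul_inv τ]
    have h1 : q ^ (k + 1) ≠ 0 := pow_ne_zero _ hq0
    have h2 : q ^ (2 * m + 1 + k) ≠ 0 := pow_ne_zero _ hq0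
    have e1 := mul_inv_cancel₀ h1
    have e2 := mul_inv_cancel₀ h2
    have e3 := mul_inv_cancel₀ hτ
    generalize q ^ (k + 1) = A at *
    generalize q ^ (2 * m + 1 + k) = C at *
    have hone : ∀ X A B C : ℂ, A = 1 → B = 1 → C = 1 → X * (A * B * C) = X := by
      rintro X _ _ _ rfl rfl rfl
      ring
    refine Eq.trans ?_ (hone _ _ _ _ e1 e2 e3)
    ring

lemma thetaPoch_relation (hp : ‖p‖ < 1) (hq0 : q ≠ 0) {τ : ℂ} (hτ : τ ≠ 0) (m k : ℕ) :
    (∏ j ∈ Finset.range k, theta p (q ^ (j + 1))⁻¹) *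
      thetaPoch p q (τ * q ^ (2 * m + k))⁻¹ k * thetaPoch p q τ (2 * m) *
      (q ^ ((m + k) * (m + k + 1)) * τ ^ k * theta p (τ * q ^ (2 * m))) =
    q ^ (m * (m + 1)) * theta p τ * thetaPoch p q (q * τ) (2 * m + k) * thetaPoch p q q k := by
  have e1 : theta p τ * thetaPoch p q (q * τ) (2 * m + k) = thetaPoch p q τ (2 * m) *
      (theta p (τ * q ^ (2 * m)) * ∏ j ∈ Finset.range k, theta p (τ * q ^ (2 * m + 1 + j))) := by
    rw [mul_comm q τ, ← thetaPoch_succ_left, add_assoc, thetaPoch_add, thetaPoch_succ_left]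
    congr 2
    refine Finset.prod_congr rfl fun j _ => ?_
    congr 1
    ring
  have e2 : thetaPoch p q q k = ∏ j ∈ Finset.range k, theta p (q ^ (j + 1)) :=
    Finset.prod_congr rfl fun j _ => by rw [pow_succ']
  rw [mul_assoc (q ^ (m * (m + 1))), e1, e2, thetaPoch_inv_eq hq0,
    prod_theta_inv hp (v := fun j => q ^ (j + 1)) (fun j => pow_ne_zero _ hq0),
    prod_theta_inv hp (v := fun j => τ * q ^ (2 * m + 1 + j))
      (fun j => mul_ne_zero hτ (pow_ne_zero _ hq0)), ← pow_mul_prod_inv hq0 hτ m k]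
  have hsign : ((-1 : ℂ) ^ k) * (-1) ^ k = 1 := by rw [← mul_pow]; simp
  linear_combination (∏ j ∈ Finset.range k, (q ^ (j + 1))⁻¹) *
    (∏ j ∈ Finset.range k, theta p (q ^ (j + 1))) *
    (∏ j ∈ Finset.range k, (τ * q ^ (2 * m + 1 + j))⁻¹) *
    (∏ j ∈ Finset.range k, theta p (τ * q ^ (2 * m + 1 + j))) * thetaPoch p q τ (2 * m) *
      (q ^ ((m + k) * (m + k + 1)) * τ ^ k * theta p (τ * q ^ (2 * m))) * hsign

lemma norm_pow_mul_lt_one_of {u : ℂ} (hq : ‖q‖ < 1) (hu : ‖u‖ < 1) (j : ℕ) : ‖u * q ^ j‖ < 1 := by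
  rw [norm_mul, norm_pow]
  exact mul_lt_one_of_nonneg_of_lt_one_left (norm_nonneg _) hu (pow_le_one₀ (norm_nonneg _) hq.le)

/-- The polar part of the transform in terms of the matrix `M`. -/
lemma polar_part_eq_entryM (hp0 : p ≠ 0) (hp : ‖p‖ < 1) (hq0 : q ≠ 0) (hq : ‖q‖ < 1) {t u : ℂ}
    (ht0 : t ≠ 0) (ht : ‖t‖ < 1) (hu0 : u ≠ 0) (hu : ‖u‖ < 1)
    (hΓ : ellGamma p q (t ^ 2) ≠ 0) (m k : ℕ)
    (hnome : ∀ j < k, theta p (q ^ (j + 1))⁻¹ ≠ 0)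
    (hQ : ∀ i j : ℕ, (u * q ^ (m + k)) ^ 2 ≠ p ^ i * q ^ j) {a x₀ : ℂ} (ha : a = u * q ^ m)
    (hx₀ : x₀ = t * u * q ^ (m + k)) :
    (ellGamma p q (t ^ 2))⁻¹ *
        (ellGamma p q (t * x₀ * a) * ellGamma p q (t * x₀ * a⁻¹) *
          ellGamma p q (t * x₀⁻¹ * a⁻¹)) *
        (∏ j ∈ Finset.range k, theta p (q ^ (j + 1))⁻¹)⁻¹ *
        (theta p (a ^ 2) * theta q (a ^ 2)⁻¹) =
      ellGamma p q (t ^ 2 * u ^ 2) / ellGamma p q (u ^ 2) *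
        (q ^ ((m + k) * (m + k + 1)) * entryM p q (u ^ 2) (t ^ 2 * u ^ 2) (m + k) m *
          (q ^ (m * (m + 1)))⁻¹) := by
  have hQ' : ∀ l ≤ 2 * (m + k), ∀ i j : ℕ, u ^ 2 * q ^ l ≠ p ^ i * q ^ j := by
    intro l hl i j h
    refine hQ i (j + (2 * (m + k) - l)) ?_
    rw [mul_pow, ← pow_mul, mul_comm (m + k) 2, pow_add, ← mul_assoc, ← h, mul_assoc, ← pow_add]
    congr 2
    omega
  have hτ0 : u ^ 2 ≠ 0 := pow_ne_zero 2 hu0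
  have hτ1 : ‖u ^ 2‖ < 1 := by
    rw [norm_pow]
    exact pow_lt_one₀ (norm_nonneg _) hu two_ne_zero
  have ht1 : ‖t ^ 2‖ < 1 := by
    rw [norm_pow]
    exact pow_lt_one₀ (norm_nonneg _) ht two_ne_zero
  have hpq1 : ‖p * q‖ < 1 := by simpa using norm_pow_mul_lt_one hp hq 0
  have hprod : ∀ {v w : ℂ}, ‖v‖ < 1 → ‖w‖ < 1 → dPoch p q (v * w) ≠ 0 := fun {v w} hv hw => by
    refine dPoch_ne_zero_of_norm_lt hp hq ?_
    rw [norm_mul]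
    exact mul_lt_one_of_nonneg_of_lt_one_left (norm_nonneg _) hv hw.le
  have hθ : ∀ l ≤ 2 * (m + k), theta p (u ^ 2 * q ^ l) ≠ 0 := fun l hl =>
    theta_ne_zero_of_norm_lt hp0 hp (mul_ne_zero hτ0 (pow_ne_zero _ hq0))
      (norm_pow_mul_lt_one_of hq hτ1 l) fun i => by simpa using hQ' l hl i 0
  have hinv : ∀ l ≤ 2 * (m + k), dPoch p q (u ^ 2 * q ^ l)⁻¹ ≠ 0 := by
    intro l hl h
    obtain ⟨i, j, hij⟩ := (dPoch_eq_zero_iff hp hq _).1 h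
    have hne : u ^ 2 * q ^ l ≠ 0 := mul_ne_zero hτ0 (pow_ne_zero _ hq0)
    refine hQ' l hl i j ?_
    field_simp at hij
    exact hij.symm
  have hinv' : ∀ l ≤ 2 * (m + k), dPoch p q (p * q * (u ^ 2 * q ^ l)⁻¹) ≠ 0 := by
    intro l hl h
    obtain ⟨i, j, hij⟩ := (dPoch_eq_zero_iff hp hq _).1 h
    have hne : u ^ 2 * q ^ l ≠ 0 := mul_ne_zero hτ0 (pow_ne_zero _ hq0)
    refine hQ' l hl (i + 1) (j + 1) ?_
    field_simp at hij
    rw [← hij]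
    ring
  have dτ : dPoch p q (u ^ 2) ≠ 0 := dPoch_ne_zero_of_norm_lt hp hq hτ1
  have g1 : ellGamma p q (t * x₀ * a) =
      thetaPoch p q (t ^ 2 * u ^ 2) (2 * m + k) * ellGamma p q (t ^ 2 * u ^ 2) := by
    rw [← ellGamma_mul_pow hp hq0 hq _ (hprod ht1 hτ1), ha, hx₀]
    congr 1
    ring
  have g2 : ellGamma p q (t * x₀ * a⁻¹) = thetaPoch p q (t ^ 2) k * ellGamma p q (t ^ 2) := by
    rw [← ellGamma_mul_pow hp hq0 hq _ (dPoch_ne_zero_of_norm_lt hp hq ht1), ha, hx₀, pow_add]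
    congr 1
    field_simp
  have g4 : t * x₀⁻¹ * a⁻¹ = (u ^ 2 * q ^ (2 * m + k))⁻¹ := by
    rw [ha, hx₀, two_mul, pow_add, pow_add, pow_add]
    field_simp
  have ea : a ^ 2 = u ^ 2 * q ^ (2 * m) := by
    rw [ha, mul_pow, ← pow_mul, mul_comm m 2]
  have ea' : (u ^ 2 * q ^ (2 * m))⁻¹ = (u ^ 2 * q ^ (2 * m + k))⁻¹ * q ^ k := by
    rw [pow_add]
    field_simp
  have hW := inv_ellGamma_mul_ellGamma_inv hp hq (Z := u ^ 2 * q ^ (2 * m))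
    (mul_ne_zero hτ0 (pow_ne_zero _ hq0)) (hprod hpq1 (norm_pow_mul_lt_one_of hq hτ1 _))
    (hinv' _ (by omega))
  rw [ellGamma_mul_pow hp hq0 hq _ dτ, ea', ellGamma_mul_pow hp hq0 hq _ (hinv _ (by omega)),
    ← ea'] at hW
  have hγ : ellGamma p q (u ^ 2 * q ^ (2 * m + k))⁻¹ ≠ 0 := by
    rw [ellGamma_eq_div, inv_inv]
    exact div_ne_zero (hprod hpq1 (norm_pow_mul_lt_one_of hq hτ1 _)) (hinv _ (by omega))
  have hγτ : ellGamma p q (u ^ 2) ≠ 0 := by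
    rw [ellGamma_eq_div]
    exact div_ne_zero (by simpa using hinv' 0 (by omega)) dτ
  have hrel := thetaPoch_relation hp hq0 hτ0 m k (p := p)
  have n1 : (∏ j ∈ Finset.range k, theta p (q ^ (j + 1))⁻¹) ≠ 0 :=
    Finset.prod_ne_zero_iff.2 fun j hj => hnome j (Finset.mem_range.1 hj)
  have n2 : thetaPoch p q (u ^ 2 * q ^ (2 * m + k))⁻¹ k ≠ 0 := by
    rw [thetaPoch_inv_eq hq0]
    refine Finset.prod_ne_zero_iff.2 fun j hj => ?_
    rw [Finset.mem_range] at hj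
    have hne : u ^ 2 * q ^ (2 * m + 1 + j) ≠ 0 := mul_ne_zero hτ0 (pow_ne_zero _ hq0)
    rw [theta_inv hp hne]
    exact mul_ne_zero (neg_ne_zero.2 (inv_ne_zero hne)) (hθ _ (by omega))
  have n3 : thetaPoch p q (u ^ 2) (2 * m) ≠ 0 := thetaPoch_ne_zero fun j hj => hθ _ (by omega)
  have n4 : theta p (u ^ 2) ≠ 0 := by simpa using hθ 0 (by omega)
  have n5 : thetaPoch p q (q * u ^ 2) (2 * m + k) ≠ 0 := thetaPoch_ne_zero fun j hj => by
    rw [mul_comm q, mul_assoc, ← pow_succ']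
    exact hθ _ (by omega)
  have n6 : thetaPoch p q q k ≠ 0 := thetaPoch_ne_zero fun j hj => by
    have := hnome j hj
    rw [theta_inv hp (pow_ne_zero _ hq0)] at this
    rw [← pow_succ']
    exact right_ne_zero_of_mul this
  have n7 : q ^ (m * (m + 1)) ≠ 0 := pow_ne_zero _ hq0
  rw [g1, g2, g4, ea, ← hW, entryM, if_pos (Nat.le_add_right m k), Nat.add_sub_cancel_left,
    show m + k + m = 2 * m + k by ring, mul_div_assoc, div_eq_mul_inv _ (u ^ 2), mul_assoc (t ^ 2),
    mul_inv_cancel₀ hτ0, mul_one]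
  generalize (∏ j ∈ Finset.range k, theta p (q ^ (j + 1))⁻¹) = P1 at *
  generalize thetaPoch p q (u ^ 2 * q ^ (2 * m + k))⁻¹ k = P2 at *
  generalize thetaPoch p q (u ^ 2) (2 * m) = P3 at *
  generalize thetaPoch p q (q * u ^ 2) (2 * m + k) = P5 at *
  generalize thetaPoch p q q k = P6 at *
  generalize q ^ (m * (m + 1)) = P7 at *
  generalize ellGamma p q (u ^ 2 * q ^ (2 * m + k))⁻¹ = G at *
  generalize ellGamma p q (u ^ 2) = G1 at *
  generalize ellGamma p q (t ^ 2) = G2 at *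
  generalize ellGamma p q (t ^ 2 * u ^ 2) = G3 at *
  generalize q ^ ((m + k) * (m + k + 1)) = P8 at *
  generalize theta p (u ^ 2) = P9 at *
  generalize theta p (u ^ 2 * q ^ (2 * m)) = P10 at *
  generalize thetaPoch p q (t ^ 2 * u ^ 2) (2 * m + k) = X1
  generalize thetaPoch p q (t ^ 2) k = X2
  have key : (P1 * P2 * P3)⁻¹ = P8 * (u ^ 2) ^ k * P10 * (P7 * P9 * P5 * P6)⁻¹ := by
    rw [← hrel]
    have h8 : P8 * (u ^ 2) ^ k * P10 ≠ 0 := by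
      intro h0
      rw [h0, mul_zero] at hrel
      exact mul_ne_zero (mul_ne_zero (mul_ne_zero n7 n4) n5) n6 hrel.symm
    rw [mul_inv (P1 * P2 * P3), mul_comm (P1 * P2 * P3)⁻¹, ← mul_assoc, mul_inv_cancel₀ h8,
      one_mul]
  have e1 := mul_inv_cancel₀ hΓ
  have e2 := mul_inv_cancel₀ hγ
  simp only [mul_inv, div_eq_mul_inv] at key ⊢
  linear_combination X1 * X2 * G3 * G1⁻¹ * key +
    P1⁻¹ * P2⁻¹ * P3⁻¹ * X1 * X2 * G3 * G1⁻¹ * (G * G⁻¹ * e1 + e2)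

end EllipticBailey

end

noncomputable section

namespace EllipticBailey

variable {p q : ℂ}

/-! ### Symmetry and linearity of the transformation -/

lemma circleIntegral_comp_inv (F : ℂ → ℂ) :
    (∮ z in C(0, 1), F z⁻¹ / z) = ∮ z in C(0, 1), F z / z := by
  have key : ∀ F : ℂ → ℂ, (∮ z in C(0, 1), F z / z) =
      ∫ θ in (0 : ℝ)..2 * Real.pi, Complex.I * F (circleMap 0 1 θ) := by
    intro F
    rw [circleIntegral]
    congr 1
    ext θ
    have : circleMap 0 1 θ ≠ 0 := circleMap_ne_center one_ne_zero
    rw [deriv_circleMap, smul_eq_mul]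
    field_simp
  rw [key (fun z => F z⁻¹), key F]
  have h := intervalIntegral.integral_comp_sub_left (a := 0) (b := 2 * Real.pi)
    (fun θ => Complex.I * F (circleMap 0 1 θ)) (2 * Real.pi)
  rw [sub_self, sub_zero] at h
  rw [← h]
  congr 1
  ext θ
  congr 2
  simp only [circleMap, Complex.ofReal_one, one_mul, zero_add]
  rw [← Complex.exp_neg, Complex.ofReal_sub, sub_mul, Complex.exp_sub]
  simp [Complex.exp_neg]

lemma opM_congr {t : ℂ} {f g : ℂ → ℂ} (h : ∀ z, ‖z‖ = 1 → f z = g z) (w : ℂ) :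
    opM p q t f w = opM p q t g w := by
  rw [opM, opM]
  congr 1
  refine circleIntegral.integral_congr zero_le_one fun z hz => ?_
  rw [h z (mem_sphere_zero_iff_norm.1 hz)]

lemma opM_inv (t : ℂ) (f : ℂ → ℂ) (w : ℂ) : opM p q t f w⁻¹ = opM p q t f w := by
  have : ∀ z, ellGamma4 p q t w⁻¹ z = ellGamma4 p q t w z := fun z => by
    simp only [ellGamma4, inv_inv]
    ring
  simp only [opM, this]

lemma opM_comp_inv (t : ℂ) (f : ℂ → ℂ) (w : ℂ) :
    opM p q t (fun z => f z⁻¹) w = opM p q t f w := by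
  simp only [opM]
  rw [← circleIntegral_comp_inv]
  congr 2
  ext z
  simp only [ellGamma4, inv_inv, inv_pow]
  ring

lemma analyticAt_ellGamma (hp : ‖p‖ < 1) (hq : ‖q‖ < 1) {v : ℂ} (hv : v ≠ 0)
    (h : dPoch p q v ≠ 0) : AnalyticAt ℂ (ellGamma p q) v := by
  have e : ellGamma p q = fun v => dPoch p q (p * q * v⁻¹) / dPoch p q v := by
    ext v
    exact ellGamma_eq_div p q v
  rw [e]
  have hd : ∀ w, AnalyticAt ℂ (dPoch p q) w := fun w => (differentiable_dPoch hp hq).analyticAt w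
  exact ((hd _).fun_comp (analyticAt_const.mul (analyticAt_inv hv))).div (hd v) h

lemma continuousOn_kernel (hp : ‖p‖ < 1) (hq : ‖q‖ < 1) {t w : ℂ} (ht0 : t ≠ 0)
    (hw : w ∈ annulus ‖t‖⁻¹) :
    ContinuousOn (fun z => ellGamma4 p q t w z /
      (ellGamma p q (t ^ 2) * (ellGamma p q (z ^ 2) * ellGamma p q ((z ^ 2)⁻¹))))
      (Metric.sphere 0 1) := by
  obtain ⟨h1, h2⟩ := norm_mul_lt_one_of_mem_annulus ht0 hw
  have hw0 := ne_zero_of_mem_annulus hw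
  have hpq : ‖p * q‖ < 1 := by simpa using norm_pow_mul_lt_one hp hq 0
  have hs : ∀ z ∈ Metric.sphere (0 : ℂ) 1, ‖z‖ = 1 ∧ z ≠ 0 := fun z hz => by
    rw [mem_sphere_zero_iff_norm] at hz
    exact ⟨hz, fun h => by simp [h] at hz⟩
  have e : Set.EqOn (fun z => ellGamma4 p q t w z * ((ellGamma p q (t ^ 2))⁻¹ *
      (theta p (z ^ 2) * theta q (z ^ 2)⁻¹))) (fun z => ellGamma4 p q t w z /
      (ellGamma p q (t ^ 2) * (ellGamma p q (z ^ 2) * ellGamma p q ((z ^ 2)⁻¹))))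
      (Metric.sphere 0 1) := by
    intro z hz
    obtain ⟨hz1, hz0⟩ := hs z hz
    have hZ : ‖z ^ 2‖ = 1 := by rw [norm_pow, hz1, one_pow]
    have hW := inv_ellGamma_mul_ellGamma_inv hp hq (pow_ne_zero 2 hz0)
      (dPoch_ne_zero_of_norm_lt hp hq (by rwa [norm_mul, hZ, mul_one]))
      (dPoch_ne_zero_of_norm_lt hp hq (by rwa [norm_mul, norm_inv, hZ, inv_one, mul_one]))
    beta_reduce
    rw [← hW, div_eq_mul_inv, mul_inv (ellGamma p q (t ^ 2))]
  refine ContinuousOn.congr ?_ e.symm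
  intro z hz
  obtain ⟨hz1, hz0⟩ := hs z hz
  refine ContinuousAt.continuousWithinAt ?_
  have hi : ContinuousAt (fun z : ℂ => z⁻¹) z := continuousAt_inv₀ hz0
  have hg : ∀ v : ℂ → ℂ, ContinuousAt v z → v z ≠ 0 → ‖v z‖ < 1 →
      ContinuousAt (fun z => ellGamma p q (v z)) z := fun v hv hv0 hv1 =>
    ContinuousAt.comp' (analyticAt_ellGamma hp hq hv0
      (dPoch_ne_zero_of_norm_lt hp hq hv1)).continuousAt hv
  have hth : ∀ {p : ℂ} (v : ℂ → ℂ), ‖p‖ < 1 → ContinuousAt v z → v z ≠ 0 →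
      ContinuousAt (fun z => theta p (v z)) z := fun v hp hv hv0 =>
    ContinuousAt.comp' (differentiableAt_theta hp hv0).continuousAt hv
  have hsq : ContinuousAt (fun z : ℂ => z ^ 2) z := by fun_prop
  refine ContinuousAt.mul (ContinuousAt.mul (ContinuousAt.mul (ContinuousAt.mul ?_ ?_) ?_) ?_)
    (continuousAt_const.mul (ContinuousAt.mul (hth _ hp hsq (pow_ne_zero 2 hz0))
      (hth _ hq (hsq.inv₀ (pow_ne_zero 2 hz0)) (inv_ne_zero (pow_ne_zero 2 hz0)))))
  · exact hg _ (by fun_prop) (by simp [ht0, hw0, hz0]) (by rwa [norm_mul, hz1, mul_one])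
  · exact hg _ (by fun_prop) (by simp [ht0, hw0, hz0])
      (by rwa [norm_mul, norm_inv, hz1, inv_one, mul_one])
  · exact hg _ (by fun_prop) (by simp [ht0, hw0, hz0]) (by rwa [norm_mul, hz1, mul_one])
  · exact hg _ (by fun_prop) (by simp [ht0, hw0, hz0])
      (by rwa [norm_mul, norm_inv, hz1, inv_one, mul_one])

lemma opM_add (hp : ‖p‖ < 1) (hq : ‖q‖ < 1) {t w : ℂ} (ht0 : t ≠ 0)
    (hw : w ∈ annulus ‖t‖⁻¹) {f g : ℂ → ℂ} (hf : ContinuousOn f (Metric.sphere 0 1))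
    (hg : ContinuousOn g (Metric.sphere 0 1)) :
    opM p q t (fun z => f z + g z) w = opM p q t f w + opM p q t g w := by
  have hs : ∀ z ∈ Metric.sphere (0 : ℂ) 1, z ≠ 0 := fun z hz h => by
    rw [mem_sphere_zero_iff_norm] at hz
    simp [h] at hz
  have hi : ∀ f : ℂ → ℂ, ContinuousOn f (Metric.sphere 0 1) → CircleIntegrable (fun z =>
      ellGamma4 p q t w z / (ellGamma p q (t ^ 2) *
        (ellGamma p q (z ^ 2) * ellGamma p q ((z ^ 2)⁻¹))) * f z / z) 0 1 := fun f hf =>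
    (((continuousOn_kernel hp hq ht0 hw).mul hf).div continuousOn_id hs).circleIntegrable
      zero_le_one
  rw [opM, opM, opM, ← mul_add, ← circleIntegral.integral_add (hi f hf) (hi g hg)]
  congr 1
  refine circleIntegral.integral_congr zero_le_one fun z _ => ?_
  ring

lemma opM_const_mul (t w c : ℂ) (f : ℂ → ℂ) :
    opM p q t (fun z => c * f z) w = c * opM p q t f w := by
  rw [opM, opM, mul_left_comm]
  congr 1
  rw [← circleIntegral.integral_const_mul]
  refine circleIntegral.integral_congr zero_le_one fun z _ => ?_
  ring

lemma opM_sum (hp : ‖p‖ < 1) (hq : ‖q‖ < 1) {t w : ℂ} (ht0 : t ≠ 0)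
    (hw : w ∈ annulus ‖t‖⁻¹) {ι : Type*} (s : Finset ι) {f : ι → ℂ → ℂ}
    (hf : ∀ i ∈ s, ContinuousOn (f i) (Metric.sphere 0 1)) :
    opM p q t (fun z => ∑ i ∈ s, f i z) w = ∑ i ∈ s, opM p q t (f i) w := by
  classical
  induction s using Finset.induction_on with
  | empty => simp [opM, circleIntegral]
  | insert i s hi ih =>
    simp only [Finset.sum_insert hi]
    rw [opM_add hp hq ht0 hw (hf i (by simp)), ih fun j hj => hf j (by simp [hj])]
    exact continuousOn_finsetSum _ fun j hj => hf j (by simp [hj])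

/-- The even function with simple poles at `a` and `a⁻¹`. -/
def polarTerm (a z : ℂ) : ℂ := 1 / (1 - a / z) + 1 / (1 - a * z)

lemma polarTerm_inv (a z : ℂ) : polarTerm a z⁻¹ = polarTerm a z := by
  rw [polarTerm, polarTerm, div_inv_eq_mul, add_comm, div_eq_mul_inv a z]

lemma analyticAt_polarTerm {a z : ℂ} (hz0 : z ≠ 0) (h1 : z ≠ a) (h2 : a * z ≠ 1) :
    AnalyticAt ℂ (polarTerm a) z := by
  have hd1 : (1 : ℂ) - a / z ≠ 0 := by
    rw [Ne, sub_eq_zero, eq_div_iff hz0, one_mul]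
    exact h1
  have hd2 : 1 - a * z ≠ 0 := sub_ne_zero.2 (Ne.symm h2)
  refine AnalyticAt.add (analyticAt_const.div ?_ hd1) (analyticAt_const.div ?_ hd2)
  · exact analyticAt_const.sub (analyticAt_const.div analyticAt_id hz0)
  · exact analyticAt_const.sub (analyticAt_const.mul analyticAt_id)

lemma opM_polarTerm (hp : ‖p‖ < 1) (hq : ‖q‖ < 1) {t w a : ℂ} (ht0 : t ≠ 0)
    (hw : w ∈ annulus ‖t‖⁻¹) (ha : ‖a‖ < 1) :
    opM p q t (polarTerm a) w = opM p q t (fun z => 2 / (1 - a / z)) w := by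
  have hs : ∀ z ∈ Metric.sphere (0 : ℂ) 1, ‖z‖ = 1 ∧ z ≠ 0 := fun z hz => by
    rw [mem_sphere_zero_iff_norm] at hz
    exact ⟨hz, fun h => by simp [h] at hz⟩
  have hne : ∀ v : ℂ, ‖v‖ < 1 → 1 - v ≠ 0 := fun v hv h => by
    rw [← sub_eq_zero.1 h, norm_one] at hv
    exact hv.false
  have c1 : ContinuousOn (fun z : ℂ => 1 / (1 - a / z)) (Metric.sphere 0 1) := by
    refine continuousOn_const.div (continuousOn_const.sub
      (continuousOn_const.div continuousOn_id fun z hz => (hs z hz).2)) fun z hz => hne _ ?_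
    rwa [norm_div, (hs z hz).1, div_one]
  have c2 : ContinuousOn (fun z : ℂ => 1 / (1 - a * z)) (Metric.sphere 0 1) := by
    refine continuousOn_const.div (by fun_prop) fun z hz => hne _ ?_
    rwa [norm_mul, (hs z hz).1, mul_one]
  have e1 : opM p q t (fun z => 1 / (1 - a * z)) w = opM p q t (fun z => 1 / (1 - a / z)) w := by
    rw [← opM_comp_inv]
    simp only [div_eq_mul_inv]
  have e2 : opM p q t (fun z => 2 / (1 - a / z)) w =
      2 * opM p q t (fun z => 1 / (1 - a / z)) w := by
    rw [← opM_const_mul]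
    simp only [mul_one_div]
  have e3 : opM p q t (polarTerm a) w =
      opM p q t (fun z => 1 / (1 - a / z) + 1 / (1 - a * z)) w := rfl
  rw [e3, opM_add hp hq ht0 hw c1 c2, e1, e2, two_mul]

end EllipticBailey

end

noncomputable section

namespace EllipticBailey

/-! ### Factorization of even meromorphic functions -/

lemma exists_list_prod_eq_pow (s : Finset ℂ) (M : ℕ) :
    ∃ L : List ℂ, (∀ a ∈ L, a ∈ s) ∧ ∀ g : ℂ → ℂ, (L.map g).prod = ∏ a ∈ s, g a ^ M := by
  classical
  induction s using Finset.induction_on with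
  | empty => exact ⟨[], by simp, by simp⟩
  | insert a s ha ih =>
    obtain ⟨L, hL, hprod⟩ := ih
    refine ⟨List.replicate M a ++ L, fun b hb => ?_, fun g => ?_⟩
    · rcases List.mem_append.1 hb with h | h
      · rw [List.eq_of_mem_replicate h]
        simp
      · exact Finset.mem_insert_of_mem (hL b h)
    · rw [List.map_append, List.prod_append, hprod, Finset.prod_insert ha, List.map_replicate,
        List.prod_replicate]

lemma finite_poles {f : ℂ → ℂ} {K : Set ℂ} (hK : IsCompact K) (hf : MeromorphicOn f K) :
    {z | z ∈ K ∧ meromorphicOrderAt f z < 0}.Finite := by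
  obtain ⟨s, -, hs⟩ := hK.elim_nhds_subcover (fun z => {y | y ≠ z → AnalyticAt ℂ f y})
    fun z hz => eventually_nhdsWithin_iff.1 (hf z hz).eventually_analyticAt
  refine s.finite_toSet.subset fun z hz => ?_
  obtain ⟨y, hy, hzy⟩ := Set.mem_iUnion₂.1 (hs hz.1)
  by_cases h : z = y
  · rw [h]
    exact hy
  · exact absurd (hzy h).meromorphicOrderAt_nonneg hz.2.not_ge

lemma meromorphicOrderAt_mul_pow_nonneg {f r : ℂ → ℂ} {z : ℂ} {M : ℕ} (hf : MeromorphicAt f z)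
    (hM : ((-(M : ℤ) : ℤ) : WithTop ℤ) ≤ meromorphicOrderAt f z) (hr : AnalyticAt ℂ r z) :
    0 ≤ meromorphicOrderAt (fun w => f w * ((w - z) ^ M * r w)) z := by
  have hpow : MeromorphicAt (fun w => (w - z) ^ M) z :=
    ((analyticAt_id.sub analyticAt_const).pow M).meromorphicAt
  have h1 : meromorphicOrderAt (fun w => f w * ((w - z) ^ M * r w)) z =
      meromorphicOrderAt f z + (meromorphicOrderAt (fun w => (w - z) ^ M) z +
        meromorphicOrderAt r z) := by
    rw [← meromorphicOrderAt_mul hpow hr.meromorphicAt,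
      ← meromorphicOrderAt_mul hf (hpow.mul hr.meromorphicAt)]
    rfl
  have h2 : meromorphicOrderAt (fun w : ℂ => (w - z) ^ M) z = ((M : ℤ) : WithTop ℤ) := by
    exact meromorphicOrderAt_pow_id_sub_const
  rw [h1, h2, ← add_assoc]
  refine add_nonneg ?_ hr.meromorphicOrderAt_nonneg
  calc (0 : WithTop ℤ) = ((-(M : ℤ) : ℤ) : WithTop ℤ) + ((M : ℤ) : WithTop ℤ) := by
        rw [← WithTop.coe_add]
        simp
    _ ≤ _ := by gcongr

lemma exists_neg_le_meromorphicOrderAt (f : ℂ → ℂ) (z : ℂ) :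
    ∃ M : ℕ, ((-(M : ℤ) : ℤ) : WithTop ℤ) ≤ meromorphicOrderAt f z := by
  cases h : meromorphicOrderAt f z with
  | top => exact ⟨0, le_top⟩
  | coe n =>
    refine ⟨n.natAbs, ?_⟩
    rw [WithTop.coe_le_coe]
    omega

lemma meromorphicOrderAt_inv_of_even {f : ℂ → ℂ} {z : ℂ} (hz : z ≠ 0)
    (h : (fun w => f w⁻¹) =ᶠ[𝓝[≠] z] f) :
    meromorphicOrderAt f z⁻¹ = meromorphicOrderAt f z := by
  rw [← meromorphicOrderAt_congr h]
  have := meromorphicOrderAt_comp_of_deriv_ne_zero (f := f) (g := fun w : ℂ => w⁻¹)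
    (analyticAt_inv hz) (by
      rw [deriv_inv]
      exact neg_ne_zero.2 (inv_ne_zero (pow_ne_zero 2 hz)))
  rw [← this]
  rfl

/-- An even meromorphic function without poles on the unit circle, written on the circle as a
quotient of a function holomorphic on an annulus and a product of linear factors. -/
lemma exists_factorization {f : ℂ → ℂ} (hf : MeromorphicOn f {w | w ≠ 0})
    (heven : ∀ z, z ≠ 0 → (fun w => f w⁻¹) =ᶠ[𝓝[≠] z] f)
    (han : ∀ z, ‖z‖ = 1 → AnalyticAt ℂ f z) {B : ℝ} (hB : 1 < B) :
    ∃ σ : List ℂ, (∀ a ∈ σ, a ≠ 0 ∧ ‖a‖ < 1 ∧ meromorphicOrderAt f a < 0) ∧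
      ∃ φ : ℂ → ℂ, DifferentiableOn ℂ φ (annulus B) ∧ ∀ z, ‖z‖ = 1 → f z / z =
        φ z / ((σ.map fun a => z - a).prod * (σ.map fun a => 1 - a * z).prod) := by
  classical
  have hB0 : 0 < B := one_pos.trans hB
  set K : Set ℂ := {z | B⁻¹ ≤ ‖z‖ ∧ ‖z‖ ≤ B} with hKdef
  have hKc : IsCompact K := by
    refine Metric.isCompact_of_isClosed_isBounded ?_ ?_
    · exact (isClosed_le continuous_const continuous_norm).inter
        (isClosed_le continuous_norm continuous_const)
    · refine (Metric.isBounded_closedBall (x := (0 : ℂ)) (r := B)).subset fun z hz => ?_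
      simpa using hz.2
  have hK0 : ∀ z ∈ K, z ≠ 0 := fun z hz h => by
    have := hz.1
    rw [h, norm_zero] at this
    exact (inv_pos.2 hB0).not_ge this
  have hfin := finite_poles hKc (hf.mono_set fun z hz => hK0 z hz)
  set s : Finset ℂ := hfin.toFinset.filter fun z => ‖z‖ < 1 with hs
  have hmem : ∀ z, z ∈ s ↔ (z ∈ K ∧ meromorphicOrderAt f z < 0) ∧ ‖z‖ < 1 := fun z => by
    simp [hs]
  choose M₀ hM₀ using exists_neg_le_meromorphicOrderAt f
  set M : ℕ := s.sup M₀ with hM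
  have hMs : ∀ z ∈ s, ((-(M : ℤ) : ℤ) : WithTop ℤ) ≤ meromorphicOrderAt f z := by
    intro z hz
    refine le_trans ?_ (hM₀ z)
    rw [WithTop.coe_le_coe]
    have : M₀ z ≤ M := Finset.le_sup hz
    omega
  obtain ⟨σ, hσ, hσprod⟩ := exists_list_prod_eq_pow s M
  set P : ℂ → ℂ := fun z => (∏ a ∈ s, (z - a) ^ M) * ∏ a ∈ s, (1 - a * z) ^ M with hP
  have hPan : ∀ z, AnalyticAt ℂ P z := fun z =>
    (Differentiable.analyticAt (by simp only [hP]; fun_prop) z)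
  have hinvan : ∀ z, z ≠ 0 → AnalyticAt ℂ (fun w : ℂ => w⁻¹) z := fun z hz => analyticAt_inv hz
  set g : ℂ → ℂ := fun z => f z * (P z * z⁻¹) with hg
  have hgm : MeromorphicOn g {w | w ≠ 0} := fun z hz =>
    (hf z hz).mul ((hPan z).mul (hinvan z hz)).meromorphicAt
  have hnonneg : ∀ z ∈ K, 0 ≤ meromorphicOrderAt g z := by
    intro z hz
    have hz0 := hK0 z hz
    rcases lt_or_ge (meromorphicOrderAt f z) 0 with hneg | hpos
    · rcases lt_trichotomy ‖z‖ 1 with h1 | h1 | h1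
      · have hzs : z ∈ s := (hmem z).2 ⟨⟨hz, hneg⟩, h1⟩
        have e : g = fun w => f w * ((w - z) ^ M * ((∏ a ∈ s.erase z, (w - a) ^ M) *
            (∏ a ∈ s, (1 - a * w) ^ M) * w⁻¹)) := by
          ext w
          simp only [hg, hP]
          rw [← Finset.mul_prod_erase s (fun a => (w - a) ^ M) hzs]
          ring
        rw [e]
        refine meromorphicOrderAt_mul_pow_nonneg (hf z hz0) (hMs z hzs)
          (AnalyticAt.mul (Differentiable.analyticAt (by fun_prop) z) (hinvan z hz0))
      · exact absurd (han z h1).meromorphicOrderAt_nonneg hneg.not_ge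
      · have ho := meromorphicOrderAt_inv_of_even hz0 (heven z hz0)
        have hzs : z⁻¹ ∈ s := by
          refine (hmem _).2 ⟨⟨⟨?_, ?_⟩, by rwa [ho]⟩, ?_⟩
          · rw [norm_inv]
            exact inv_anti₀ (norm_pos_iff.2 hz0) hz.2
          · rw [norm_inv]
            exact (inv_le_comm₀ (norm_pos_iff.2 hz0) hB0).2 hz.1
          · rw [norm_inv]
            exact inv_lt_one_of_one_lt₀ h1
        have e : g = fun w => f w * ((w - z) ^ M * ((-z⁻¹) ^ M * ((∏ a ∈ s, (w - a) ^ M) *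
            (∏ a ∈ s.erase z⁻¹, (1 - a * w) ^ M)) * w⁻¹)) := by
          ext w
          simp only [hg, hP]
          rw [← Finset.mul_prod_erase s (fun a => (1 - a * w) ^ M) hzs]
          have : (1 - z⁻¹ * w) ^ M = (w - z) ^ M * (-z⁻¹) ^ M := by
            rw [← mul_pow]
            congr 1
            field_simp
            ring
          rw [this]
          ring
        rw [e]
        refine meromorphicOrderAt_mul_pow_nonneg (hf z hz0) (by rw [← ho]; exact hMs _ hzs)
          (AnalyticAt.mul (Differentiable.analyticAt (by fun_prop) z) (hinvan z hz0))
    · have hpa := (hPan z).mul (hinvan z hz0)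
      have : meromorphicOrderAt g z = meromorphicOrderAt f z +
          meromorphicOrderAt (P * fun w => w⁻¹) z := by
        rw [← meromorphicOrderAt_mul (hf z hz0) hpa.meromorphicAt]
        rfl
      rw [this]
      exact add_nonneg hpos hpa.meromorphicOrderAt_nonneg
  have hNF := meromorphicNFOn_toMeromorphicNFOn g {w : ℂ | w ≠ 0}
  refine ⟨σ, fun a ha => ?_, toMeromorphicNFOn g {w | w ≠ 0}, fun z hz => ?_, fun z hz => ?_⟩
  · obtain ⟨⟨h1, h2⟩, h3⟩ := (hmem a).1 (hσ a ha)
    exact ⟨hK0 a h1, h3, h2⟩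
  · have hzK : z ∈ K := ⟨hz.1.le, hz.2.le⟩
    have hz0 : z ∈ {w : ℂ | w ≠ 0} := hK0 z hzK
    have : 0 ≤ meromorphicOrderAt (toMeromorphicNFOn g {w | w ≠ 0}) z := by
      rw [meromorphicOrderAt_toMeromorphicNFOn hgm hz0]
      exact hnonneg z hzK
    exact ((hNF hz0).meromorphicOrderAt_nonneg_iff_analyticAt.1
      this).differentiableAt.differentiableWithinAt
  · have hz0 : z ≠ 0 := fun h => by simp [h] at hz
    have hgan : AnalyticAt ℂ g z := (han z hz).mul ((hPan z).mul (hinvan z hz0))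
    have hgerm : g =ᶠ[𝓝[≠] z] toMeromorphicNFOn g {w | w ≠ 0} :=
      (hgm.toMeromorphicNFOn_eq_self_on_nhdsNE hz0).symm
    have hval : g z = toMeromorphicNFOn g {w | w ≠ 0} z :=
      ((MeromorphicNFAt.eventuallyEq_nhdsNE_iff_eventuallyEq_nhds hgan.meromorphicNFAt
        (hNF hz0)).1 hgerm).eq_of_nhds
    rw [← hval, hσprod (fun a => z - a), hσprod (fun a => 1 - a * z)]
    have hP0 : P z ≠ 0 := by
      refine mul_ne_zero (Finset.prod_ne_zero_iff.2 fun a ha => pow_ne_zero _ fun h => ?_)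
        (Finset.prod_ne_zero_iff.2 fun a ha => pow_ne_zero _ fun h => ?_)
      · have h1 := ((hmem a).1 ha).2
        rw [← sub_eq_zero.1 h, hz] at h1
        exact h1.false
      · have h1 := ((hmem a).1 ha).2
        have h2 := congrArg norm (sub_eq_zero.1 h)
        rw [norm_one, norm_mul, hz, mul_one] at h2
        exact h1.ne' h2
    change f z / z = f z * (P z * z⁻¹) / P z
    field_simp

end EllipticBailey

end

noncomputable section

namespace EllipticBailey

variable {p q : ℂ}

/-! ### Polar parts of the transformation -/

/-- The even meromorphic functions to which the transformation is applied: in the punctured unit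
disc, the poles are in `S`, except for simple poles at `u q^m`, `m ≤ N`, where
`(1 - u q^m / z) f` tends to `ρ m`. -/
structure TransformData (q u : ℂ) (N : ℕ) (S : Set ℂ) (f : ℂ → ℂ) (ρ : ℕ → ℂ) : Prop where
  meromorphic : MeromorphicOn f {w | w ≠ 0}
  even : ∀ z, z ≠ 0 → (fun w => f w⁻¹) =ᶠ[𝓝[≠] z] f
  analytic : ∀ z, ‖z‖ = 1 → AnalyticAt ℂ f z
  order : ∀ z, z ≠ 0 → ‖z‖ < 1 → z ∉ S → (∀ m ≤ N, z ≠ u * q ^ m) → 0 ≤ meromorphicOrderAt f z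
  residue : ∀ m ≤ N,
    Tendsto (fun z => (1 - u * q ^ m / z) * f z) (𝓝[≠] (u * q ^ m)) (𝓝 (ρ m))

/-- The sets of poles that stay away from `u q^m`, `m ≤ N`, after the transformation. -/
structure IsPoleSet (p q u : ℂ) (N : ℕ) (S : Set ℂ) : Prop where
  mul : ∀ z ∈ S, ∀ i j : ℕ, z * (p ^ i * q ^ j) ∈ S
  sq : ∀ (z : ℂ) (i j : ℕ), z ^ 2 = p ^ i * q ^ j → z ∈ S
  shift : ∀ i j : ℕ, 1 ≤ i ∨ N < j → u * (p ^ i * q ^ j) ∈ S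
  notMem : ∀ m ≤ N, u * q ^ m ∉ S

lemma exists_global_continuation {t : ℂ} (ht0 : t ≠ 0) (ht : ‖t‖ < 1) {f : ℂ → ℂ} {P : ℂ → Prop}
    (h : ∀ B : ℝ, 1 < B → ∃ F : ℂ → ℂ, MeromorphicOn F (annulus B) ∧
      Set.EqOn F (opM p q t f) (annulus B ∩ annulus ‖t‖⁻¹) ∧
      ∀ x ∈ annulus B, (x ∈ annulus ‖t‖⁻¹ ∨ P x) → AnalyticAt ℂ F x) :
    ∃ g : ℂ → ℂ, MeromorphicOn g {w | w ≠ 0} ∧ Set.EqOn g (opM p q t f) (annulus ‖t‖⁻¹) ∧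
      (∀ x ∈ annulus ‖t‖⁻¹, AnalyticAt ℂ g x) ∧
      ∀ x, x ≠ 0 → P x → 0 ≤ meromorphicOrderAt g x := by
  have hρ : 1 < ‖t‖⁻¹ := (one_lt_inv₀ (norm_pos_iff.2 ht0)).2 ht
  have hd : DifferentiableOn ℂ (opM p q t f) (annulus ‖t‖⁻¹) := by
    intro x hx
    have hx0 := ne_zero_of_mem_annulus hx
    obtain ⟨F, -, hF, han⟩ := h _ (one_lt_of_ne_zero hx0)
    have hxB := mem_annulus_self hx0
    refine DifferentiableAt.differentiableWithinAt
      ((han x hxB (Or.inl hx)).differentiableAt.congr_of_eventuallyEq ?_)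
    filter_upwards [(isOpen_annulus _).mem_nhds hxB, (isOpen_annulus _).mem_nhds hx] with y h1 h2
    exact (hF ⟨h1, h2⟩).symm
  obtain ⟨g, hg, hgf⟩ := exists_continuation_of_annuli hρ hd fun B hB => by
    obtain ⟨F, h1, h2, -⟩ := h B hB
    exact ⟨F, h1, h2⟩
  refine ⟨g, hg, hgf, fun x hx => ?_, fun x hx0 hx => ?_⟩
  · refine (hd.analyticAt ((isOpen_annulus _).mem_nhds hx)).congr ?_
    filter_upwards [(isOpen_annulus _).mem_nhds hx] with y hy
    exact (hgf hy).symm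
  · obtain ⟨F, h1, h2, han⟩ := h _ (one_lt_of_ne_zero hx0)
    have hxB := mem_annulus_self hx0
    rw [meromorphicOrderAt_congr (eventuallyEq_of_eqOn_annulus (one_lt_of_ne_zero hx0) hρ
      (hg.mono_set fun y hy => ne_zero_of_mem_annulus hy) h1
      (hgf.mono Set.inter_subset_right) h2 hxB)]
    exact (han x hxB (Or.inr hx)).meromorphicOrderAt_nonneg

lemma tendsto_one_sub_div {x₀ : ℂ} (hx₀ : x₀ ≠ 0) :
    Tendsto (fun x => 1 - x₀ / x) (𝓝[≠] x₀) (𝓝 0) := by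
  have : ContinuousAt (fun x => 1 - x₀ / x) x₀ :=
    continuousAt_const.sub (continuousAt_const.div continuousAt_id hx₀)
  have h := this.tendsto
  rw [div_self hx₀, sub_self] at h
  exact h.mono_left nhdsWithin_le_nhds

lemma tendsto_one_sub_div_mul {g : ℂ → ℂ} {x₀ : ℂ} (hx₀ : x₀ ≠ 0) (hg : MeromorphicAt g x₀)
    (h : 0 ≤ meromorphicOrderAt g x₀) :
    Tendsto (fun x => (1 - x₀ / x) * g x) (𝓝[≠] x₀) (𝓝 0) := by
  obtain ⟨c, hc⟩ := (tendsto_nhds_iff_meromorphicOrderAt_nonneg hg).2 h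
  simpa using (tendsto_one_sub_div hx₀).mul hc

lemma meromorphicOrderAt_nonneg_of_tendsto {f : ℂ → ℂ} {a : ℂ} (ha : a ≠ 0)
    (hf : MeromorphicAt f a) (h : Tendsto (fun z => (1 - a / z) * f z) (𝓝[≠] a) (𝓝 0)) :
    0 ≤ meromorphicOrderAt f a := by
  have h' : Tendsto (fun z => (z - a) * f z) (𝓝[≠] a) (𝓝 0) := by
    have hid : Tendsto (fun z : ℂ => z) (𝓝[≠] a) (𝓝 a) := tendsto_id.mono_left nhdsWithin_le_nhds
    have h2 := hid.mul h
    rw [mul_zero] at h2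
    refine h2.congr' ?_
    filter_upwards [nhdsWithin_le_nhds (isOpen_ne.mem_nhds ha)] with z hz
    have hz' : z ≠ 0 := hz
    field_simp
  have hm : MeromorphicAt (fun z : ℂ => z - a) a :=
    (analyticAt_id.sub analyticAt_const).meromorphicAt
  have h1 : 0 < meromorphicOrderAt ((fun z : ℂ => z - a) * f) a :=
    (tendsto_zero_iff_meromorphicOrderAt_pos (hm.mul hf)).1 h'
  rw [meromorphicOrderAt_mul hm hf, meromorphicOrderAt_id_sub_const] at h1
  cases ho : meromorphicOrderAt f a with
  | top => exact le_top
  | coe n =>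
    rw [ho] at h1
    have h1' : ((0 : ℤ) : WithTop ℤ) < ((1 + n : ℤ) : WithTop ℤ) := by exact_mod_cast h1
    rw [WithTop.coe_lt_coe] at h1'
    have : (0 : ℤ) ≤ n := by omega
    exact_mod_cast this

lemma meromorphicAt_polarTerm (a : ℂ) {z : ℂ} (hz : z ≠ 0) : MeromorphicAt (polarTerm a) z := by
  have h1 : MeromorphicAt (fun z => 1 / (1 - a / z)) z :=
    (MeromorphicAt.const 1 z).div (analyticAt_const.sub
      (analyticAt_const.div analyticAt_id hz)).meromorphicAt
  have h2 : MeromorphicAt (fun z => 1 / (1 - a * z)) z :=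
    (MeromorphicAt.const 1 z).div (analyticAt_const.sub
      (analyticAt_const.mul analyticAt_id)).meromorphicAt
  exact h1.add h2

lemma tendsto_polarTerm_self {a : ℂ} (ha0 : a ≠ 0) (ha : ‖a‖ < 1) :
    Tendsto (fun z => (1 - a / z) * polarTerm a z) (𝓝[≠] a) (𝓝 1) := by
  have hne : 1 - a * a ≠ 0 := sub_ne_zero.2 (mul_ne_one_of_norm_lt ha ha).symm
  have h2 : Tendsto (fun z => 1 / (1 - a * z)) (𝓝[≠] a) (𝓝 (1 / (1 - a * a))) := by
    have : ContinuousAt (fun z => 1 / (1 - a * z)) a :=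
      continuousAt_const.div (by fun_prop) hne
    exact this.tendsto.mono_left nhdsWithin_le_nhds
  have h3 := ((tendsto_one_sub_div ha0).mul h2).const_add 1
  rw [zero_mul, add_zero] at h3
  refine h3.congr' ?_
  filter_upwards [self_mem_nhdsWithin, nhdsWithin_le_nhds (isOpen_ne.mem_nhds ha0)] with z hz hz0
  have hz0' : z ≠ 0 := hz0
  have hd : 1 - a / z ≠ 0 := by
    rw [Ne, sub_eq_zero, eq_div_iff hz0', one_mul]
    exact hz
  rw [polarTerm, mul_add, mul_one_div_cancel hd]

lemma even_of_eqOn_opM {t : ℂ} (ht0 : t ≠ 0) (ht : ‖t‖ < 1) {f g : ℂ → ℂ}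
    (hg : MeromorphicOn g {w | w ≠ 0}) (hgf : Set.EqOn g (opM p q t f) (annulus ‖t‖⁻¹)) {x : ℂ}
    (hx : x ≠ 0) : (fun w => g w⁻¹) =ᶠ[𝓝[≠] x] g := by
  have hρ : 1 < ‖t‖⁻¹ := (one_lt_inv₀ (norm_pos_iff.2 ht0)).2 ht
  refine eventuallyEq_of_eqOn_annulus (f := opM p q t f) (one_lt_of_ne_zero hx) hρ
    (fun y hy => ?_) (hg.mono_set fun y hy => ne_zero_of_mem_annulus hy) (fun y hy => ?_)
    (hgf.mono Set.inter_subset_right) (mem_annulus_self hx)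
  · have hy0 := ne_zero_of_mem_annulus hy
    exact (hg y⁻¹ (inv_ne_zero hy0)).comp_analyticAt (analyticAt_inv hy0)
  · rw [hgf (inv_mem_annulus hy.2), opM_inv]

end EllipticBailey

end

noncomputable section

namespace EllipticBailey

variable {p q : ℂ}

lemma mul_pow_injective (hq0 : q ≠ 0) (hq : ‖q‖ < 1) {u : ℂ} (hu0 : u ≠ 0) {m n : ℕ}
    (h : u * q ^ m = u * q ^ n) : m = n := by
  have h1 := congrArg norm (mul_left_cancel₀ hu0 h)
  rw [norm_pow, norm_pow] at h1
  exact (pow_right_strictAnti₀ (norm_pos_iff.2 hq0) hq).injective h1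

section Regular

variable {u : ℂ} {N : ℕ} {S : Set ℂ} {f : ℂ → ℂ} {ρ : ℕ → ℂ}

/-- The function `f` without its polar parts at `u q^m`, `m ≤ N`. -/
def regularPart (q u : ℂ) (N : ℕ) (f : ℂ → ℂ) (ρ : ℕ → ℂ) (z : ℂ) : ℂ :=
  f z - ∑ m ∈ Finset.range (N + 1), ρ m * polarTerm (u * q ^ m) z

lemma analyticAt_sum_polarTerm (N : ℕ) (ρ : ℕ → ℂ) {z : ℂ} (hz0 : z ≠ 0)
    (h1 : ∀ m ≤ N, z ≠ u * q ^ m) (h2 : ∀ m ≤ N, u * q ^ m * z ≠ 1) :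
    AnalyticAt ℂ (fun z => ∑ m ∈ Finset.range (N + 1), ρ m * polarTerm (u * q ^ m) z) z :=
  Finset.analyticAt_fun_sum _ fun m hm => by
    rw [Finset.mem_range, Nat.lt_succ_iff] at hm
    exact analyticAt_const.mul (analyticAt_polarTerm hz0 (h1 m hm) (h2 m hm))

lemma TransformData.meromorphicOn_regularPart (h : TransformData q u N S f ρ) :
    MeromorphicOn (regularPart q u N f ρ) {w | w ≠ 0} := fun z hz =>
  (h.meromorphic z hz).sub (MeromorphicAt.fun_sum fun _ _ =>
    (MeromorphicAt.const _ z).mul (meromorphicAt_polarTerm _ hz))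

lemma TransformData.even_regularPart (h : TransformData q u N S f ρ) {z : ℂ} (hz : z ≠ 0) :
    (fun w => regularPart q u N f ρ w⁻¹) =ᶠ[𝓝[≠] z] regularPart q u N f ρ := by
  filter_upwards [h.even z hz] with w hw
  simp only [regularPart, polarTerm_inv, hw]

lemma TransformData.analyticAt_regularPart (hq : ‖q‖ < 1) (hu : ‖u‖ < 1)
    (h : TransformData q u N S f ρ) {z : ℂ} (hz : ‖z‖ = 1) :
    AnalyticAt ℂ (regularPart q u N f ρ) z := by
  have hz0 : z ≠ 0 := fun h => by simp [h] at hz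
  refine (h.analytic z hz).sub (analyticAt_sum_polarTerm N ρ hz0 (fun m _ h => ?_) fun m _ h => ?_)
  · have := norm_pow_mul_lt_one_of hq hu m
    rw [← h, hz] at this
    exact this.false
  · have := norm_pow_mul_lt_one_of hq hu m
    have h' := congrArg norm h
    rw [norm_mul, hz, mul_one, norm_one] at h'
    exact this.ne h'

lemma TransformData.order_regularPart (hq0 : q ≠ 0) (hq : ‖q‖ < 1) (hu0 : u ≠ 0) (hu : ‖u‖ < 1)
    (h : TransformData q u N S f ρ) {z : ℂ} (hz0 : z ≠ 0) (hz : ‖z‖ < 1) (hS : z ∉ S) :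
    0 ≤ meromorphicOrderAt (regularPart q u N f ρ) z := by
  have hm1 : ∀ m, u * q ^ m * z ≠ 1 := fun m =>
    mul_ne_one_of_norm_lt (norm_pow_mul_lt_one_of hq hu m) hz
  have hmer := h.meromorphicOn_regularPart z hz0
  by_cases hex : ∃ m ≤ N, z = u * q ^ m
  · obtain ⟨m, hm, rfl⟩ := hex
    refine meromorphicOrderAt_nonneg_of_tendsto hz0 hmer ?_
    have hmem : m ∈ Finset.range (N + 1) := Finset.mem_range.2 (Nat.lt_succ_of_le hm)
    have hsum : Tendsto (fun z => ∑ n ∈ (Finset.range (N + 1)).erase m,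
        ρ n * ((1 - u * q ^ m / z) * polarTerm (u * q ^ n) z)) (𝓝[≠] (u * q ^ m))
        (𝓝 (∑ n ∈ (Finset.range (N + 1)).erase m, ρ n * 0)) := by
      refine tendsto_finsetSum _ fun n hn => Tendsto.const_mul _ ?_
      have hne : u * q ^ m ≠ u * q ^ n := fun h =>
        (Finset.mem_erase.1 hn).1 (mul_pow_injective hq0 hq hu0 h).symm
      have han := analyticAt_polarTerm hz0 hne (hm1 n)
      exact tendsto_one_sub_div_mul hz0 han.meromorphicAt han.meromorphicOrderAt_nonneg
    have hlim := ((h.residue m hm).sub ((tendsto_polarTerm_self hz0 hz).const_mul (ρ m))).sub hsum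
    simp only [mul_one, mul_zero, Finset.sum_const_zero, sub_self] at hlim
    refine hlim.congr fun z => ?_
    rw [regularPart, ← Finset.add_sum_erase _ _ hmem, mul_sub, mul_add, Finset.mul_sum, sub_sub]
    congr 2
    · ring
    · exact Finset.sum_congr rfl fun n _ => by ring
  · push Not at hex
    have ho := h.order z hz0 hz hS hex
    rw [← tendsto_nhds_iff_meromorphicOrderAt_nonneg (h.meromorphic z hz0)] at ho
    rw [← tendsto_nhds_iff_meromorphicOrderAt_nonneg hmer]
    obtain ⟨c, hc⟩ := ho
    have han := analyticAt_sum_polarTerm (q := q) (u := u) N ρ hz0 hex fun m _ => hm1 m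
    exact ⟨_, hc.sub (han.continuousAt.tendsto.mono_left nhdsWithin_le_nhds)⟩

end Regular

/-- The continuation of the transform of the regular part. -/
lemma TransformData.exists_transform_regularPart (hp : ‖p‖ < 1) (hq0 : q ≠ 0) (hq : ‖q‖ < 1)
    {t u : ℂ} (ht0 : t ≠ 0) (ht : ‖t‖ < 1) (hu0 : u ≠ 0) (hu : ‖u‖ < 1) {N : ℕ} {S : Set ℂ}
    {f : ℂ → ℂ} {ρ : ℕ → ℂ} (hS : IsPoleSet p q u N S) (h : TransformData q u N S f ρ) :
    ∃ g : ℂ → ℂ, MeromorphicOn g {w | w ≠ 0} ∧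
      Set.EqOn g (opM p q t (regularPart q u N f ρ)) (annulus ‖t‖⁻¹) ∧
      (∀ x ∈ annulus ‖t‖⁻¹, AnalyticAt ℂ g x) ∧
      ∀ x, x ≠ 0 → (‖x‖ < 1 ∧ x / t ∉ S) → 0 ≤ meromorphicOrderAt g x := by
  refine exists_global_continuation ht0 ht fun B hB => ?_
  obtain ⟨σ, hσ, φ, hφ, hfφ⟩ := exists_factorization h.meromorphicOn_regularPart
    (fun z hz => h.even_regularPart hz) (fun z hz => h.analyticAt_regularPart hq hu hz)
    (B := B + 1) (by linarith)
  have hσS : ∀ s ∈ σ, s ∈ S := fun s hs => by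
    obtain ⟨h1, h2, h3⟩ := hσ s hs
    by_contra hn
    exact h3.not_ge (h.order_regularPart hq0 hq hu0 hu h1 h2 hn)
  obtain ⟨F, h1, h2, h3⟩ := exists_continuation_opM hp hq ht0 ht hB (fun s hs => (hσ s hs).2.1)
    (fun s hs => (hσ s hs).2.1) hφ hfφ
  refine ⟨F, h1, h2, fun x hx hcond => h3 x hx (hcond.imp_right fun hP => ?_)⟩
  have hmul : ∀ s ∈ σ, ∀ i j : ℕ, x / t ≠ s * (p ^ i * q ^ j) := fun s hs i j he =>
    hP.2 (he ▸ hS.mul s (hσS s hs) i j)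
  exact ⟨hP.1, fun i j he => hP.2 (hS.sq _ i j he), hmul, hmul⟩

/-- The continuation of the transform of a polar part. -/
lemma exists_transform_polarTerm (hp : ‖p‖ < 1) (hq : ‖q‖ < 1)
    {t a : ℂ} (ht0 : t ≠ 0) (ht : ‖t‖ < 1) (ha : ‖a‖ < 1) :
    ∃ g : ℂ → ℂ, MeromorphicOn g {w | w ≠ 0} ∧
      Set.EqOn g (opM p q t fun z => 2 / (1 - a / z)) (annulus ‖t‖⁻¹) ∧
      (∀ x ∈ annulus ‖t‖⁻¹, AnalyticAt ℂ g x) ∧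
      ∀ x, x ≠ 0 → (‖x‖ < 1 ∧ (∀ i j : ℕ, (x / t) ^ 2 ≠ p ^ i * q ^ j) ∧
        ∀ i j : ℕ, x / t ≠ a * (p ^ i * q ^ j)) → 0 ≤ meromorphicOrderAt g x := by
  refine exists_global_continuation ht0 ht fun B hB => ?_
  obtain ⟨F, h1, h2, h3⟩ := exists_continuation_opM (f := fun z => 2 / (1 - a / z))
    (φ := fun _ => 2) (σ := [a]) (σ' := []) hp hq ht0 ht hB (by simpa using ha) (by simp)
    (differentiableOn_const 2) fun z hz => by
      have hz0 : z ≠ 0 := fun h => by simp [h] at hz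
      have hza : z - a ≠ 0 := fun h => by
        rw [← sub_eq_zero.1 h, hz] at ha
        exact ha.false
      simp only [List.map_cons, List.map_nil, List.prod_cons, List.prod_nil, mul_one]
      field_simp
  refine ⟨F, h1, h2, fun x hx hcond => h3 x hx (hcond.imp_right fun hP => ?_)⟩
  exact ⟨hP.1, hP.2.1, by simpa using hP.2.2, by simp⟩

/-- The transformation maps functions with poles at `u q^m` to functions with poles at `t u q^n`,
and acts on the polar parts by the matrix `M`. -/
theorem TransformData.exists_transform (hp0 : p ≠ 0) (hp : ‖p‖ < 1) (hq0 : q ≠ 0) (hq : ‖q‖ < 1)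
    {t u : ℂ} (ht0 : t ≠ 0) (ht : ‖t‖ < 1) (hu0 : u ≠ 0) (hu : ‖u‖ < 1)
    (hΓ : ellGamma p q (t ^ 2) ≠ 0) {N : ℕ} (hnome : ∀ j < N, theta p (q ^ (j + 1))⁻¹ ≠ 0)
    {S : Set ℂ} {f : ℂ → ℂ} {ρ : ℕ → ℂ} (hS : IsPoleSet p q u N S)
    (h : TransformData q u N S f ρ) :
    ∃ g : ℂ → ℂ, Set.EqOn g (opM p q t f) (annulus ‖t‖⁻¹) ∧
      TransformData q (t * u) N {x | x / t ∈ S} g fun n =>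
        ∑ m ∈ Finset.range (N + 1), ρ m * (ellGamma p q (t ^ 2 * u ^ 2) / ellGamma p q (u ^ 2) *
          (q ^ (n * (n + 1)) * entryM p q (u ^ 2) (t ^ 2 * u ^ 2) n m *
            (q ^ (m * (m + 1)))⁻¹)) := by
  have hρ : 1 < ‖t‖⁻¹ := (one_lt_inv₀ (norm_pos_iff.2 ht0)).2 ht
  have hum : ∀ m, ‖u * q ^ m‖ < 1 := norm_pow_mul_lt_one_of hq hu
  have hum0 : ∀ m, u * q ^ m ≠ 0 := fun m => mul_ne_zero hu0 (pow_ne_zero _ hq0)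
  obtain ⟨g₀, hg₀, hg₀f, hg₀a, hg₀o⟩ := h.exists_transform_regularPart hp hq0 hq ht0 ht hu0 hu hS
  choose g hg hgf hga hgo using fun m : ℕ => exists_transform_polarTerm hp hq ht0 ht (hum m)
  set G : ℂ → ℂ := fun x => g₀ x + ∑ m ∈ Finset.range (N + 1), ρ m * g m x with hG
  have hGm : MeromorphicOn G {w | w ≠ 0} := fun x hx =>
    (hg₀ x hx).add (MeromorphicAt.fun_sum fun m _ => (MeromorphicAt.const _ x).mul (hg m x hx))
  have hGf : Set.EqOn G (opM p q t f) (annulus ‖t‖⁻¹) := by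
    intro x hx
    have hs : ∀ z ∈ Metric.sphere (0 : ℂ) 1, ‖z‖ = 1 := fun z hz => mem_sphere_zero_iff_norm.1 hz
    have hc : ∀ m, ContinuousOn (polarTerm (u * q ^ m)) (Metric.sphere 0 1) := fun m z hz => by
      have hz1 := hs z hz
      refine (analyticAt_polarTerm (fun h => by simp [h] at hz1) (fun h => ?_)
        fun h => ?_).continuousAt.continuousWithinAt
      · have := hum m
        rw [← h, hz1] at this
        exact this.false
      · have h' := congrArg norm h
        rw [norm_mul, hz1, mul_one, norm_one] at h'
        exact (hum m).ne h'
    have hc' : ∀ m, ContinuousOn (fun z => ρ m * polarTerm (u * q ^ m) z) (Metric.sphere 0 1) :=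
      fun m => continuousOn_const.mul (hc m)
    have e : opM p q t f x = opM p q t (fun z => regularPart q u N f ρ z +
        ∑ m ∈ Finset.range (N + 1), ρ m * polarTerm (u * q ^ m) z) x :=
      opM_congr (fun z _ => by rw [regularPart, sub_add_cancel]) x
    rw [e, opM_add hp hq ht0 hx
      (fun z hz => (h.analyticAt_regularPart hq hu (hs z hz)).continuousAt.continuousWithinAt)
      (continuousOn_finsetSum _ fun m _ => hc' m), opM_sum hp hq ht0 hx _ fun m _ => hc' m]
    simp only [hG]
    rw [hg₀f hx]
    congr 1
    refine Finset.sum_congr rfl fun m _ => ?_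
    rw [opM_const_mul, hgf m hx, opM_polarTerm hp hq ht0 hx (hum m)]
  refine ⟨G, hGf, hGm, fun x hx => even_of_eqOn_opM ht0 ht hGm hGf hx, fun x hx => ?_,
    fun x hx0 hx1 hxS hxu => ?_, fun n hn => ?_⟩
  · have hxa := mem_annulus_of_norm_eq_one hρ hx
    exact (hg₀a x hxa).add (Finset.analyticAt_fun_sum _ fun m _ =>
      analyticAt_const.mul (hga m x hxa))
  · have hxS' : x / t ∉ S := hxS
    have o0 := hg₀o x hx0 ⟨hx1, hxS'⟩
    have om : ∀ m ∈ Finset.range (N + 1), 0 ≤ meromorphicOrderAt (g m) x := by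
      intro m hm
      rw [Finset.mem_range, Nat.lt_succ_iff] at hm
      refine hgo m x hx0 ⟨hx1, fun i j he => hxS' (hS.sq _ i j he), fun i j he => ?_⟩
      by_cases hij : 1 ≤ i ∨ N < m + j
      · apply hxS'
        have := hS.shift i (m + j) hij
        rwa [he, show u * q ^ m * (p ^ i * q ^ j) = u * (p ^ i * q ^ (m + j)) by
          rw [pow_add]; ring]
      · push Not at hij
        obtain ⟨hi, hj⟩ := hij
        have hi0 : i = 0 := by omega
        refine hxu (m + j) hj ?_
        rw [hi0, pow_zero, one_mul, div_eq_iff ht0] at he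
        rw [he, pow_add]
        ring
    rw [← tendsto_nhds_iff_meromorphicOrderAt_nonneg (hg₀ x hx0)] at o0
    have om' : ∀ m ∈ Finset.range (N + 1), ∃ c, Tendsto (g m) (𝓝[≠] x) (𝓝 c) := fun m hm =>
      (tendsto_nhds_iff_meromorphicOrderAt_nonneg (hg m x hx0)).2 (om m hm)
    choose! c hc using om'
    obtain ⟨c₀, hc₀⟩ := o0
    rw [← tendsto_nhds_iff_meromorphicOrderAt_nonneg (hGm x hx0)]
    exact ⟨_, hc₀.add (tendsto_finsetSum _ fun m hm => (hc m hm).const_mul (ρ m))⟩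
  · have hx0 : t * u * q ^ n ≠ 0 := mul_ne_zero (mul_ne_zero ht0 hu0) (pow_ne_zero _ hq0)
    have hx1 : ‖t * u * q ^ n‖ < 1 := by
      rw [mul_assoc, norm_mul]
      exact mul_lt_one_of_nonneg_of_lt_one_left (norm_nonneg _) ht (hum n).le
    have hxt : t * u * q ^ n / t = u * q ^ n := by field_simp
    have l0 : Tendsto (fun x => (1 - t * u * q ^ n / x) * g₀ x) (𝓝[≠] (t * u * q ^ n)) (𝓝 0) :=
      tendsto_one_sub_div_mul hx0 (hg₀ _ hx0)
        (hg₀o _ hx0 ⟨hx1, by rw [hxt]; exact hS.notMem n hn⟩)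
    have hQ : ∀ i j : ℕ, (u * q ^ n) ^ 2 ≠ p ^ i * q ^ j := fun i j he =>
      hS.notMem n hn (hS.sq _ i j he)
    have lm : ∀ m ∈ Finset.range (N + 1), Tendsto (fun x => ρ m * ((1 - t * u * q ^ n / x) * g m x))
        (𝓝[≠] (t * u * q ^ n)) (𝓝 (ρ m * (ellGamma p q (t ^ 2 * u ^ 2) / ellGamma p q (u ^ 2) *
          (q ^ (n * (n + 1)) * entryM p q (u ^ 2) (t ^ 2 * u ^ 2) n m *
            (q ^ (m * (m + 1)))⁻¹)))) := by
      intro m hm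
      refine Tendsto.const_mul _ ?_
      rcases le_or_gt m n with hmn | hmn
      · obtain ⟨k, rfl⟩ := Nat.exists_eq_add_of_le hmn
        have hnome' : ∀ j < k, theta p (q ^ (j + 1))⁻¹ ≠ 0 := fun j hj => hnome j (by omega)
        have hx₀ : t * u * q ^ (m + k) = t * (u * q ^ m) * q ^ k := by
          rw [pow_add]
          ring
        obtain ⟨B, hB, hxB, F, hF, hFf, hlim⟩ := exists_continuation_opM_pinch hp hq0 hq ht0 ht
          (hum0 m) (hum m) k hnome' (by rwa [mul_assoc, ← pow_add]) hx₀
        rw [polar_part_eq_entryM hp0 hp hq0 hq ht0 ht hu0 hu hΓ m k hnome' hQ rfl rfl] at hlim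
        refine hlim.congr' ?_
        filter_upwards [eventuallyEq_of_eqOn_annulus hB hρ
          ((hg m).mono_set fun y hy => ne_zero_of_mem_annulus hy) hF
          ((hgf m).mono Set.inter_subset_right) hFf hxB] with x hx
        rw [hx]
      · rw [entryM, if_neg hmn.not_ge, mul_zero, zero_mul, mul_zero]
        refine tendsto_one_sub_div_mul hx0 (hg m _ hx0) (hgo m _ hx0 ⟨hx1, ?_, ?_⟩)
        · rwa [hxt]
        · rw [hxt]
          intro i j he
          rw [Finset.mem_range, Nat.lt_succ_iff] at hm
          rcases Nat.eq_zero_or_pos i with hi | hi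
          · rw [hi, pow_zero, one_mul, mul_assoc, ← pow_add] at he
            have := mul_pow_injective hq0 hq hu0 he
            omega
          · refine hS.notMem n hn ?_
            rw [he, show u * q ^ m * (p ^ i * q ^ j) = u * (p ^ i * q ^ (m + j)) by
              rw [pow_add]; ring]
            exact hS.shift i (m + j) (Or.inl hi)
    have hlim := l0.add (tendsto_finsetSum _ lm)
    rw [zero_add] at hlim
    refine hlim.congr fun x => ?_
    simp only [hG]
    rw [mul_add, Finset.mul_sum]
    congr 1
    exact Finset.sum_congr rfl fun m _ => by ring

end EllipticBailey

end

noncomputable section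

namespace EllipticBailey

variable {p q : ℂ}

/-! ### The diagonal factors -/

lemma meromorphicAt_ellGamma_comp (hp : ‖p‖ < 1) (hq : ‖q‖ < 1) {v : ℂ → ℂ} {w : ℂ}
    (hv : AnalyticAt ℂ v w) (hv0 : v w ≠ 0) : MeromorphicAt (fun x => ellGamma p q (v x)) w := by
  have hd : ∀ w, AnalyticAt ℂ (dPoch p q) w := fun w => (differentiable_dPoch hp hq).analyticAt w
  simp only [ellGamma_eq_div]
  exact ((hd _).fun_comp (analyticAt_const.mul (hv.inv hv0))).meromorphicAt.div
    ((hd _).fun_comp hv).meromorphicAt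

lemma ellGamma4_inv (e y w : ℂ) : ellGamma4 p q e y w⁻¹ = ellGamma4 p q e y w := by
  simp only [ellGamma4, inv_inv]
  ring

lemma meromorphicAt_ellGamma4 (hp : ‖p‖ < 1) (hq : ‖q‖ < 1) {e y w : ℂ} (he : e ≠ 0) (hy : y ≠ 0)
    (hw : w ≠ 0) : MeromorphicAt (ellGamma4 p q e y) w := by
  have hi : AnalyticAt ℂ (fun w : ℂ => w⁻¹) w := analyticAt_inv hw
  have h : ∀ c : ℂ, c ≠ 0 → MeromorphicAt (fun x => ellGamma p q (c * x)) w ∧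
      MeromorphicAt (fun x => ellGamma p q (c * x⁻¹)) w := fun c hc =>
    ⟨meromorphicAt_ellGamma_comp hp hq (analyticAt_const.mul analyticAt_id) (mul_ne_zero hc hw),
      meromorphicAt_ellGamma_comp hp hq (analyticAt_const.mul hi)
        (mul_ne_zero hc (inv_ne_zero hw))⟩
  have h1 := h (e * y) (mul_ne_zero he hy)
  have h2 := h (e * y⁻¹) (mul_ne_zero he (inv_ne_zero hy))
  exact ((h1.1.mul h1.2).mul h2.1).mul h2.2

/-- The poles of `Γ(e y^{±1} w^{±1})` in the punctured unit disc. -/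
def diagPoles (p q e y : ℂ) : Set ℂ :=
  {w | ∃ i j : ℕ, w = e * y * (p ^ i * q ^ j) ∨ w = e * y⁻¹ * (p ^ i * q ^ j)}

lemma mul_mem_diagPoles {e y w : ℂ} (hw : w ∈ diagPoles p q e y) (i j : ℕ) :
    w * (p ^ i * q ^ j) ∈ diagPoles p q e y := by
  obtain ⟨i', j', h⟩ := hw
  refine ⟨i' + i, j' + j, h.imp (fun h => ?_) fun h => ?_⟩ <;> rw [h, pow_add, pow_add] <;> ring

lemma norm_mul_lt_one {v w : ℂ} (hv : ‖v‖ < 1) (hw : ‖w‖ ≤ 1) : ‖v * w‖ < 1 := by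
  rw [norm_mul]
  exact mul_lt_one_of_nonneg_of_lt_one_left (norm_nonneg _) hv hw

lemma dPoch_mul_inv_ne_zero (hp : ‖p‖ < 1) (hq : ‖q‖ < 1) {c w : ℂ} (hw : w ≠ 0)
    (h : ∀ i j : ℕ, w ≠ c * (p ^ i * q ^ j)) : dPoch p q (c * w⁻¹) ≠ 0 := by
  intro h0
  obtain ⟨i, j, hij⟩ := (dPoch_eq_zero_iff hp hq _).1 h0
  refine h i j ?_
  field_simp at hij
  rw [← hij]
  ring

lemma analyticAt_ellGamma4 (hp : ‖p‖ < 1) (hq : ‖q‖ < 1) {e y w : ℂ} (he : e ≠ 0) (hy : y ≠ 0)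
    (hw : w ≠ 0) (hy1 : ‖e * y‖ < 1) (hy2 : ‖e * y⁻¹‖ < 1) (hw1 : ‖w‖ ≤ 1)
    (hwD : w ∉ diagPoles p q e y) : AnalyticAt ℂ (ellGamma4 p q e y) w := by
  have hi : AnalyticAt ℂ (fun w : ℂ => w⁻¹) w := analyticAt_inv hw
  have h : ∀ c : ℂ, c ≠ 0 → ‖c‖ < 1 → (∀ i j : ℕ, w ≠ c * (p ^ i * q ^ j)) →
      AnalyticAt ℂ (fun x => ellGamma p q (c * x)) w ∧
      AnalyticAt ℂ (fun x => ellGamma p q (c * x⁻¹)) w := fun c hc hc1 hcw =>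
    ⟨(analyticAt_ellGamma hp hq (mul_ne_zero hc hw) (dPoch_ne_zero_of_norm_lt hp hq
        (norm_mul_lt_one hc1 hw1))).fun_comp (f := fun x => c * x)
        (analyticAt_const.mul analyticAt_id),
      (analyticAt_ellGamma hp hq (mul_ne_zero hc (inv_ne_zero hw))
        (dPoch_mul_inv_ne_zero hp hq hw hcw)).fun_comp (f := fun x => c * x⁻¹)
        (analyticAt_const.mul hi)⟩
  have h1 := h (e * y) (mul_ne_zero he hy) hy1 fun i j h => hwD ⟨i, j, Or.inl h⟩
  have h2 := h (e * y⁻¹) (mul_ne_zero he (inv_ne_zero hy)) hy2 fun i j h => hwD ⟨i, j, Or.inr h⟩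
  exact ((h1.1.mul h1.2).mul h2.1).mul h2.2

lemma notMem_diagPoles_of_norm_eq_one (hp : ‖p‖ < 1) (hq : ‖q‖ < 1) {e y w : ℂ}
    (hy1 : ‖e * y‖ < 1) (hy2 : ‖e * y⁻¹‖ < 1) (hw : ‖w‖ = 1) : w ∉ diagPoles p q e y := by
  rintro ⟨i, j, h | h⟩
  · have := norm_mul_lt_one hy1 (norm_pow_mul_pow_le_one hp hq i j)
    rw [← h, hw] at this
    exact this.false
  · have := norm_mul_lt_one hy2 (norm_pow_mul_pow_le_one hp hq i j)
    rw [← h, hw] at this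
    exact this.false

lemma TransformData.mul_ellGamma4 (hp : ‖p‖ < 1) (hq0 : q ≠ 0) (hq : ‖q‖ < 1) {u : ℂ} (hu0 : u ≠ 0)
    (hu : ‖u‖ < 1) {N : ℕ} {S : Set ℂ} {f : ℂ → ℂ} {ρ : ℕ → ℂ} (h : TransformData q u N S f ρ)
    {e y : ℂ} (he : e ≠ 0) (hy : y ≠ 0) (hy1 : ‖e * y‖ < 1) (hy2 : ‖e * y⁻¹‖ < 1)
    (hD : ∀ m ≤ N, u * q ^ m ∉ diagPoles p q e y) {S' : Set ℂ}
    (hS' : S ∪ diagPoles p q e y ⊆ S') :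
    TransformData q u N S' (fun z => ellGamma4 p q e y z * f z)
      fun m => ellGamma4 p q e y (u * q ^ m) * ρ m where
  meromorphic z hz := (meromorphicAt_ellGamma4 hp hq he hy hz).mul (h.meromorphic z hz)
  even z hz := by
    filter_upwards [h.even z hz] with w hw
    rw [hw, ellGamma4_inv]
  analytic z hz := (analyticAt_ellGamma4 hp hq he hy (fun h => by simp [h] at hz) hy1 hy2 hz.le
    (notMem_diagPoles_of_norm_eq_one hp hq hy1 hy2 hz)).mul (h.analytic z hz)
  order z hz0 hz1 hzS hzu := by
    have ha := analyticAt_ellGamma4 hp hq he hy hz0 hy1 hy2 hz1.le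
      fun h => hzS (hS' (Or.inr h))
    have := meromorphicOrderAt_mul ha.meromorphicAt (h.meromorphic z hz0)
    change 0 ≤ meromorphicOrderAt (ellGamma4 p q e y * f) z
    rw [this]
    exact add_nonneg ha.meromorphicOrderAt_nonneg
      (h.order z hz0 hz1 (fun h => hzS (hS' (Or.inl h))) hzu)
  residue m hm := by
    have ha := analyticAt_ellGamma4 hp hq he hy (mul_ne_zero hu0 (pow_ne_zero m hq0)) hy1 hy2
      (norm_pow_mul_lt_one_of hq hu m).le (hD m hm)
    refine ((ha.continuousAt.tendsto.mono_left nhdsWithin_le_nhds).mul (h.residue m hm)).congr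
      fun z => ?_
    ring

/-- The values of `Γ(e y^{±1} w^{±1})` at `w = v q^n`. -/
lemma ellGamma4_mul_pow (hp0 : p ≠ 0) (hp : ‖p‖ < 1) (hq0 : q ≠ 0) (hq : ‖q‖ < 1) {e y v : ℂ}
    (he : e ≠ 0) (hy : y ≠ 0) (hv0 : v ≠ 0) (hv : ‖v‖ < 1) (hy1 : ‖e * y‖ < 1)
    (hy2 : ‖e * y⁻¹‖ < 1) (hy3 : ‖p * q * e⁻¹ * y‖ < 1) (hy4 : ‖p * q * e⁻¹ * y⁻¹‖ < 1) {n : ℕ}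
    (hD : v * q ^ n ∉ diagPoles p q e y) :
    ellGamma4 p q e y (v * q ^ n) = ellGamma p q (e * y * v) * ellGamma p q (e * y⁻¹ * v) /
      (ellGamma p q (p * q * e⁻¹ * y * v) * ellGamma p q (p * q * e⁻¹ * y⁻¹ * v)) *
      entryD p q (v ^ 2) (e * y * v) (e * y⁻¹ * v / p) n := by
  have hvn0 : v * q ^ n ≠ 0 := mul_ne_zero hv0 (pow_ne_zero n hq0)
  have hdir : ∀ c : ℂ, ‖c‖ < 1 → ellGamma p q (c * (v * q ^ n)) =
      thetaPoch p q (c * v) n * ellGamma p q (c * v) := fun c hc => by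
    rw [← mul_assoc, ellGamma_mul_pow hp hq0 hq n
      (dPoch_ne_zero_of_norm_lt hp hq (norm_mul_lt_one hc hv.le))]
  have hrefl : ∀ c d : ℂ, c ≠ 0 → p * q * c⁻¹ = d → ‖d‖ < 1 →
      (∀ i j : ℕ, v * q ^ n ≠ c * (p ^ i * q ^ j)) → ellGamma p q (c * (v * q ^ n)⁻¹) =
      (thetaPoch p q (d * v) n * ellGamma p q (d * v))⁻¹ := by
    intro c d hc hcd hd hcD
    have e1 : p * q * (c * (v * q ^ n)⁻¹)⁻¹ = d * (v * q ^ n) := by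
      rw [← hcd, mul_inv, inv_inv]
      ring
    have h1 := dPoch_mul_inv_ne_zero hp hq hvn0 hcD
    have h2 : dPoch p q (p * q * (c * (v * q ^ n)⁻¹)⁻¹) ≠ 0 := by
      rw [e1]
      exact dPoch_ne_zero_of_norm_lt hp hq
        (norm_mul_lt_one hd (norm_pow_mul_lt_one_of hq hv n).le)
    have := ellGamma_mul_reflect hp0 hq0 h1 h2
    rw [e1, hdir d hd] at this
    exact eq_inv_of_mul_eq_one_left this
  have hey : e * y ≠ 0 := mul_ne_zero he hy
  have hey' : e * y⁻¹ ≠ 0 := mul_ne_zero he (inv_ne_zero hy)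
  have r1 := hrefl (e * y) (p * q * e⁻¹ * y⁻¹) hey (by rw [mul_inv]; ring) hy4
    fun i j h => hD ⟨i, j, Or.inl h⟩
  have r2 := hrefl (e * y⁻¹) (p * q * e⁻¹ * y) hey' (by rw [mul_inv, inv_inv]; ring) hy3
    fun i j h => hD ⟨i, j, Or.inr h⟩
  have hshift : ∀ w : ℂ, w ≠ 0 → thetaPoch p q (p * w) n =
      (∏ j ∈ Finset.range n, -(w * q ^ j)⁻¹) * thetaPoch p q w n := by
    intro w hw
    rw [thetaPoch, thetaPoch, ← Finset.prod_mul_distrib]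
    refine Finset.prod_congr rfl fun j _ => ?_
    rw [mul_assoc, theta_mul_left hp0 hp (mul_ne_zero hw (pow_ne_zero j hq0))]
  have hprod : ∀ w : ℂ, ∏ j ∈ Finset.range n, -(w * q ^ j)⁻¹ =
      (w⁻¹) ^ n * ∏ j ∈ Finset.range n, -(q ^ j)⁻¹ := by
    intro w
    rw [← Finset.card_range n, ← Finset.prod_const, Finset.card_range, ← Finset.prod_mul_distrib]
    exact Finset.prod_congr rfl fun j _ => by rw [mul_inv]; ring
  have hsgn : (∏ j ∈ Finset.range n, -(q ^ j)⁻¹) ≠ 0 :=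
    Finset.prod_ne_zero_iff.2 fun j _ => neg_ne_zero.2 (inv_ne_zero (pow_ne_zero j hq0))
  have s1 : thetaPoch p q (e * y⁻¹ * v) n = ((e * y⁻¹ * v / p)⁻¹ ^ n *
      ∏ j ∈ Finset.range n, -(q ^ j)⁻¹) * thetaPoch p q (e * y⁻¹ * v / p) n := by
    rw [← hprod, ← hshift _ (div_ne_zero (mul_ne_zero hey' hv0) hp0)]
    congr 1
    field_simp
  have s2 : thetaPoch p q (p * q * e⁻¹ * y⁻¹ * v) n = ((v ^ 2 * q / (e * y * v))⁻¹ ^ n *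
      ∏ j ∈ Finset.range n, -(q ^ j)⁻¹) * thetaPoch p q (v ^ 2 * q / (e * y * v)) n := by
    rw [← hprod, ← hshift _ (div_ne_zero (mul_ne_zero (pow_ne_zero 2 hv0) hq0)
      (mul_ne_zero hey hv0))]
    congr 1
    field_simp
  have s3 : p * q * e⁻¹ * y * v = v ^ 2 * q / (e * y⁻¹ * v / p) := by field_simp
  have s4 : v ^ 2 * q / (e * y * v * (e * y⁻¹ * v / p)) =
      (v ^ 2 * q / (e * y * v)) * (e * y⁻¹ * v / p)⁻¹ := by field_simp
  rw [ellGamma4, hdir _ hy1, hdir _ hy2, r1, r2, s1, s2, entryD, s4, mul_pow]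
  rw [show thetaPoch p q (p * q * e⁻¹ * y * v) n =
    thetaPoch p q (v ^ 2 * q / (e * y⁻¹ * v / p)) n by rw [s3]]
  have hsgn' := mul_inv_cancel₀ hsgn
  generalize thetaPoch p q (e * y⁻¹ * v / p) n = T₁
  generalize thetaPoch p q (v ^ 2 * q / (e * y⁻¹ * v / p)) n = T₂
  generalize thetaPoch p q (v ^ 2 * q / (e * y * v)) n = T₃
  generalize v ^ 2 * q / (e * y * v) = A
  generalize (e * y⁻¹ * v / p)⁻¹ = C
  generalize (∏ j ∈ Finset.range n, -(q ^ j)⁻¹) = P at hsgn'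
  simp only [div_eq_mul_inv, mul_inv, inv_inv, inv_pow]
  linear_combination (thetaPoch p q (e * y * v) n * ellGamma p q (e * y * v) *
    (A ^ n * T₃⁻¹ * (ellGamma p q (p * q * e⁻¹ * y⁻¹ * v))⁻¹) *
    (C ^ n * T₁ * ellGamma p q (e * y⁻¹ * v)) *
    (T₂⁻¹ * (ellGamma p q (p * q * e⁻¹ * y * v))⁻¹)) * hsgn'

end EllipticBailey

end

noncomputable section

namespace EllipticBailey

variable {p q : ℂ}

/-! ### Test functions and pole sets -/

lemma meromorphicAt_of_tendsto {f : ℂ → ℂ} {a l : ℂ} (ha : a ≠ 0)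
    (hf : ∀ᶠ z in 𝓝[≠] a, AnalyticAt ℂ f z)
    (h : Tendsto (fun z => (1 - a / z) * f z) (𝓝[≠] a) (𝓝 l)) : MeromorphicAt f a := by
  set g : ℂ → ℂ := Function.update (fun z => (1 - a / z) * f z) a l with hg
  have hne : ∀ᶠ z : ℂ in 𝓝[≠] a, z ≠ 0 := (eventually_ne_nhds ha).filter_mono nhdsWithin_le_nhds
  have hga : AnalyticAt ℂ g a := by
    refine Complex.analyticAt_of_differentiable_on_punctured_nhds_of_continuousAt ?_ ?_
    · filter_upwards [hf, hne, self_mem_nhdsWithin] with z hz hz0 hza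
      have h1 : DifferentiableAt ℂ (fun z => (1 - a / z) * f z) z :=
        ((differentiableAt_const _).sub ((differentiableAt_const _).div differentiableAt_id
          hz0)).mul hz.differentiableAt
      refine h1.congr_of_eventuallyEq ?_
      filter_upwards [eventually_ne_nhds hza] with w hw
      rw [hg, Function.update_of_ne hw]
    · rwa [hg, continuousAt_update_same]
  have hd : MeromorphicAt (fun z : ℂ => 1 - a / z) a :=
    (analyticAt_const.sub (analyticAt_const.div analyticAt_id ha)).meromorphicAt
  refine (hga.meromorphicAt.div hd).congr ?_
  filter_upwards [hne, self_mem_nhdsWithin] with z hz0 hza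
  have : 1 - a / z ≠ 0 := by
    rw [sub_ne_zero]
    exact fun h => hza ((div_eq_one_iff_eq hz0).1 h.symm).symm
  rw [Pi.div_apply, hg, Function.update_of_ne hza, mul_div_cancel_left₀ _ this]

lemma IsTestFunction.transformData (hq0 : q ≠ 0) (hq : ‖q‖ < 1) {u : ℂ} (hu0 : u ≠ 0)
    (hu : ‖u‖ < 1) {N : ℕ} {α : ℂ → ℂ} {ρ : ℕ → ℂ} (h : IsTestFunction q u N α ρ) (S : Set ℂ) :
    TransformData q u N S α ρ := by
  have hlt : ∀ m, ‖u * q ^ m‖ < 1 := fun m => norm_pow_mul_lt_one_of hq hu m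
  have hne : ∀ m, u * q ^ m ≠ 0 := fun m => mul_ne_zero hu0 (pow_ne_zero m hq0)
  have hgt : ∀ m, 1 < ‖(u * q ^ m)⁻¹‖ := fun m => by
    rw [norm_inv]
    exact (one_lt_inv₀ (norm_pos_iff.2 (hne m))).2 (hlt m)
  have hpole : ∀ m ≤ N, MeromorphicAt α (u * q ^ m) := by
    intro m hm
    refine meromorphicAt_of_tendsto (hne m) ?_ (h.residue m hm)
    have hfin : ({z : ℂ | ∃ n ≤ N, z = u * q ^ n} \ {u * q ^ m}).Finite := by
      refine Set.Finite.subset ((Set.finite_Iic N).image fun n => u * q ^ n) ?_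
      rintro z ⟨⟨n, hn, rfl⟩, -⟩
      exact ⟨n, hn, rfl⟩
    have h1 : ∀ᶠ z in 𝓝 (u * q ^ m), z ∉ {z : ℂ | ∃ n ≤ N, z = u * q ^ n} \ {u * q ^ m} :=
      hfin.isClosed.isOpen_compl.mem_nhds fun h => h.2 rfl
    have h2 : ∀ᶠ z in 𝓝 (u * q ^ m), ‖z‖ < 1 :=
      continuousAt_id.norm.eventually_lt continuousAt_const (hlt m)
    filter_upwards [h1.filter_mono nhdsWithin_le_nhds, h2.filter_mono nhdsWithin_le_nhds,
      (eventually_ne_nhds (hne m)).filter_mono nhdsWithin_le_nhds, self_mem_nhdsWithin]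
      with z hz1 hz2 hz0 hz
    refine h.analytic z hz0 fun n hn => ⟨fun e => hz1 ⟨⟨n, hn, e⟩, hz⟩, fun e => ?_⟩
    have := hgt n
    rw [← e] at this
    exact (this.trans hz2).false
  have heven : ∀ z : ℂ, z ≠ 0 → (fun w => α w⁻¹) =ᶠ[𝓝 z] α := fun z hz => by
    filter_upwards [eventually_ne_nhds hz] with w hw
    exact h.symm w hw
  refine ⟨fun z hz => ?_, fun z hz => (heven z hz).filter_mono nhdsWithin_le_nhds,
    fun z hz => ?_, fun z hz0 hz1 _ hz => ?_, h.residue⟩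
  · by_cases hz' : ∀ m ≤ N, z ≠ u * q ^ m ∧ z ≠ (u * q ^ m)⁻¹
    · exact (h.analytic z hz hz').meromorphicAt
    · push Not at hz'
      obtain ⟨m, hm, hz'⟩ := hz'
      by_cases e : z = u * q ^ m
      · exact e ▸ hpole m hm
      · have e' := hz' e
        have h1 : MeromorphicAt α z⁻¹ := by rw [e', inv_inv]; exact hpole m hm
        exact (h1.comp_analyticAt (analyticAt_inv hz)).congr
          ((heven z hz).filter_mono nhdsWithin_le_nhds)
  · refine h.analytic z (fun h => by simp [h] at hz) fun m _ => ⟨fun e => ?_, fun e => ?_⟩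
    · exact (hlt m).ne (e ▸ hz)
    · exact (hgt m).ne' (e ▸ hz)
  · refine (h.analytic z hz0 fun m hm => ⟨hz m hm, fun e => ?_⟩).meromorphicOrderAt_nonneg
    exact ((hgt m).trans (e ▸ hz1)).false

/-- The poles that the transformation produces from those at `u q^m`, `m ≤ N`, and those in `D`. -/
def poleSet (p q u : ℂ) (N : ℕ) (D : Set ℂ) : Set ℂ :=
  {z | (∃ i j : ℕ, z ^ 2 = p ^ i * q ^ j) ∨
    (∃ i j : ℕ, (1 ≤ i ∨ N < j) ∧ z = u * (p ^ i * q ^ j)) ∨ z ∈ D}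

lemma isPoleSet_poleSet (hp : ‖p‖ < 1) (hq0 : q ≠ 0) (hq : ‖q‖ < 1) {u : ℂ} (hu0 : u ≠ 0) {N : ℕ}
    {D : Set ℂ} (hD : ∀ z ∈ D, ∀ i j : ℕ, z * (p ^ i * q ^ j) ∈ D)
    (hpq : ∀ i j : ℕ, 1 ≤ i → 1 ≤ j → j ≤ N → p ^ i ≠ q ^ j)
    (hsq : ∀ i j : ℕ, (u * q ^ N) ^ 2 ≠ p ^ i * q ^ j) (huD : u * q ^ N ∉ D) :
    IsPoleSet p q u N (poleSet p q u N D) := by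
  have hmul : ∀ z ∈ poleSet p q u N D, ∀ i j : ℕ, z * (p ^ i * q ^ j) ∈ poleSet p q u N D := by
    rintro z (⟨i', j', h⟩ | ⟨i', j', h, h'⟩ | h) i j
    · refine Or.inl ⟨i' + 2 * i, j' + 2 * j, ?_⟩
      rw [mul_pow, h]
      ring
    · refine Or.inr (Or.inl ⟨i' + i, j' + j, by omega, ?_⟩)
      rw [h']
      ring
    · exact Or.inr (Or.inr (hD z h i j))
  refine ⟨hmul, fun z i j h => Or.inl ⟨i, j, h⟩, fun i j h => Or.inr (Or.inl ⟨i, j, h, rfl⟩),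
    fun m hm hmem => ?_⟩
  have h := hmul _ hmem 0 (N - m)
  rw [pow_zero, one_mul, mul_assoc, ← pow_add, Nat.add_sub_cancel' hm] at h
  rcases h with ⟨i, j, h⟩ | ⟨i, j, h, h'⟩ | h
  · exact hsq i j h
  · have e := mul_left_cancel₀ hu0 h'
    rcases lt_or_ge j N with hj | hj
    · refine hpq i (N - j) (by omega) (by omega) (by omega) ?_
      refine mul_right_cancel₀ (pow_ne_zero j hq0) ?_
      rw [← e, ← pow_add, Nat.sub_add_cancel hj.le]
    · have e' : p ^ i * q ^ (j - N) = 1 := by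
        refine mul_right_cancel₀ (pow_ne_zero N hq0) ?_
        rw [one_mul, mul_assoc, ← pow_add, Nat.sub_add_cancel hj, ← e]
      have hn : ‖p ^ i * q ^ (j - N)‖ < 1 := by
        rw [norm_mul, norm_pow, norm_pow]
        rcases h with h | h
        · exact mul_lt_one_of_nonneg_of_lt_one_left (by positivity)
            (pow_lt_one₀ (norm_nonneg _) hp (by omega)) (pow_le_one₀ (norm_nonneg _) hq.le)
        · exact mul_lt_one_of_nonneg_of_lt_one_right (pow_le_one₀ (norm_nonneg _) hp.le)
            (by positivity) (pow_lt_one₀ (norm_nonneg _) hq (by omega))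
      rw [e', norm_one] at hn
      exact hn.false
  · exact huD h

lemma ellGamma_ne_zero (hp : ‖p‖ < 1) (hq : ‖q‖ < 1) {v : ℂ} (hv : ‖v‖ < 1)
    (h : dPoch p q (p * q * v⁻¹) ≠ 0) : ellGamma p q v ≠ 0 := by
  rw [ellGamma_eq_div]
  exact div_ne_zero h (dPoch_ne_zero_of_norm_lt hp hq hv)

lemma dPoch_mul_inv_ne_zero_of_mul_pow (hp : ‖p‖ < 1) (hq : ‖q‖ < 1) {v : ℂ} (hv : v ≠ 0) (N : ℕ)
    (h : ∀ i j : ℕ, v * q ^ N ≠ p ^ i * q ^ j) : dPoch p q (p * q * v⁻¹) ≠ 0 := by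
  refine dPoch_mul_inv_ne_zero hp hq hv fun i j e => h (i + 1) (j + 1 + N) ?_
  rw [e]
  ring

lemma tendsto_mul_limit {F : ℂ → ℂ} {x₀ l : ℂ} (hx₀ : x₀ ≠ 0)
    (h : Tendsto (fun x => (1 - x₀ / x) * F x) (𝓝[≠] x₀) (𝓝 l)) :
    Tendsto (fun ε : ℂ => (1 - ε) * F (ε⁻¹ * x₀)) (𝓝[≠] 1) (𝓝 l) := by
  have h1 : Tendsto (fun ε : ℂ => ε⁻¹ * x₀) (𝓝[≠] 1) (𝓝[≠] x₀) := by
    refine tendsto_nhdsWithin_iff.2 ⟨?_, ?_⟩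
    · have : ContinuousAt (fun ε : ℂ => ε⁻¹ * x₀) 1 :=
        (continuousAt_inv₀ one_ne_zero).mul continuousAt_const
      have h := this.tendsto
      rw [inv_one, one_mul] at h
      exact h.mono_left nhdsWithin_le_nhds
    · filter_upwards [self_mem_nhdsWithin] with ε hε h
      refine hε ?_
      have : ε⁻¹ * x₀ = 1 * x₀ := by rw [one_mul]; exact h
      exact inv_eq_one.1 (mul_right_cancel₀ hx₀ this)
  refine (h.comp h1).congr' ?_
  filter_upwards [(eventually_ne_nhds (one_ne_zero (α := ℂ))).filter_mono nhdsWithin_le_nhds]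
    with ε hε
  simp only [Function.comp]
  congr 2
  field_simp

lemma mem_annulus_of_norm {s w : ℂ} (hs0 : s ≠ 0) (h1 : ‖s‖ < ‖w‖) (h2 : ‖s * w‖ < 1) :
    w ∈ annulus ‖s‖⁻¹ := by
  refine ⟨by rwa [inv_inv], ?_⟩
  rw [norm_mul] at h2
  rwa [lt_inv_comm₀ ((norm_pos_iff.2 hs0).trans h1) (norm_pos_iff.2 hs0), ← one_div,
    lt_div_iff₀ ((norm_pos_iff.2 hs0).trans h1)]

lemma theta_mul_pow_ne_zero (hp0 : p ≠ 0) (hp : ‖p‖ < 1) (hq0 : q ≠ 0) (hq : ‖q‖ < 1) {v e : ℂ}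
    (hv0 : v ≠ 0) (he : e ≠ 0) (h1 : ‖p * q * e⁻¹ * v‖ < 1) {N j : ℕ} (hj : j < N)
    (h : ∀ i j : ℕ, v * q ^ N ≠ e * (p ^ i * q ^ j)) :
    theta p (p * q * e⁻¹ * v * q ^ j) ≠ 0 := by
  have hn := norm_pow_mul_lt_one_of hq h1 j
  refine theta_ne_zero_of_norm_lt hp0 hp (mul_ne_zero (mul_ne_zero (mul_ne_zero
    (mul_ne_zero hp0 hq0) (inv_ne_zero he)) hv0) (pow_ne_zero j hq0)) hn fun i hi => ?_
  rcases i with _ | i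
  · rw [hi, pow_zero, norm_one] at hn
    exact hn.false
  · refine h i (N - (j + 1)) ?_
    have e1 : v * q ^ (j + 1) = e * p ^ i := by
      field_simp at hi
      refine mul_left_cancel₀ hp0 ?_
      rw [pow_succ] at hi ⊢
      linear_combination hi
    rw [← mul_assoc, ← e1, mul_assoc, ← pow_add]
    congr 2
    omega

end EllipticBailey

end

noncomputable section

namespace EllipticBailey

variable {p q : ℂ}

/-! ### The limits of the two sides of the star-triangle relation -/

lemma notMem_diagPoles_mul_pow {e y u : ℂ} {N m : ℕ} (hm : m ≤ N)
    (h : u * q ^ N ∉ diagPoles p q e y) : u * q ^ m ∉ diagPoles p q e y := fun hm' => by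
  have := mul_mem_diagPoles hm' 0 (N - m)
  rw [pow_zero, one_mul, mul_assoc, ← pow_add, Nat.add_sub_cancel' hm] at this
  exact h this

lemma theta_inv_pow_ne_zero (hp0 : p ≠ 0) (hp : ‖p‖ < 1) (hq0 : q ≠ 0) (hq : ‖q‖ < 1) {j : ℕ}
    (hj : 1 ≤ j) (hpq : ∀ i : ℕ, 1 ≤ i → p ^ i ≠ q ^ j) :
    theta p (q ^ j) ≠ 0 ∧ theta p (q ^ j)⁻¹ ≠ 0 := by
  have hq' : q ^ j ≠ 0 := pow_ne_zero j hq0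
  have hn : ‖q ^ j‖ < 1 := by
    rw [norm_pow]
    exact pow_lt_one₀ (norm_nonneg _) hq (by omega)
  have h : theta p (q ^ j) ≠ 0 := by
    refine theta_ne_zero_of_norm_lt hp0 hp hq' hn fun i hi => ?_
    rcases i with _ | i
    · rw [hi, pow_zero, norm_one] at hn
      exact hn.false
    · exact hpq (i + 1) (by omega) hi.symm
  refine ⟨h, ?_⟩
  rw [theta_inv hp hq']
  exact mul_ne_zero (neg_ne_zero.2 (inv_ne_zero hq')) h

lemma ellGamma_ne_zero_of_norm_lt (hp : ‖p‖ < 1) (hq : ‖q‖ < 1) {v : ℂ} (hv : ‖v‖ < 1)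
    (h : ‖p * q * v⁻¹‖ < 1) : ellGamma p q v ≠ 0 :=
  ellGamma_ne_zero hp hq hv (dPoch_ne_zero_of_norm_lt hp hq h)

lemma exists_continuation_starLHS (hp0 : p ≠ 0) (hp : ‖p‖ < 1) (hq0 : q ≠ 0) (hq : ‖q‖ < 1)
    {r s t y u : ℂ} {N : ℕ} (hr0 : r ≠ 0)
    (hs0 : s ≠ 0) (hs : ‖s‖ < 1) (ht0 : t ≠ 0) (ht : ‖t‖ < 1) (hy0 : y ≠ 0)
    (hsΓ : ellGamma p q (s ^ 2) ≠ 0) (htΓ : ellGamma p q (t ^ 2) ≠ 0)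
    (hy1 : ‖r * (s * t)⁻¹ * y‖ < 1) (hy2 : ‖r * (s * t)⁻¹ * y⁻¹‖ < 1)
    (hu0 : u ≠ 0) (hu : ‖u‖ < 1)
    (hpq : ∀ i j : ℕ, 1 ≤ i → 1 ≤ j → j ≤ N → p ^ i ≠ q ^ j)
    (hgz : ∀ i j : ℕ, (u * q ^ N) ^ 2 ≠ p ^ i * q ^ j)
    (hgx : ∀ i j : ℕ, (t * u * q ^ N) ^ 2 ≠ p ^ i * q ^ j)
    (hgD : t * u * q ^ N ∉ diagPoles p q (r * (s * t)⁻¹) y) {α : ℂ → ℂ} {ρ : ℕ → ℂ}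
    (h : IsTestFunction q u N α ρ) :
    ∃ F : ℂ → ℂ, IsContinuation s (starLHS p q r s t y α) F ∧
      Tendsto (fun ε : ℂ => (1 - ε) * F (ε⁻¹ * s * t * u * q ^ N)) (𝓝[≠] 1)
        (𝓝 (∑ n ∈ Finset.range (N + 1), ellGamma4 p q (r * (s * t)⁻¹) y (t * u * q ^ n) *
          (∑ m ∈ Finset.range (N + 1), ρ m * (ellGamma p q (t ^ 2 * u ^ 2) / ellGamma p q (u ^ 2) *
            (q ^ (n * (n + 1)) * entryM p q (u ^ 2) (t ^ 2 * u ^ 2) n m *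
              (q ^ (m * (m + 1)))⁻¹))) *
          (ellGamma p q (s ^ 2 * (t * u) ^ 2) / ellGamma p q ((t * u) ^ 2) *
            (q ^ (N * (N + 1)) * entryM p q ((t * u) ^ 2) (s ^ 2 * (t * u) ^ 2) N n *
              (q ^ (n * (n + 1)))⁻¹)))) := by
  have hnome : ∀ j < N, theta p (q ^ (j + 1))⁻¹ ≠ 0 := fun j hj =>
    (theta_inv_pow_ne_zero hp0 hp hq0 hq (by omega) fun i hi => hpq i _ hi (by omega)
      (by omega)).2
  have hS := isPoleSet_poleSet (D := ∅) hp hq0 hq hu0 (by simp) hpq hgz (by simp)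
  obtain ⟨g, hg, hgT⟩ := (h.transformData hq0 hq hu0 hu _).exists_transform hp0 hp hq0 hq ht0 ht
    hu0 hu htΓ hnome hS
  have htu0 : t * u ≠ 0 := mul_ne_zero ht0 hu0
  have htu : ‖t * u‖ < 1 := norm_mul_lt_one ht hu.le
  have he : r * (s * t)⁻¹ ≠ 0 := mul_ne_zero hr0 (inv_ne_zero (mul_ne_zero hs0 ht0))
  set e := r * (s * t)⁻¹ with he_def
  have hsub : {x | x / t ∈ poleSet p q u N ∅} ∪ diagPoles p q e y ⊆
      poleSet p q (t * u) N ({x | ∃ i j : ℕ, (x / t) ^ 2 = p ^ i * q ^ j} ∪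
        diagPoles p q e y) := by
    rintro x ((hx | ⟨i, j, hij, hx⟩ | hx) | hx)
    · exact Or.inr (Or.inr (Or.inl hx))
    · refine Or.inr (Or.inl ⟨i, j, hij, ?_⟩)
      rw [div_eq_iff ht0] at hx
      rw [hx]
      ring
    · exact hx.elim
    · exact Or.inr (Or.inr (Or.inr hx))
  have hS' : IsPoleSet p q (t * u) N (poleSet p q (t * u) N
      ({x | ∃ i j : ℕ, (x / t) ^ 2 = p ^ i * q ^ j} ∪ diagPoles p q e y)) := by
    refine isPoleSet_poleSet hp hq0 hq htu0 ?_ hpq hgx ?_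
    · rintro z (⟨i', j', hz⟩ | hz) i j
      · refine Or.inl ⟨i' + 2 * i, j' + 2 * j, ?_⟩
        rw [mul_div_right_comm, mul_pow, hz]
        ring
      · exact Or.inr (mul_mem_diagPoles hz i j)
    · rintro (⟨i, j, hz⟩ | hz)
      · refine hgz i j ?_
        rw [← hz]
        congr 1
        field_simp
      · exact hgD hz
  obtain ⟨F, hF, hFT⟩ := (hgT.mul_ellGamma4 hp hq0 hq htu0 htu he hy0 hy1 hy2
    (fun m hm => notMem_diagPoles_mul_pow hm hgD) hsub).exists_transform hp0 hp hq0 hq hs0 hs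
    htu0 htu hsΓ hnome hS'
  have hB : 1 < ‖t‖⁻¹ := (one_lt_inv₀ (norm_pos_iff.2 ht0)).2 ht
  refine ⟨F, ⟨hFT.meromorphic, fun w h1 h2 => ?_⟩, ?_⟩
  · rw [hF (mem_annulus_of_norm hs0 h1 h2), starLHS]
    refine opM_congr (fun z hz => ?_) w
    rw [hg (mem_annulus_of_norm_eq_one hB hz)]
    rfl
  · have := tendsto_mul_limit (mul_ne_zero (mul_ne_zero hs0 htu0) (pow_ne_zero N hq0))
      (hFT.residue N le_rfl)
    refine this.congr fun ε => ?_
    congr 2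
    ring

lemma exists_continuation_starRHS (hp0 : p ≠ 0) (hp : ‖p‖ < 1) (hq0 : q ≠ 0) (hq : ‖q‖ < 1)
    {r s t y u : ℂ} {N : ℕ} (hr0 : r ≠ 0)
    (hs0 : s ≠ 0) (hs : ‖s‖ < 1) (ht0 : t ≠ 0) (ht : ‖t‖ < 1) (hy0 : y ≠ 0)
    (hΓ : ellGamma p q ((s * t) ^ 2) ≠ 0)
    (hy1 : ‖r * s⁻¹ * y‖ < 1) (hy2 : ‖r * s⁻¹ * y⁻¹‖ < 1)
    (hy1' : ‖r * t⁻¹ * y‖ < 1) (hy2' : ‖r * t⁻¹ * y⁻¹‖ < 1)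
    (hu0 : u ≠ 0) (hu : ‖u‖ < 1)
    (hpq : ∀ i j : ℕ, 1 ≤ i → 1 ≤ j → j ≤ N → p ^ i ≠ q ^ j)
    (hgz : ∀ i j : ℕ, (u * q ^ N) ^ 2 ≠ p ^ i * q ^ j)
    (hgD : u * q ^ N ∉ diagPoles p q (r * s⁻¹) y)
    (hgD' : s * t * u * q ^ N ∉ diagPoles p q (r * t⁻¹) y) {α : ℂ → ℂ} {ρ : ℕ → ℂ}
    (h : IsTestFunction q u N α ρ) :
    ∃ G : ℂ → ℂ, IsContinuation s (starRHS p q r s t y α) G ∧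
      Tendsto (fun ε : ℂ => (1 - ε) * G (ε⁻¹ * s * t * u * q ^ N)) (𝓝[≠] 1)
        (𝓝 (ellGamma4 p q (r * t⁻¹) y (s * t * u * q ^ N) *
          ∑ m ∈ Finset.range (N + 1), ellGamma4 p q (r * s⁻¹) y (u * q ^ m) * ρ m *
            (ellGamma p q ((s * t) ^ 2 * u ^ 2) / ellGamma p q (u ^ 2) *
              (q ^ (N * (N + 1)) * entryM p q (u ^ 2) ((s * t) ^ 2 * u ^ 2) N m *
                (q ^ (m * (m + 1)))⁻¹)))) := by
  have hnome : ∀ j < N, theta p (q ^ (j + 1))⁻¹ ≠ 0 := fun j hj =>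
    (theta_inv_pow_ne_zero hp0 hp hq0 hq (by omega) fun i hi => hpq i _ hi (by omega)
      (by omega)).2
  have hst0 : s * t ≠ 0 := mul_ne_zero hs0 ht0
  have hst : ‖s * t‖ < 1 := norm_mul_lt_one hs ht.le
  have he : r * s⁻¹ ≠ 0 := mul_ne_zero hr0 (inv_ne_zero hs0)
  have he' : r * t⁻¹ ≠ 0 := mul_ne_zero hr0 (inv_ne_zero ht0)
  have hx0 : s * t * u * q ^ N ≠ 0 := mul_ne_zero (mul_ne_zero hst0 hu0) (pow_ne_zero N hq0)
  have hx1 : ‖s * t * u * q ^ N‖ < 1 :=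
    norm_pow_mul_lt_one_of hq (norm_mul_lt_one hst hu.le) N
  have hS := isPoleSet_poleSet hp hq0 hq hu0
    (fun z hz i j => mul_mem_diagPoles (p := p) (q := q) (e := r * s⁻¹) (y := y) hz i j)
    hpq hgz hgD
  obtain ⟨g, hg, hgT⟩ := ((h.transformData hq0 hq hu0 hu ∅).mul_ellGamma4 hp hq0 hq hu0 hu he hy0
    hy1 hy2 (fun m hm => notMem_diagPoles_mul_pow hm hgD) (S' := poleSet p q u N
      (diagPoles p q (r * s⁻¹) y)) fun z hz => Or.inr (Or.inr (by simpa using hz))).exists_transform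
    hp0 hp hq0 hq hst0 hst hu0 hu hΓ hnome hS
  refine ⟨fun w => opD p q r t y w * g w, ⟨fun w hw =>
    (meromorphicAt_ellGamma4 hp hq he' hy0 hw).mul (hgT.meromorphic w hw), fun w h1 h2 => ?_⟩, ?_⟩
  · have hB : ‖s‖⁻¹ ≤ ‖s * t‖⁻¹ := by
      refine inv_anti₀ (norm_pos_iff.2 hst0) ?_
      rw [norm_mul]
      exact mul_le_of_le_one_right (norm_nonneg _) ht.le
    beta_reduce
    rw [hg (annulus_subset (inv_pos.2 (norm_pos_iff.2 hs0)) hB (mem_annulus_of_norm hs0 h1 h2))]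
    rfl
  · have ha := analyticAt_ellGamma4 hp hq he' hy0 hx0 hy1' hy2' hx1.le hgD'
    have h1 := (ha.continuousAt.tendsto.mono_left
      (nhdsWithin_le_nhds (s := {s * t * u * q ^ N}ᶜ))).mul (hgT.residue N le_rfl)
    have h2 := tendsto_mul_limit (F := fun w => opD p q r t y w * g w) hx0 (h1.congr fun x => by
      rw [opD]
      ring)
    refine h2.congr fun ε => ?_
    beta_reduce
    rw [show ε⁻¹ * s * t * u * q ^ N = ε⁻¹ * (s * t * u * q ^ N) by ring]

end EllipticBailey

end

noncomputable section

namespace EllipticBailey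

variable {p q : ℂ}

/-! ### Genericity of the parameters -/

lemma theta_sq_mul_pow_ne_zero (hp0 : p ≠ 0) (hp : ‖p‖ < 1) (hq0 : q ≠ 0) (hq : ‖q‖ < 1) {v : ℂ}
    (hv0 : v ≠ 0) (hv : ‖v‖ < 1) {N j : ℕ} (hj : j ≤ 2 * N)
    (h : ∀ i j : ℕ, (v * q ^ N) ^ 2 ≠ p ^ i * q ^ j) : theta p (v ^ 2 * q ^ j) ≠ 0 := by
  have hv2 : ‖v ^ 2‖ < 1 := by
    rw [norm_pow]
    exact pow_lt_one₀ (norm_nonneg _) hv two_ne_zero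
  refine theta_ne_zero_of_norm_lt hp0 hp (mul_ne_zero (pow_ne_zero 2 hv0) (pow_ne_zero j hq0))
    (norm_pow_mul_lt_one_of hq hv2 j) fun i hi => h i (2 * N - j) ?_
  rw [← hi, mul_assoc, ← pow_add, Nat.add_sub_cancel' hj]
  ring

lemma theta_ne_zero_of_mul_left (hp0 : p ≠ 0) (hp : ‖p‖ < 1) {z : ℂ} (hz : z ≠ 0)
    (h : theta p (p * z) ≠ 0) : theta p z ≠ 0 := by
  rw [theta_mul_left hp0 hp hz] at h
  exact right_ne_zero_of_mul h

lemma ellGamma_sq_ne_zero (hp : ‖p‖ < 1) (hq : ‖q‖ < 1) {v : ℂ} (hv0 : v ≠ 0) (hv : ‖v‖ < 1)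
    {N : ℕ} (h : ∀ i j : ℕ, (v * q ^ N) ^ 2 ≠ p ^ i * q ^ j) : ellGamma p q (v ^ 2) ≠ 0 := by
  refine ellGamma_ne_zero hp hq ?_ (dPoch_mul_inv_ne_zero_of_mul_pow hp hq (pow_ne_zero 2 hv0)
    (N * 2) fun i j => ?_)
  · rw [norm_pow]
    exact pow_lt_one₀ (norm_nonneg _) hv two_ne_zero
  · rw [pow_mul, ← mul_pow]
    exact h i j

lemma starGeneric_of_notMem (hp0 : p ≠ 0) (hp : ‖p‖ < 1) (hq0 : q ≠ 0) (hq : ‖q‖ < 1)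
    {r s t y u : ℂ} {N : ℕ} (hr : r ^ 2 = p * q) (hs0 : s ≠ 0) (hs : ‖s‖ < 1) (ht0 : t ≠ 0)
    (ht : ‖t‖ < 1) (hy0 : y ≠ 0) (hy1 : ‖r * y‖ < 1) (hy2 : ‖r * y⁻¹‖ < 1)
    (hu0 : u ≠ 0) (hu : ‖u‖ < 1)
    (hpq : ∀ i j : ℕ, 1 ≤ i → 1 ≤ j → j ≤ N → p ^ i ≠ q ^ j)
    (hgz : ∀ i j : ℕ, (u * q ^ N) ^ 2 ≠ p ^ i * q ^ j)
    (hgx : ∀ i j : ℕ, (t * u * q ^ N) ^ 2 ≠ p ^ i * q ^ j)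
    (hgD : t * u * q ^ N ∉ diagPoles p q (r * (s * t)⁻¹) y)
    (hgD' : u * q ^ N ∉ diagPoles p q (r * s⁻¹) y) :
    StarGeneric p q (u ^ 2) ((t * u) ^ 2) (r * (u / s) * y) (r / p * (u / s) * y⁻¹) N := by
  have hr0 : r ≠ 0 := fun h => mul_ne_zero hp0 hq0 (by rw [← hr, h]; ring)
  have hst0 : s * t ≠ 0 := mul_ne_zero hs0 ht0
  have htu0 : t * u ≠ 0 := mul_ne_zero ht0 hu0
  have htu : ‖t * u‖ < 1 := norm_mul_lt_one ht hu.le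
  have hsu : ‖s * u‖ < 1 := norm_mul_lt_one hs hu.le
  have hsttu : ‖s * t * (t * u)‖ < 1 := norm_mul_lt_one (norm_mul_lt_one hs ht.le) htu.le
  have hq1 : ∀ j, 1 ≤ j → q ^ j = q * q ^ (j - 1) := fun j hj => by
    rw [← pow_succ', Nat.sub_add_cancel hj]
  refine ⟨fun j hj => theta_sq_mul_pow_ne_zero hp0 hp hq0 hq htu0 htu hj hgx,
    fun j hj => theta_sq_mul_pow_ne_zero hp0 hp hq0 hq hu0 hu hj hgz,
    fun j h1 hj => (theta_inv_pow_ne_zero hp0 hp hq0 hq h1 fun i hi => hpq i j hi h1 hj).1,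
    fun j h1 hj => theta_ne_zero_of_mul_left hp0 hp (by positivity) ?_, fun j h1 hj => ?_,
    fun j h1 hj => theta_ne_zero_of_mul_left hp0 hp (by positivity) ?_, fun j h1 hj => ?_⟩
  · have h := theta_mul_pow_ne_zero (N := N) (j := j - 1) (e := r * (s * t)⁻¹ * y) hp0 hp hq0 hq
      htu0 (by positivity) ?_ (by omega) fun i j e => hgD ⟨i, j, Or.inl e⟩
    · convert h using 2
      rw [hq1 j h1]
      field_simp
    · convert norm_mul_lt_one hy2 hsttu.le using 2
      rw [← hr]
      field_simp
  · have h := theta_mul_pow_ne_zero (N := N) (j := j - 1) (e := r * (s * t)⁻¹ * y⁻¹) hp0 hp hq0 hq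
      htu0 (by positivity) ?_ (by omega) fun i j e => hgD ⟨i, j, Or.inr e⟩
    · convert h using 2
      rw [hq1 j h1]
      field_simp
    · convert norm_mul_lt_one hy1 hsttu.le using 2
      rw [← hr]
      field_simp
  · have h := theta_mul_pow_ne_zero (N := N) (j := j - 1) (e := r * s⁻¹ * y) hp0 hp hq0 hq
      hu0 (by positivity) ?_ (by omega) fun i j e => hgD' ⟨i, j, Or.inl e⟩
    · convert h using 2
      rw [hq1 j h1]
      field_simp
    · convert norm_mul_lt_one hy2 hsu.le using 2
      rw [← hr]
      field_simp
  · have h := theta_mul_pow_ne_zero (N := N) (j := j - 1) (e := r * s⁻¹ * y⁻¹) hp0 hp hq0 hq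
      hu0 (by positivity) ?_ (by omega) fun i j e => hgD' ⟨i, j, Or.inr e⟩
    · convert h using 2
      rw [hq1 j h1]
      field_simp
    · convert norm_mul_lt_one hy1 hsu.le using 2
      rw [← hr]
      field_simp

end EllipticBailey

end

open EllipticBailey in
theorem mainTheorem2
    (p q r s t y z₀ : ℂ) (N : ℕ)
    (hp0 : p ≠ 0) (hp1 : ‖p‖ < 1) (hq0 : q ≠ 0) (hq1 : ‖q‖ < 1)
    (hr : r ^ 2 = p * q)
    (hs0 : s ≠ 0) (hs1 : ‖s‖ < 1) (ht0 : t ≠ 0) (ht1 : ‖t‖ < 1) (hy0 : y ≠ 0)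
    (hy1 : ‖r * (s * t)⁻¹ * y‖ < 1) (hy2 : ‖r * (s * t)⁻¹ * y⁻¹‖ < 1)
    (hz0 : z₀ ≠ 0) (hz1 : ‖z₀‖ < 1)
    -- genericity: no poles collide besides those that produce the limits
    (hpq : ∀ i j : ℕ, 1 ≤ i → 1 ≤ j → j ≤ N → p ^ i ≠ q ^ j)
    (hgz : ∀ i j : ℕ, (z₀ * q ^ N) ^ 2 ≠ p ^ i * q ^ j)
    (hgx : ∀ i j : ℕ, (t * z₀ * q ^ N) ^ 2 ≠ p ^ i * q ^ j)
    (hgD : ∀ i j : ℕ, t * z₀ * q ^ N ≠ r * (s * t)⁻¹ * y * p ^ i * q ^ j ∧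
      t * z₀ * q ^ N ≠ r * (s * t)⁻¹ * y⁻¹ * p ^ i * q ^ j)
    (hgD' : ∀ i j : ℕ, z₀ * q ^ N ≠ r * s⁻¹ * y * p ^ i * q ^ j ∧
      z₀ * q ^ N ≠ r * s⁻¹ * y⁻¹ * p ^ i * q ^ j)
    (τ a k b c : ℂ)
    (hτ : τ = z₀ ^ 2) (ha : a = (t * z₀) ^ 2) (hk : k = (s * t * z₀) ^ 2)
    -- the branches `√(pqτa/k) = √(pq) z₀/s` and `√(qτa/(pk)) = √(pq) z₀/(ps)`
    (hb : b = r * (z₀ / s) * y) (hc : c = r / p * (z₀ / s) * y⁻¹) :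
    b ^ 2 = p * q * τ * a / k * y ^ 2 ∧
    c ^ 2 = q * τ * a / (p * k) * (y⁻¹) ^ 2 ∧
    k * b * c = q * a * τ ∧
    (∀ (α : ℂ → ℂ) (res : ℕ → ℂ), IsTestFunction q z₀ N α res →
      (∃ F : ℂ → ℂ, IsContinuation s (starLHS p q r s t y α) F ∧
        Tendsto (fun ε : ℂ => (1 - ε) * F (ε⁻¹ * s * t * z₀ * q ^ N)) (𝓝[≠] 1)
          (𝓝 (prefactor p q N τ a k b c *
            ∑ n : Fin (N + 1), ∑ m : Fin (N + 1),
              matM p q N a k (Fin.last N) n * entryD p q a b c n * matM p q N τ a n m *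
                ((q ^ ((m : ℕ) * (m + 1)))⁻¹ * res m)))) ∧
      (∃ G : ℂ → ℂ, IsContinuation s (starRHS p q r s t y α) G ∧
        Tendsto (fun ε : ℂ => (1 - ε) * G (ε⁻¹ * s * t * z₀ * q ^ N)) (𝓝[≠] 1)
          (𝓝 (prefactor p q N τ a k b c *
            ∑ m : Fin (N + 1),
              entryD p q k (q * τ / c) (q * τ / b) N * matM p q N τ k (Fin.last N) m *
                entryD p q τ b c m * ((q ^ ((m : ℕ) * (m + 1)))⁻¹ * res m))))) ∧
    matM p q N a k * matD p q N a b c * matM p q N τ a =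
      matD p q N k (q * τ / c) (q * τ / b) * matM p q N τ k * matD p q N τ b c := by
  have hr0 : r ≠ 0 := fun h => mul_ne_zero hp0 hq0 (by rw [← hr, h]; ring)
  have hst0 : s * t ≠ 0 := mul_ne_zero hs0 ht0
  have hst1 : ‖s * t‖ < 1 := norm_mul_lt_one hs1 ht1.le
  have htz0 : t * z₀ ≠ 0 := mul_ne_zero ht0 hz0
  have htz1 : ‖t * z₀‖ < 1 := norm_mul_lt_one ht1 hz1.le
  have hsq : ∀ {v : ℂ}, ‖v‖ < 1 → ‖v ^ 2‖ < 1 := fun hv => by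
    rw [norm_pow]
    exact pow_lt_one₀ (norm_nonneg _) hv two_ne_zero
  -- the bounds on `√(pq) x y^{±1}` for the various `x`
  have hmul : ∀ x v : ℂ, v = s * t * x → ‖v‖ ≤ 1 → ‖r * x * y‖ < 1 ∧ ‖r * x * y⁻¹‖ < 1 := by
    intro x v hv hv1
    have e : ∀ z : ℂ, r * x * z = r * (s * t)⁻¹ * z * v := fun z => by rw [hv]; field_simp
    rw [e, e]
    exact ⟨norm_mul_lt_one hy1 hv1, norm_mul_lt_one hy2 hv1⟩
  have hs' := hmul s⁻¹ t (by field_simp) ht1.le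
  have ht' := hmul t⁻¹ s (by field_simp) hs1.le
  have hr1 := hmul 1 (s * t) (by ring) hst1.le
  have hs'' := hmul s (s * t * s) rfl (norm_mul_lt_one hst1 hs1.le).le
  have ht'' := hmul t (s * t * t) rfl (norm_mul_lt_one hst1 ht1.le).le
  have hst'' := hmul (s * t) (s * t * (s * t)) rfl (norm_mul_lt_one hst1 hst1.le).le
  have hinv : ∀ x : ℂ, x ≠ 0 → p * q * (r * x⁻¹)⁻¹ = r * x := fun x hx => by
    rw [← hr]
    field_simp
  have hD₁ : t * z₀ * q ^ N ∉ diagPoles p q (r * (s * t)⁻¹) y := by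
    rintro ⟨i, j, h | h⟩
    · exact (hgD i j).1 (by rw [h]; ring)
    · exact (hgD i j).2 (by rw [h]; ring)
  have hD₂ : z₀ * q ^ N ∉ diagPoles p q (r * s⁻¹) y := by
    rintro ⟨i, j, h | h⟩
    · exact (hgD' i j).1 (by rw [h]; ring)
    · exact (hgD' i j).2 (by rw [h]; ring)
  have hD₃ : s * t * z₀ * q ^ N ∉ diagPoles p q (r * t⁻¹) y := by
    have e : t * z₀ * q ^ N = s⁻¹ * (s * t * z₀ * q ^ N) := by field_simp
    rintro ⟨i, j, h | h⟩
    · exact (hgD i j).1 (by rw [e, h, mul_inv]; ring)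
    · exact (hgD i j).2 (by rw [e, h, mul_inv]; ring)
  have hpqst : ‖p * q * ((s * t) ^ 2)⁻¹‖ < 1 := by
    have e : p * q * ((s * t) ^ 2)⁻¹ = r * (s * t)⁻¹ * y * (r * (s * t)⁻¹ * y⁻¹) := by
      rw [← hr]
      field_simp
    rw [e]
    exact norm_mul_lt_one hy1 hy2.le
  have hΓst : ellGamma p q ((s * t) ^ 2) ≠ 0 :=
    ellGamma_ne_zero_of_norm_lt hp1 hq1 (hsq hst1) hpqst
  have hΓs : ellGamma p q (s ^ 2) ≠ 0 := by
    refine ellGamma_ne_zero_of_norm_lt hp1 hq1 (hsq hs1) ?_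
    convert norm_mul_lt_one hpqst (hsq ht1).le using 2
    field_simp
  have hΓt : ellGamma p q (t ^ 2) ≠ 0 := by
    refine ellGamma_ne_zero_of_norm_lt hp1 hq1 (hsq ht1) ?_
    convert norm_mul_lt_one hpqst (hsq hs1).le using 2
    field_simp
  have hΓa : ellGamma p q ((t * z₀) ^ 2) ≠ 0 := ellGamma_sq_ne_zero hp1 hq1 htz0 htz1 hgx
  have hD₀ : z₀ ∉ diagPoles p q (r * s⁻¹) y := by
    simpa using notMem_diagPoles_mul_pow (Nat.zero_le N) hD₂
  have hΓ₁ : ellGamma p q (r * s * y * z₀) ≠ 0 := by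
    refine ellGamma_ne_zero hp1 hq1 (norm_mul_lt_one hs''.1 hz1.le) ?_
    convert dPoch_mul_inv_ne_zero hp1 hq1 hz0 fun i j e => hD₀ ⟨i, j, Or.inr e⟩ using 2
    rw [← hr]
    field_simp
  have hΓ₂ : ellGamma p q (r * s * y⁻¹ * z₀) ≠ 0 := by
    refine ellGamma_ne_zero hp1 hq1 (norm_mul_lt_one hs''.2 hz1.le) ?_
    convert dPoch_mul_inv_ne_zero hp1 hq1 hz0 fun i j e => hD₀ ⟨i, j, Or.inl e⟩ using 2
    rw [← hr]
    field_simp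
  -- the arguments of the elliptic gamma functions
  have eb₁ : r * (s * t)⁻¹ * y * (t * z₀) = b := by rw [hb]; field_simp
  have ec₁ : r * (s * t)⁻¹ * y⁻¹ * (t * z₀) = p * c := by rw [hc]; field_simp
  have eb₂ : r * s⁻¹ * y * z₀ = b := by rw [hb]; field_simp
  have ec₂ : r * s⁻¹ * y⁻¹ * z₀ = p * c := by rw [hc]; field_simp
  have eqc : r * s * y * z₀ = q * τ / c := by
    rw [hc, hτ]
    field_simp
    linear_combination hr
  have epb : r * s * y⁻¹ * z₀ = p * (q * τ / b) := by
    rw [hb, hτ]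
    field_simp
    linear_combination hr
  have eqa : r * (s * t) * y * (t * z₀) = q * a / c := by
    rw [hc, ha]
    field_simp
    linear_combination hr
  have epa : r * (s * t) * y⁻¹ * (t * z₀) = p * q * a / b := by
    rw [hb, ha]
    field_simp
    linear_combination hr
  have hpc : p * c / p = c := by field_simp
  have hpb : p * (q * τ / b) / p = q * τ / b := by field_simp
  have v₁ : ∀ n ≤ N, ellGamma4 p q (r * (s * t)⁻¹) y (t * z₀ * q ^ n) =
      ellGamma p q b * ellGamma p q (p * c) / (ellGamma p q (q * a / c) *
        ellGamma p q (p * q * a / b)) * entryD p q a b c n := by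
    intro n hn
    rw [ellGamma4_mul_pow hp0 hp1 hq0 hq1 (mul_ne_zero hr0 (inv_ne_zero hst0)) hy0 htz0 htz1 hy1
      hy2 (by rw [hinv _ hst0]; exact hst''.1) (by rw [hinv _ hst0]; exact hst''.2)
      (notMem_diagPoles_mul_pow hn hD₁), hinv _ hst0, eb₁, ec₁, eqa, epa, hpc, ha]
  have v₂ : ∀ n ≤ N, ellGamma4 p q (r * s⁻¹) y (z₀ * q ^ n) =
      ellGamma p q b * ellGamma p q (p * c) / (ellGamma p q (q * τ / c) *
        ellGamma p q (p * (q * τ / b))) * entryD p q τ b c n := by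
    intro n hn
    rw [ellGamma4_mul_pow hp0 hp1 hq0 hq1 (mul_ne_zero hr0 (inv_ne_zero hs0)) hy0 hz0 hz1 hs'.1
      hs'.2 (by rw [hinv _ hs0]; exact hs''.1) (by rw [hinv _ hs0]; exact hs''.2)
      (notMem_diagPoles_mul_pow hn hD₂), hinv _ hs0, eb₂, ec₂, eqc, epb, hpc, hτ]
  have v₃ : ellGamma4 p q (r * t⁻¹) y (s * t * z₀ * q ^ N) =
      ellGamma p q (q * τ / c) * ellGamma p q (p * (q * τ / b)) / (ellGamma p q (q * a / c) *
        ellGamma p q (p * q * a / b)) * entryD p q k (q * τ / c) (q * τ / b) N := by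
    rw [ellGamma4_mul_pow hp0 hp1 hq0 hq1 (mul_ne_zero hr0 (inv_ne_zero ht0)) hy0
      (mul_ne_zero hst0 hz0) (norm_mul_lt_one hst1 hz1.le) ht'.1
      ht'.2 (by rw [hinv _ ht0]; exact ht''.1) (by rw [hinv _ ht0]; exact ht''.2)
      hD₃, hinv _ ht0, show r * t⁻¹ * y * (s * t * z₀) = q * τ / c by rw [← eqc]; field_simp,
      show r * t⁻¹ * y⁻¹ * (s * t * z₀) = p * (q * τ / b) by rw [← epb]; field_simp,
      show r * t * y * (s * t * z₀) = q * a / c by rw [← eqa]; ring,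
      show r * t * y⁻¹ * (s * t * z₀) = p * q * a / b by rw [← epa]; ring, hpb, hk]
  rw [eqc] at hΓ₁
  rw [epb] at hΓ₂
  rw [← ha] at hΓa
  have hbal : k * b * c = q * a * τ := by
    rw [hk, hb, hc, ha, hτ]
    field_simp
    linear_combination hr
  have ek : (s * t) ^ 2 * z₀ ^ 2 = k := by rw [hk]; ring
  have ek' : s ^ 2 * (t * z₀) ^ 2 = k := by rw [hk]; ring
  have ea : t ^ 2 * z₀ ^ 2 = a := by rw [ha]; ring
  refine ⟨?_, ?_, hbal, fun α res hα => ⟨?_, ?_⟩, ?_⟩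
  · rw [hb, hτ, ha, hk]
    field_simp
    linear_combination hr
  · rw [hc, hτ, ha, hk]
    field_simp
    linear_combination hr
  · obtain ⟨F, hF, hlim⟩ := exists_continuation_starLHS hp0 hp1 hq0 hq1 hr0 hs0 hs1 ht0 ht1 hy0
      hΓs hΓt hy1 hy2 hz0 hz1 hpq hgz hgx hD₁ hα
    refine ⟨F, hF, ?_⟩
    convert hlim using 2
    rw [Finset.mul_sum, Finset.sum_range]
    refine Finset.sum_congr rfl fun n _ => ?_
    rw [Finset.sum_range, Finset.mul_sum, Finset.mul_sum, Finset.sum_mul]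
    refine Finset.sum_congr rfl fun m _ => ?_
    rw [v₁ n (Nat.le_of_lt_succ n.2), ea, ek', ← ha, ← hτ]
    simp only [matM, Matrix.of_apply, Fin.val_last, prefactor]
    have hqn := mul_inv_cancel₀ (pow_ne_zero ((n : ℕ) * (n + 1)) hq0)
    have hΓa' := mul_inv_cancel₀ hΓa
    generalize ellGamma p q a = A at hΓa'
    generalize q ^ ((n : ℕ) * (n + 1)) = Q at hqn
    simp only [div_eq_mul_inv, mul_inv]
    have e : A * A⁻¹ * (Q * Q⁻¹) = 1 := by rw [hΓa', hqn, one_mul]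
    refine (mul_one _).symm.trans ?_
    rw [← e]
    ring
  · obtain ⟨G, hG, hlim⟩ := exists_continuation_starRHS hp0 hp1 hq0 hq1 hr0 hs0 hs1 ht0 ht1 hy0
      hΓst hs'.1 hs'.2 ht'.1 ht'.2 hz0 hz1 hpq hgz hD₂ hD₃ hα
    refine ⟨G, hG, ?_⟩
    convert hlim using 2
    rw [Finset.mul_sum, Finset.sum_range, Finset.mul_sum]
    refine Finset.sum_congr rfl fun m _ => ?_
    rw [v₂ m (Nat.le_of_lt_succ m.2), v₃, ek, ← hτ]
    simp only [matM, Matrix.of_apply, Fin.val_last, prefactor]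
    have h1 := mul_inv_cancel₀ hΓ₁
    have h2 := mul_inv_cancel₀ hΓ₂
    generalize ellGamma p q (q * τ / c) = A at h1
    generalize ellGamma p q (p * (q * τ / b)) = B at h2
    simp only [div_eq_mul_inv, mul_inv]
    have e : A * A⁻¹ * (B * B⁻¹) = 1 := by rw [h1, h2, one_mul]
    refine (mul_one _).symm.trans ?_
    rw [← e]
    ring
  · have hgen := starGeneric_of_notMem hp0 hp1 hq0 hq1 hr hs0 hs1 ht0 ht1 hy0
      (by simpa using hr1.1) (by simpa using hr1.2) hz0 hz1 hpq hgz hgx hD₁ hD₂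
    rw [← hτ, ← ha, ← hb, ← hc] at hgen
    refine matrix_star_triangle hp0 hp1 hq0 ?_ ?_ ?_ ?_ ?_ hbal hgen
    · rw [hk]; positivity
    · rw [ha]; positivity
    · rw [hb]; positivity
    · rw [hc]; positivity
    · rw [hτ]; positivity
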